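/- **Setting.** An instance $(G,C,\chi,s,t,k)$ of \textsc{Colored Path}$^\star$ consists of a finite simple planar graph $G$, a finite set $C\subset\mathbb N$ of colors, a map $\chi:V(G)\to 2^C$ such that for every $c\in C$ the vertices $v$ with $c\in\chi(v)$ induce a connected (possibly empty) subgraph of $G$, two vertices $s,t\in V(G)$, and $k\in\mathbb N$. For a walk $W$, $\chi(W)$ is the union of $\chi(w)$ over the vertices $w$ of $W$. $G$ is *irreducible under color contraction* if no two adjacent vertices $x,y$ have $\chi(x)=\chi(y)$. A color set $p\subseteq C$ is *$s$-reachable* if there is a path $P$ starting in $s$ with $\chi(P)=p$. A vertex $u$ is *reachable from $s$ by $p$* if there is an $s$-$u$ path $P$ with $\chi(P)\subseteq p$. For $v\in V(G)$ and a $v$-$t$ walk $Q$, the set $p$ *minimally completes* $Q$ if * there is an $s$-$v$ path $P$ with $\chi(P)=p$, * $|p\cup\chi(Q)|\le k$, * no vertex of $Q$ after its first one is reachable from $s$ by $p$ (so $Q$ does not return to $v$), and * there is no $s$-$v$ path $P'$ with $\chi(P')\subsetneq p$. A family $\mathcal P'$ of color sets *$k$-represents* a family $\mathcal P$ with respect to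 $v$ if for every $p\in\mathcal P$ and every $v$-$t$ walk $Q$ such that $p$ minimally completes $Q$ there is $p'\in\mathcal P'$ with $|p'\cup\chi(Q)|\le k$, $p'\cap\chi(Q)\supseteq p\cap\chi(Q)$, and an $s$-$v$ path $P'$ with $\chi(P')=p'$. **Lemma.** There are a function $f:\mathbb N\to\mathbb N$ with $f(k)=2^{O(k^2\log k)}$ and an algorithm with the following property. Let $(G,C,\chi,s,t,k)$ be an instance of \textsc{Colored Path}$^\star$ such that $G$ is irreducible under color contraction, let $v\in V(G)$, let $\ell\le k$, and let $\mathcal P$ be a family of pairwise disjoint $s$-reachable color sets of size $\ell$. If $|\mathcal P|>f(k)$, then the algorithm, given the instance, $v$ and $\mathcal P$, finds in time polynomial in $|\mathcal P|+|V(G)|$ a set $p\in\mathcal P$ such that $\mathcal P\setminus\{p\}$ $k$-represents $\mathcal P$ with respect to $v$. (Time is counted on a random access machine that adds, subtracts, compares and copies numbers, and reads an entry of the input, in unit time.) -/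

import Mathlib

/-! ### Planar graphs -/

/-- `A` is a polygonal arc from `a` to `b`: a union of finitely many nondegenerate straight line
segments `[pt i, pt (i + 1)]`, `i < m`, in which two segments meet only if they are consecutive,
and then only in their common endpoint. -/
def IsPolygonalArc (A : Set (ℝ × ℝ)) (a b : ℝ × ℝ) : Prop :=
  ∃ (m : ℕ) (pt : ℕ → ℝ × ℝ),
    0 < m ∧ pt 0 = a ∧ pt m = b ∧
    (∀ i < m, pt i ≠ pt (i + 1)) ∧
    (∀ i j, i < j → j < m →
      ∀ x ∈ segment ℝ (pt i) (pt (i + 1)) ∩ segment ℝ (pt j) (pt (j + 1)),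
        j = i + 1 ∧ x = pt j) ∧
    A = ⋃ i ∈ Finset.range m, segment ℝ (pt i) (pt (i + 1))

/-- A drawing of `G` in the plane: distinct vertices are distinct points, the edge `uv` is an arc
from `u` to `v` that contains no other vertex, and two edges meet only in common endpoints. -/
structure PlaneDrawing {V : Type*} (G : SimpleGraph V) where
  pos : V → ℝ × ℝ
  arc : Sym2 V → Set (ℝ × ℝ)
  pos_injective : Function.Injective pos
  isArc : ∀ u v, G.Adj u v → IsPolygonalArc (arc s(u, v)) (pos u) (pos v)
  vertex_of_mem : ∀ u v w, G.Adj u v → pos w ∈ arc s(u, v) → w = u ∨ w = v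
  edges_meet : ∀ e ∈ G.edgeSet, ∀ f ∈ G.edgeSet, e ≠ f →
    ∀ x ∈ arc e ∩ arc f, ∃ w, w ∈ e ∧ w ∈ f ∧ x = pos w

/-- `G` can be drawn in the plane without edge intersections (except at endpoints). -/
def IsPlanarGraph {V : Type*} (G : SimpleGraph V) : Prop :=
  Nonempty (PlaneDrawing G)

/-! ### Instances of Colored Path* -/

/-- An instance `(G, C, χ, s, t, k)` with vertex set `{0, …, n - 1}`: a planar graph `G`, a finite
set `C` of colors, a color set `χ v ⊆ C` for every vertex `v`, such that every color induces a
connected (possibly empty) subgraph. -/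
structure ColoredPathStar (n : ℕ) where
  G : SimpleGraph (Fin n)
  C : Finset ℕ
  χ : Fin n → Finset ℕ
  s : Fin n
  t : Fin n
  k : ℕ
  χ_subset : ∀ v, χ v ⊆ C
  planar : IsPlanarGraph G
  colorConnected : ∀ c ∈ C, (G.induce {v | c ∈ χ v}).Preconnected

namespace ColoredPathStar

variable {n : ℕ} (I : ColoredPathStar n)

/-- The color contraction operation is applicable to `x` and `y`. -/
def ColorContractible (x y : Fin n) : Prop :=
  I.G.Adj x y ∧ I.χ x = I.χ y

/-- `G` is irreducible with respect to color contraction. -/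
def Irreducible : Prop :=
  ¬ ∃ x y, I.ColorContractible x y

/-- The set `χ(W)` of colors that appear on the vertices of the walk `W`. -/
def colors {u v : Fin n} (W : I.G.Walk u v) : Finset ℕ :=
  W.support.toFinset.biUnion I.χ

/-- Some path from `u` to `v` has exactly the color set `p`. -/
def HasPath (u v : Fin n) (p : Finset ℕ) : Prop :=
  ∃ W : I.G.Walk u v, W.IsPath ∧ I.colors W = p

/-- The vertex `u` is reachable from `v` by the color set `p`. -/
def ReachableBy (v u : Fin n) (p : Finset ℕ) : Prop :=
  ∃ W : I.G.Walk v u, W.IsPath ∧ I.colors W ⊆ p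

/-- The color set `p` is `s`-reachable: it is the color set of a path that starts in `s`. -/
def SReachable (p : Finset ℕ) : Prop :=
  ∃ u, I.HasPath I.s u p

/-- The color set `p` completes the `v`-`t` walk `Q`. The last clause says that `v`, in its role
as the first vertex of `Q`, is the only vertex on `Q` that is reachable from `s` by `p`; in
particular `Q` does not return to `v`. -/
def Completes (p : Finset ℕ) {v : Fin n} (Q : I.G.Walk v I.t) : Prop :=
  I.HasPath I.s v p ∧
  (p ∪ I.colors Q).card ≤ I.k ∧
  ∀ w ∈ Q.support.tail, ¬ I.ReachableBy I.s w p

/-- The color set `p` minimally completes the `v`-`t` walk `Q`. -/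
def MinimallyCompletes (p : Finset ℕ) {v : Fin n} (Q : I.G.Walk v I.t) : Prop :=
  I.Completes p Q ∧ ¬ ∃ p', p' ⊂ p ∧ I.HasPath I.s v p'

/-- The family `P'` `k`-represents the family `P` with respect to `v`. -/
def KRepresents (P' P : Finset (Finset ℕ)) (v : Fin n) : Prop :=
  ∀ p ∈ P, ∀ Q : I.G.Walk v I.t, I.MinimallyCompletes p Q →
    ∃ p' ∈ P', (p' ∪ I.colors Q).card ≤ I.k ∧
      p ∩ I.colors Q ⊆ p' ∩ I.colors Q ∧ I.HasPath I.s v p'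

end ColoredPathStar

/-! ### Random access machines

Structured programs for a random access machine whose memory cells hold natural numbers. The input
is a read-only sequence of arrays of natural numbers. Every instruction and every test costs one
step; there is no multiplication. -/

inductive RamProgram : Type
  /-- `mem[d] := c` -/
  | const (d c : ℕ)
  /-- `mem[d] := mem[a] + mem[b]` -/
  | add (d a b : ℕ)
  /-- `mem[d] := max (mem[a] - mem[b]) 0` -/
  | sub (d a b : ℕ)
  /-- `mem[d] := mem[mem[a]]` -/
  | load (d a : ℕ)
  /-- `mem[mem[d]] := mem[a]` -/
  | store (d a : ℕ)
  /-- `mem[d] := input[mem[a]][mem[b]]`, and `0` if there is no such entry -/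
  | read (d a b : ℕ)
  /-- sequential composition -/
  | seq (A B : RamProgram)
  /-- `if mem[a] ≠ 0 then A else B` -/
  | cond (a : ℕ) (A B : RamProgram)
  /-- `while mem[a] ≠ 0 do A` -/
  | loop (a : ℕ) (A : RamProgram)

/-- `RamExec input A m T m'`: on the given input, the program `A` started with memory contents `m`
halts after exactly `T` steps with memory contents `m'`. -/
inductive RamExec (input : List (List ℕ)) :
    RamProgram → (ℕ → ℕ) → ℕ → (ℕ → ℕ) → Prop
  | const (d c : ℕ) (m : ℕ → ℕ) :
      RamExec input (.const d c) m 1 (Function.update m d c)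
  | add (d a b : ℕ) (m : ℕ → ℕ) :
      RamExec input (.add d a b) m 1 (Function.update m d (m a + m b))
  | sub (d a b : ℕ) (m : ℕ → ℕ) :
      RamExec input (.sub d a b) m 1 (Function.update m d (m a - m b))
  | load (d a : ℕ) (m : ℕ → ℕ) :
      RamExec input (.load d a) m 1 (Function.update m d (m (m a)))
  | store (d a : ℕ) (m : ℕ → ℕ) :
      RamExec input (.store d a) m 1 (Function.update m (m d) (m a))
  | read (d a b : ℕ) (m : ℕ → ℕ) :
      RamExec input (.read d a b) m 1
        (Function.update m d ((input.getD (m a) []).getD (m b) 0))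
  | seq {A B : RamProgram} {m₁ m₂ m₃ : ℕ → ℕ} {T₁ T₂ : ℕ} :
      RamExec input A m₁ T₁ m₂ → RamExec input B m₂ T₂ m₃ →
      RamExec input (.seq A B) m₁ (T₁ + T₂) m₃
  | cond_true {a : ℕ} {A B : RamProgram} {m₁ m₂ : ℕ → ℕ} {T : ℕ} :
      m₁ a ≠ 0 → RamExec input A m₁ T m₂ →
      RamExec input (.cond a A B) m₁ (T + 1) m₂
  | cond_false {a : ℕ} {A B : RamProgram} {m₁ m₂ : ℕ → ℕ} {T : ℕ} :
      m₁ a = 0 → RamExec input B m₁ T m₂ →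
      RamExec input (.cond a A B) m₁ (T + 1) m₂
  | loop_done {a : ℕ} {A : RamProgram} {m : ℕ → ℕ} :
      m a = 0 → RamExec input (.loop a A) m 1 m
  | loop_step {a : ℕ} {A : RamProgram} {m₁ m₂ m₃ : ℕ → ℕ} {T₁ T₂ : ℕ} :
      m₁ a ≠ 0 → RamExec input A m₁ T₁ m₂ → RamExec input (.loop a A) m₂ T₂ m₃ →
      RamExec input (.loop a A) m₁ (T₁ + T₂ + 1) m₃

/-! ### Input format -/

/-- A color set is given by its size, followed by its elements in increasing order. -/
def encodeColorSet (A : Finset ℕ) : List ℕ :=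
  A.card :: A.sort (· ≤ ·)

open Classical in
/-- The input `(G, C, χ, s, t, k)`, `v`, `P` (with its sets listed as `L`) as a sequence of arrays:
the numbers `n, |P|, s, t, v, k`; the color set `C`; the `n` rows of the adjacency matrix of `G`;
the color sets of the `n` vertices; the sets in `P`. -/
noncomputable def encodeInput {n : ℕ} (I : ColoredPathStar n) (v : Fin n)
    (L : List (Finset ℕ)) : List (List ℕ) :=
  [n, L.length, I.s, I.t, v, I.k] ::
  encodeColorSet I.C ::
  ((List.finRange n).map fun u =>
    (List.finRange n).map fun w => if I.G.Adj u w then 1 else 0) ++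
  ((List.finRange n).map fun u => encodeColorSet (I.χ u)) ++
  (L.map encodeColorSet)

/-! A set may be dropped for one of two reasons. If it does not reach `v`, or stays able to reach
`v` after losing a color, it minimally completes nothing (`NonMinimal.not_minimallyCompletes`).
Otherwise suppose that every set of the family is minimal, and that `t` cannot be linked to a color
of `p` in `3 * k` steps (along edges or shared colors) through vertices that have at most `k` colors
and are not uncolored vertices reached by `p`. Then `p` shares no color with any walk `Q` that it
minimally completes: the part of `Q` from a common color on would, by irreducibility, shorten to
such a link (`Irreducible.expand_of_walk`). Hence any other set of the family, having the same size,
replaces `p` (`kRepresents_erase`).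

It remains to see that a large family of minimal sets has an unlinked member
(`exists_not_linkedToTarget_of_paths`). Take `s`-`v` paths with these color sets; since the colors
are disjoint, paths can only share uncolored vertices. Collect hubs, uncolored vertices passed in
the same order by many paths, as long as enough paths survive (`exists_maximal_hubSystem`). There
are at most `k` hubs, because on some path the colored vertices that follow the hubs have distinct
colors (`HubSystem.card_le`). All vertices other than hubs and `v` are then on few of the surviving
paths. If every set were linked to `t`, many paths would share the last hub `b` before the start of
their link, and from the vertex after `b` each would have a walk to `t` that meets few paths
(`exists_walk_of_expand`). Three of these walks avoid each other's paths (`exists_three_unrelated`),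
which planarity forbids.

The planarity fact `IsPlanarGraph.false_of_three_paths` is proved with winding numbers, so the three
paths may cross freely. The difference of the angles under which two `a`-`b` arcs are seen is
constant along a connected set that avoids both (`AngleAlong.sub_eq_sub`). Carried along the third
walk to `t`, the three cyclic differences cancel; evaluated near `a`, they cannot
(`angleFrom_sum_ne_zero`).

Both tests are breadth-first searches, and `runs_findRedundantSet` analyses a program that runs them
on all sets. Vertices with more than `k` colors are discarded by size alone, and `k` is less than
the size of the family, so the time does not depend on the total number of colors. -/

/-! ### Angles along polygonal arcs -/

open Complex in
/-- The identification of `ℝ × ℝ` with the complex plane. -/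
noncomputable def planeToComplex : (ℝ × ℝ) →L[ℝ] ℂ :=
  Complex.equivRealProdCLM.symm.toContinuousLinearMap

lemma planeToComplex_eq_zero {x : ℝ × ℝ} : planeToComplex x = 0 ↔ x = 0 := by
  simp [planeToComplex]

lemma planeToComplex_sub_ne_zero {x y : ℝ × ℝ} (h : x ≠ y) : planeToComplex (x - y) ≠ 0 := by
  rw [Ne, planeToComplex_eq_zero, sub_eq_zero]
  exact h

/-- `θ x` is a continuous choice, for `x` off the closed set `S`, of the angle under which an arc
from `a` to `b` is seen from `x`. -/
def AngleAlong (S : Set (ℝ × ℝ)) (a b : ℝ × ℝ) (θ : ℝ × ℝ → ℝ) : Prop :=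
  IsClosed S ∧ ContinuousOn θ Sᶜ ∧
    ∀ x, x ∉ S → (θ x : Real.Angle) = (planeToComplex (b - x)).arg - (planeToComplex (a - x)).arg

lemma AngleAlong.refl (a : ℝ × ℝ) : AngleAlong ∅ a a (fun _ => 0) :=
  ⟨isClosed_empty, continuousOn_const, fun x _ => by simp⟩

lemma AngleAlong.trans {S T : Set (ℝ × ℝ)} {a b c : ℝ × ℝ} {θ ψ : ℝ × ℝ → ℝ}
    (h : AngleAlong S a b θ) (h' : AngleAlong T b c ψ) :
    AngleAlong (S ∪ T) a c (fun x => θ x + ψ x) := by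
  refine ⟨h.1.union h'.1, ?_, fun x hx => ?_⟩
  · exact (h.2.1.mono (Set.compl_subset_compl.2 Set.subset_union_left)).add
      (h'.2.1.mono (Set.compl_subset_compl.2 Set.subset_union_right))
  · rw [Set.mem_union, not_or] at hx
    rw [Real.Angle.coe_add, h.2.2 x hx.1, h'.2.2 x hx.2]
    abel

lemma isClosed_segment_plane (a b : ℝ × ℝ) : IsClosed (segment ℝ a b) := by
  rw [segment_eq_image_lineMap]
  exact (isCompact_Icc.image (by fun_prop)).isClosed

/-- If the quotient were a real number `r ≤ 0`, then `x = (b - r a) / (1 - r)` would be a convex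
combination of `a` and `b`. Consequently the principal argument is a continuous choice of angle off
the segment. -/
lemma div_mem_slitPlane_of_notMem_segment {a b x : ℝ × ℝ} (hx : x ∉ segment ℝ a b) :
    planeToComplex (b - x) / planeToComplex (a - x) ∈ Complex.slitPlane := by
  have hax : a ≠ x := by
    rintro rfl
    exact hx (left_mem_segment ℝ _ _)
  have h0 := planeToComplex_sub_ne_zero hax
  by_contra h
  rw [Complex.mem_slitPlane_iff, not_or, not_lt, not_not] at h
  set w := planeToComplex (b - x) / planeToComplex (a - x) with hw
  have hw' : w = ((w.re : ℝ) : ℂ) := by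
    apply Complex.ext <;> simp [h.2]
  have h1 : planeToComplex (b - x) = w.re • planeToComplex (a - x) := by
    rw [Complex.real_smul, ← hw', hw, div_mul_cancel₀ _ h0]
  rw [← map_smul, ← sub_eq_zero, ← map_sub, planeToComplex_eq_zero, sub_eq_zero] at h1
  apply hx
  have hpos : 0 < 1 - w.re := by linarith [h.1]
  refine ⟨-w.re / (1 - w.re), 1 / (1 - w.re), div_nonneg (by linarith [h.1]) hpos.le,
    by positivity, by field_simp; ring, ?_⟩
  have h2 : (1 - w.re) • x = b - w.re • a := by
    have : b = x + w.re • (a - x) := by rw [← h1]; abel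
    rw [this]
    module
  have h3 : x = (1 / (1 - w.re)) • (b - w.re • a) := by
    rw [← h2, smul_smul, one_div_mul_cancel hpos.ne', one_smul]
  conv_rhs => rw [h3]
  module

lemma AngleAlong.segment (a b : ℝ × ℝ) : AngleAlong (segment ℝ a b) a b
    (fun x => (planeToComplex (b - x) / planeToComplex (a - x)).arg) := by
  refine ⟨isClosed_segment_plane a b, ?_, fun x hx => ?_⟩
  · intro x hx
    have hax : a ≠ x := by
      rintro rfl
      exact hx (left_mem_segment ℝ _ _)
    apply ContinuousAt.continuousWithinAt
    apply ContinuousAt.comp (f := fun x => planeToComplex (b - x) / planeToComplex (a - x))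
      (Complex.continuousAt_arg (div_mem_slitPlane_of_notMem_segment hx))
    exact ContinuousAt.div (by fun_prop) (by fun_prop) (planeToComplex_sub_ne_zero hax)
  · have hax : a ≠ x := by
      rintro rfl
      exact hx (left_mem_segment ℝ _ _)
    have hbx : b ≠ x := by
      rintro rfl
      exact hx (right_mem_segment ℝ _ _)
    exact Complex.arg_div_coe_angle (planeToComplex_sub_ne_zero hbx)
      (planeToComplex_sub_ne_zero hax)

/-- The image of `K` is order connected; two different values would be at least `2π` apart, so the
smaller one plus `π` would also be a value. -/
lemma IsPreconnected.eq_of_sub_mem_two_pi {K : Set (ℝ × ℝ)} (hK : IsPreconnected K)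
    {f : ℝ × ℝ → ℝ} (hf : ContinuousOn f K) (h2 : ∀ x ∈ K, ∃ m : ℤ, f x = 2 * Real.pi * m)
    {x y : ℝ × ℝ} (hx : x ∈ K) (hy : y ∈ K) : f x = f y := by
  wlog hlt : f x < f y generalizing x y
  · rcases lt_trichotomy (f x) (f y) with h | h | h
    · exact absurd h hlt
    · exact h
    · exact (this hy hx h).symm
  exfalso
  have hpi := Real.pi_pos
  obtain ⟨m, hm⟩ := h2 x hx
  obtain ⟨m', hm'⟩ := h2 y hy
  have hmm : (m : ℝ) < m' := by
    rw [hm, hm'] at hlt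
    exact lt_of_mul_lt_mul_left hlt (by positivity)
  have hmm' : (m : ℝ) + 1 ≤ m' := by
    have : m < m' := by exact_mod_cast hmm
    exact_mod_cast this
  have hI := isPreconnected_iff_ordConnected.1 (hK.image f hf)
  have hmem : f x + Real.pi ∈ f '' K := by
    apply hI.out ⟨x, hx, rfl⟩ ⟨y, hy, rfl⟩
    constructor
    · linarith
    · rw [hm, hm']
      nlinarith
  obtain ⟨z, hz, hfz⟩ := hmem
  obtain ⟨q, hq⟩ := h2 z hz
  rw [hq, hm] at hfz
  have h3 : Real.pi * (2 * q - 2 * m - 1) = 0 := by linarith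
  rcases mul_eq_zero.1 h3 with h4 | h4
  · exact hpi.ne' h4
  · have : (2 * q - 2 * m - 1 : ℤ) = 0 := by exact_mod_cast h4
    omega

/-- Up to a factor `2π` the difference is the winding number of the closed curve formed by the two
arcs; both angles have the same class modulo `2π`, so it is a continuous integer multiple of `2π`.
-/
lemma AngleAlong.sub_eq_sub {S T K : Set (ℝ × ℝ)} {a b : ℝ × ℝ} {θ ψ : ℝ × ℝ → ℝ}
    (h : AngleAlong S a b θ) (h' : AngleAlong T a b ψ) (hK : IsPreconnected K)
    (hS : ∀ x ∈ K, x ∉ S) (hT : ∀ x ∈ K, x ∉ T) {x y : ℝ × ℝ} (hx : x ∈ K) (hy : y ∈ K) :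
    θ x - ψ x = θ y - ψ y := by
  refine hK.eq_of_sub_mem_two_pi (f := fun x => θ x - ψ x)
    ((h.2.1.mono hS).sub (h'.2.1.mono hT)) (fun z hz => ?_) hx hy
  apply Real.Angle.angle_eq_iff_two_pi_dvd_sub.1
  rw [h.2.2 z (hS z hz), h'.2.2 z (hT z hz)]

/-- The angle under which the arc that consists of `[a, p]` and an arc with angle `ψ` is seen. -/
noncomputable def angleFrom (a p : ℝ × ℝ) (ψ : ℝ × ℝ → ℝ) (x : ℝ × ℝ) : ℝ :=
  (planeToComplex (p - x) / planeToComplex (a - x)).arg + ψ x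

lemma AngleAlong.angleFrom {S : Set (ℝ × ℝ)} {p b : ℝ × ℝ} {ψ : ℝ × ℝ → ℝ}
    (h : AngleAlong S p b ψ) (a : ℝ × ℝ) :
    AngleAlong (_root_.segment ℝ a p ∪ S) a b (angleFrom a p ψ) :=
  (AngleAlong.segment a p).trans h

-- Each angle jumps at `a`, but has a limit along a ray leaving `a`. On the ray, `a - x = -ε (p -
-- a)`, and the positive factor `ε` does not affect the argument.
open Filter Topology in
lemma angleFrom_tendsto {S : Set (ℝ × ℝ)} {a b p q : ℝ × ℝ} {ψ : ℝ × ℝ → ℝ}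
    (h : AngleAlong S q b ψ) (ha : a ∉ S) (hp : a ≠ p)
    (hs : -planeToComplex (q - a) / planeToComplex (p - a) ∈ Complex.slitPlane) :
    Tendsto (fun ε : ℝ => angleFrom a q ψ (a + ε • (p - a))) (𝓝[>] 0)
      (𝓝 ((-planeToComplex (q - a) / planeToComplex (p - a)).arg + ψ a)) := by
  have hp0 := planeToComplex_sub_ne_zero hp.symm
  have hx : Tendsto (fun ε : ℝ => a + ε • (p - a)) (𝓝 0) (𝓝 a) := by
    have : ContinuousAt (fun ε : ℝ => a + ε • (p - a)) 0 := by fun_prop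
    simpa [ContinuousAt] using this
  have h1 : Tendsto (fun ε : ℝ => ψ (a + ε • (p - a))) (𝓝 0) (𝓝 (ψ a)) :=
    ((h.2.1.continuousAt (h.1.isOpen_compl.mem_nhds ha)).tendsto).comp hx
  have h2 : Tendsto (fun ε : ℝ =>
      (-planeToComplex (q - (a + ε • (p - a))) / planeToComplex (p - a)).arg) (𝓝 0)
      (𝓝 (-planeToComplex (q - a) / planeToComplex (p - a)).arg) := by
    refine (Complex.continuousAt_arg hs).tendsto.comp ?_
    refine Tendsto.div_const ?_ _
    refine Tendsto.neg ?_
    exact (planeToComplex.continuous.tendsto _).comp (tendsto_const_nhds.sub hx)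
  refine ((h2.add h1).mono_left nhdsWithin_le_nhds).congr' ?_
  filter_upwards [self_mem_nhdsWithin] with ε hε
  have hε : 0 < ε := hε
  have h3 : planeToComplex (a - (a + ε • (p - a))) = -(ε : ℂ) * planeToComplex (p - a) := by
    rw [sub_add_cancel_left, map_neg, map_smul, Complex.real_smul, neg_mul]
  rw [angleFrom, h3]
  congr 1
  rw [← Complex.arg_real_mul (planeToComplex (q - (a + ε • (p - a))) /
    (-(ε : ℂ) * planeToComplex (p - a))) hε]
  congr 1
  have : (ε : ℂ) ≠ 0 := by exact_mod_cast hε.ne'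
  field_simp

lemma ne_of_ray_notMem {a p q : ℝ × ℝ}
    (H : ∀ ε : ℝ, 0 < ε → ε ≤ 1 → a + ε • (p - a) ∉ segment ℝ a q) : a ≠ p := by
  rintro rfl
  exact H 1 one_pos le_rfl (by simpa using left_mem_segment ℝ _ _)

/-- Otherwise `q - a` would be a positive multiple `r` of `p - a`; then the ray towards `p` meets
`[a, q]` at `q` if `r ≤ 1`, and at `p` if `r ≥ 1`. -/
lemma neg_div_mem_slitPlane {a p q : ℝ × ℝ}
    (H : ∀ ε : ℝ, 0 < ε → ε ≤ 1 → a + ε • (p - a) ∉ segment ℝ a q) (hq : a ≠ q) :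
    -planeToComplex (q - a) / planeToComplex (p - a) ∈ Complex.slitPlane := by
  have hp0 := planeToComplex_sub_ne_zero (ne_of_ray_notMem H).symm
  have hq0 := planeToComplex_sub_ne_zero hq.symm
  by_contra h
  rw [Complex.mem_slitPlane_iff, not_or, not_lt, not_not] at h
  set w := -planeToComplex (q - a) / planeToComplex (p - a) with hw
  have hw' : w = ((w.re : ℝ) : ℂ) := by
    apply Complex.ext <;> simp [h.2]
  have h1 : planeToComplex (q - a) = (-w.re) • planeToComplex (p - a) := by
    rw [Complex.real_smul, Complex.ofReal_neg, ← hw', hw]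
    field_simp
  have hr : 0 < -w.re := by
    rcases lt_or_eq_of_le h.1 with h2 | h2
    · linarith
    · rw [h2] at h1
      simp at h1
      exact absurd h1 hq0
  rw [← map_smul, ← sub_eq_zero, ← map_sub, planeToComplex_eq_zero, sub_eq_zero] at h1
  set r := -w.re
  have hmem : ∀ ε : ℝ, 0 ≤ ε → ε ≤ 1 → a + ε • (q - a) ∈ segment ℝ a q := by
    intro ε h0 h1
    refine ⟨1 - ε, ε, by linarith, h0, by ring, by module⟩
  rcases le_total r 1 with h2 | h2
  · apply H r hr h2
    rw [← h1]
    simpa using hmem 1 zero_le_one le_rfl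
  · apply H 1 one_pos le_rfl
    have h3 := hmem r⁻¹ (by positivity) (inv_le_one_of_one_le₀ h2)
    rwa [h1, smul_smul, inv_mul_cancel₀ hr.ne'] at h3

-- The difference of the two angles is constant on the half-open segment from `a` to `p`, hence its
-- value at `p` can be read off from the limit at `a`.
open Filter Topology in
lemma angleFrom_sub_eq {S T : Set (ℝ × ℝ)} {a b p q r : ℝ × ℝ} {ψ φ : ℝ × ℝ → ℝ}
    (h : AngleAlong S q b ψ) (h' : AngleAlong T r b φ) (haS : a ∉ S) (haT : a ∉ T)
    (hq : a ≠ q) (hr : a ≠ r)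
    (HS : ∀ ε : ℝ, 0 < ε → ε ≤ 1 → a + ε • (p - a) ∉ segment ℝ a q ∪ S)
    (HT : ∀ ε : ℝ, 0 < ε → ε ≤ 1 → a + ε • (p - a) ∉ segment ℝ a r ∪ T) :
    angleFrom a q ψ p - angleFrom a r φ p =
      ((-planeToComplex (q - a) / planeToComplex (p - a)).arg + ψ a) -
      ((-planeToComplex (r - a) / planeToComplex (p - a)).arg + φ a) := by
  have Hq : ∀ ε : ℝ, 0 < ε → ε ≤ 1 → a + ε • (p - a) ∉ segment ℝ a q :=
    fun ε h0 h1 hm => HS ε h0 h1 (Or.inl hm)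
  have Hr : ∀ ε : ℝ, 0 < ε → ε ≤ 1 → a + ε • (p - a) ∉ segment ℝ a r :=
    fun ε h0 h1 hm => HT ε h0 h1 (Or.inl hm)
  have hp := ne_of_ray_notMem Hq
  have hlim := (angleFrom_tendsto h haS hp (neg_div_mem_slitPlane Hq hq)).sub
    (angleFrom_tendsto h' haT hp (neg_div_mem_slitPlane Hr hr))
  refine (tendsto_nhds_unique_of_eventuallyEq hlim tendsto_const_nhds ?_).symm
  have hK : IsPreconnected ((fun ε : ℝ => a + ε • (p - a)) '' Set.Ioc 0 1) :=
    isPreconnected_Ioc.image _ (by fun_prop)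
  have hIoc : Set.Ioc (0 : ℝ) 1 ∈ 𝓝[>] (0 : ℝ) := Ioc_mem_nhdsGT one_pos
  filter_upwards [hIoc] with ε hε
  refine (h.angleFrom a).sub_eq_sub (h'.angleFrom a) hK ?_ ?_ ⟨ε, hε, rfl⟩
    ⟨1, ⟨one_pos, le_rfl⟩, by simp⟩
  · rintro _ ⟨δ, hδ, rfl⟩
    exact HS δ hδ.1 hδ.2
  · rintro _ ⟨δ, hδ, rfl⟩
    exact HT δ hδ.1 hδ.2

lemma arg_neg_div_add {z w : ℂ} (h : -z / w ∈ Complex.slitPlane) :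
    (-w / z).arg = -(-z / w).arg := by
  have h1 : -w / z = (-z / w)⁻¹ := by rw [inv_div, neg_div, div_neg]
  rw [h1, Complex.arg_inv, if_neg (Complex.slitPlane_arg_ne_pi h)]

lemma mul_neg_div_cycle {x y z : ℂ} (hx : x ≠ 0) (hy : y ≠ 0) (hz : z ≠ 0) :
    -y / x * (-z / y) * (-x / z) = -1 := by
  field_simp

/-- Three arcs from `a` to `b` whose first segments leave `a` in different directions: the numbers
of turns of the three closed curves formed by two of them, each around the first segment of the
third, do not add up to zero. -/
theorem angleFrom_sum_ne_zero {S : Fin 3 → Set (ℝ × ℝ)} {a b : ℝ × ℝ} {p : Fin 3 → ℝ × ℝ}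
    {ψ : Fin 3 → ℝ × ℝ → ℝ} (h : ∀ i, AngleAlong (S i) (p i) b (ψ i)) (ha : ∀ i, a ∉ S i)
    (H : ∀ i j, i ≠ j → ∀ ε : ℝ, 0 < ε → ε ≤ 1 →
      a + ε • (p i - a) ∉ segment ℝ a (p j) ∪ S j) :
    (angleFrom a (p 1) (ψ 1) (p 0) - angleFrom a (p 2) (ψ 2) (p 0)) +
    (angleFrom a (p 2) (ψ 2) (p 1) - angleFrom a (p 0) (ψ 0) (p 1)) +
    (angleFrom a (p 0) (ψ 0) (p 2) - angleFrom a (p 1) (ψ 1) (p 2)) ≠ 0 := by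
  have H' : ∀ i j, i ≠ j → ∀ ε : ℝ, 0 < ε → ε ≤ 1 → a + ε • (p i - a) ∉ segment ℝ a (p j) :=
    fun i j hij ε h0 h1 hm => H i j hij ε h0 h1 (Or.inl hm)
  have hp : ∀ i, a ≠ p i := by
    intro i
    obtain ⟨j, hj⟩ : ∃ j : Fin 3, i ≠ j := by
      fin_cases i
      exacts [⟨1, by decide⟩, ⟨0, by decide⟩, ⟨0, by decide⟩]
    exact ne_of_ray_notMem (H' i j hj)
  have hz : ∀ i, planeToComplex (p i - a) ≠ 0 := fun i => planeToComplex_sub_ne_zero (hp i).symm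
  have hs : ∀ i j, i ≠ j →
      -planeToComplex (p j - a) / planeToComplex (p i - a) ∈ Complex.slitPlane :=
    fun i j hij => neg_div_mem_slitPlane (H' i j hij) (hp j)
  -- In the limit at `a` the contributions `ψ i a` cancel, and since inverting a quotient negates
  -- its argument, each of three arguments occurs twice.
  rw [angleFrom_sub_eq (h 1) (h 2) (ha 1) (ha 2) (hp 1) (hp 2) (H 0 1 (by decide))
      (H 0 2 (by decide)),
    angleFrom_sub_eq (h 2) (h 0) (ha 2) (ha 0) (hp 2) (hp 0) (H 1 2 (by decide))
      (H 1 0 (by decide)),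
    angleFrom_sub_eq (h 0) (h 1) (ha 0) (ha 1) (hp 0) (hp 1) (H 2 0 (by decide))
      (H 2 1 (by decide)),
    arg_neg_div_add (hs 0 1 (by decide)), arg_neg_div_add (hs 1 2 (by decide)),
    arg_neg_div_add (hs 2 0 (by decide))]
  set z := fun i => planeToComplex (p i - a)
  intro h0
  have hsum : (-z 1 / z 0).arg + (-z 2 / z 1).arg + (-z 0 / z 2).arg = 0 := by
    simp only [z]
    linarith
  -- The three quotients multiply to `-1`, so their arguments add up to `π` modulo `2π`.
  have hang : (((-z 1 / z 0).arg + (-z 2 / z 1).arg + (-z 0 / z 2).arg : ℝ) : Real.Angle)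
      = (Real.pi : ℝ) := by
    rw [Real.Angle.coe_add, Real.Angle.coe_add,
      ← Complex.arg_mul_coe_angle (div_ne_zero (neg_ne_zero.2 (hz 1)) (hz 0))
        (div_ne_zero (neg_ne_zero.2 (hz 2)) (hz 1)),
      ← Complex.arg_mul_coe_angle (mul_ne_zero (div_ne_zero (neg_ne_zero.2 (hz 1)) (hz 0))
        (div_ne_zero (neg_ne_zero.2 (hz 2)) (hz 1))) (div_ne_zero (neg_ne_zero.2 (hz 0)) (hz 2)),
      ← Complex.arg_neg_one]
    congr 2
    exact mul_neg_div_cycle (hz 0) (hz 1) (hz 2)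
  rw [hsum] at hang
  exact Real.Angle.pi_ne_zero hang.symm

/-! ### Angles along walks in a plane drawing -/

/-- The starting point is inserted because the union is empty for `m = 0`. That case occurs when an
arc that is a single segment is cut after its first segment. -/
lemma exists_angleAlong_polygon (pt : ℕ → ℝ × ℝ) (m : ℕ) :
    (∃ θ, AngleAlong (⋃ i ∈ Finset.range m, segment ℝ (pt i) (pt (i + 1))) (pt 0) (pt m) θ) ∧
    IsPreconnected (insert (pt 0) (⋃ i ∈ Finset.range m, segment ℝ (pt i) (pt (i + 1)))) ∧
    pt m ∈ insert (pt 0) (⋃ i ∈ Finset.range m, segment ℝ (pt i) (pt (i + 1))) := by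
  induction m with
  | zero => exact ⟨⟨_, by simpa using AngleAlong.refl (pt 0)⟩, by simpa using isPreconnected_singleton,
      by simp⟩
  | succ m ih =>
    have hU : (⋃ i ∈ Finset.range (m + 1), segment ℝ (pt i) (pt (i + 1))) =
        (⋃ i ∈ Finset.range m, segment ℝ (pt i) (pt (i + 1))) ∪
          segment ℝ (pt m) (pt (m + 1)) := by
      rw [Finset.range_add_one, Finset.set_biUnion_insert, Set.union_comm]
    obtain ⟨⟨θ, hθ⟩, hc, hm⟩ := ih
    rw [hU, ← Set.insert_union]
    exact ⟨⟨_, hθ.trans (AngleAlong.segment _ _)⟩,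
      hc.union (pt m) hm (left_mem_segment ℝ _ _) (convex_segment _ _).isPreconnected,
      Or.inr (right_mem_segment ℝ _ _)⟩

lemma IsPolygonalArc.exists_angleAlong {A : Set (ℝ × ℝ)} {a b : ℝ × ℝ}
    (h : IsPolygonalArc A a b) : ∃ θ, AngleAlong A a b θ := by
  obtain ⟨m, pt, -, rfl, rfl, -, -, rfl⟩ := h
  exact (exists_angleAlong_polygon pt m).1

lemma IsPolygonalArc.isPreconnected {A : Set (ℝ × ℝ)} {a b : ℝ × ℝ}
    (h : IsPolygonalArc A a b) : IsPreconnected A ∧ a ∈ A ∧ b ∈ A := by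
  obtain ⟨m, pt, hm, rfl, rfl, -, -, rfl⟩ := h
  have h0 : pt 0 ∈ ⋃ i ∈ Finset.range m, segment ℝ (pt i) (pt (i + 1)) :=
    Set.mem_biUnion (Finset.mem_coe.2 (Finset.mem_range.2 hm)) (left_mem_segment ℝ _ _)
  have := (exists_angleAlong_polygon pt m).2
  rw [Set.insert_eq_of_mem h0] at this
  exact ⟨this.1, h0, this.2⟩

lemma IsPolygonalArc.exists_first_segment {A : Set (ℝ × ℝ)} {a b : ℝ × ℝ}
    (h : IsPolygonalArc A a b) : ∃ (p : ℝ × ℝ) (T : Set (ℝ × ℝ)) (ψ : ℝ × ℝ → ℝ),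
      A = segment ℝ a p ∪ T ∧ a ≠ p ∧ a ∉ T ∧ AngleAlong T p b ψ ∧
      IsPreconnected (insert p T) ∧ b ∈ insert p T := by
  obtain ⟨m, pt, hm, rfl, rfl, hne, hmeet, rfl⟩ := h
  obtain ⟨m, rfl⟩ := Nat.exists_eq_succ_of_ne_zero hm.ne'
  obtain ⟨⟨ψ, hψ⟩, hc, hb⟩ := exists_angleAlong_polygon (fun i => pt (i + 1)) m
  refine ⟨pt 1, _, ψ, ?_, hne 0 hm, ?_, hψ, hc, hb⟩
  · ext x
    simp only [Set.mem_iUnion, Finset.mem_range, Set.mem_union, exists_prop]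
    constructor
    · rintro ⟨i, hi, hx⟩
      rcases i with _ | i
      · exact Or.inl hx
      · exact Or.inr ⟨i, by omega, hx⟩
    · rintro (hx | ⟨i, hi, hx⟩)
      · exact ⟨0, hm, hx⟩
      · exact ⟨i + 1, by omega, hx⟩
  · simp only [Set.mem_iUnion, Finset.mem_range, exists_prop, not_exists, not_and]
    intro i hi hx
    obtain ⟨h1, h2⟩ := hmeet 0 (i + 1) (by omega) (by omega) (pt 0)
      ⟨left_mem_segment ℝ _ _, hx⟩
    rw [h1] at h2
    exact hne 0 hm h2

namespace PlaneDrawing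

variable {V : Type*} {G : SimpleGraph V} (D : PlaneDrawing G)

/-- The points on the edges of a walk. -/
def walkSet {u v : V} (W : G.Walk u v) : Set (ℝ × ℝ) :=
  ⋃ e ∈ W.edges, D.arc e

lemma walkSet_cons {u v w : V} (h : G.Adj u v) (W : G.Walk v w) :
    D.walkSet (SimpleGraph.Walk.cons h W) = D.arc s(u, v) ∪ D.walkSet W := by
  simp [walkSet, Set.iUnion_or, Set.iUnion_union_distrib]

lemma exists_angleAlong_walkSet {u v : V} (W : G.Walk u v) :
    ∃ θ, AngleAlong (D.walkSet W) (D.pos u) (D.pos v) θ := by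
  induction W with
  | nil => exact ⟨_, by simpa [walkSet] using AngleAlong.refl _⟩
  | cons h W ih =>
    obtain ⟨θ, hθ⟩ := ih
    obtain ⟨ψ, hψ⟩ := (D.isArc _ _ h).exists_angleAlong
    rw [walkSet_cons]
    exact ⟨_, hψ.trans hθ⟩

lemma isPreconnected_insert_walkSet {u v : V} (W : G.Walk u v) :
    IsPreconnected (insert (D.pos u) (D.walkSet W)) ∧
      D.pos v ∈ insert (D.pos u) (D.walkSet W) := by
  induction W with
  | nil => simpa [walkSet] using isPreconnected_singleton
  | @cons u v w h W ih =>
    obtain ⟨h1, h2, h3⟩ := (D.isArc _ _ h).isPreconnected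
    have : insert (D.pos u) (D.walkSet (SimpleGraph.Walk.cons h W)) =
        D.arc s(u, v) ∪ insert (D.pos v) (D.walkSet W) := by
      rw [walkSet_cons, Set.union_insert,
        Set.insert_eq_of_mem (s := D.arc s(u, v) ∪ D.walkSet W) (Or.inl h2),
        Set.insert_eq_of_mem (s := D.arc s(u, v) ∪ D.walkSet W) (Or.inl h3)]
    rw [this]
    exact ⟨h1.union _ h3 (Set.mem_insert _ _) ih.1, Or.inr ih.2⟩

lemma pos_notMem_walkSet {u v w : V} {W : G.Walk u v} (hw : w ∉ W.support) :
    D.pos w ∉ D.walkSet W := by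
  simp only [walkSet, Set.mem_iUnion, not_exists]
  intro e
  induction e using Sym2.ind with
  | _ x y =>
    intro he hx
    rcases D.vertex_of_mem x y w (W.adj_of_mem_edges he) hx with rfl | rfl
    · exact hw (W.fst_mem_support_of_mem_edges he)
    · exact hw (W.snd_mem_support_of_mem_edges he)

/-- As `z` is off the walk, `yz` is not one of its edges; two different edges meet only in a common
vertex, which cannot be `z`. -/
lemma exists_vertex_of_mem_arc {u v y z : V} {W : G.Walk u v} (h : G.Adj y z)
    (hz : z ∉ W.support) {x : ℝ × ℝ} (hx : x ∈ D.arc s(y, z)) (hx' : x ∈ D.walkSet W) :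
    y ∈ W.support ∧ x = D.pos y := by
  simp only [walkSet, Set.mem_iUnion] at hx'
  obtain ⟨f, hf, hxf⟩ := hx'
  have hmem : ∀ w ∈ f, w ∈ W.support := fun w hw => W.mem_support_of_mem_edges hf hw
  obtain ⟨w, hw, hwf, rfl⟩ := D.edges_meet s(y, z) h f (W.edges_subset_edgeSet hf)
    (by rintro rfl; exact hz (hmem z (by simp))) x ⟨hx, hxf⟩
  rcases Sym2.mem_iff.1 hw with rfl | rfl
  · exact ⟨hmem _ hwf, rfl⟩
  · exact absurd (hmem _ hwf) hz

lemma disjoint_walkSet {u v u' v' : V} {W : G.Walk u v} {W' : G.Walk u' v'}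
    (h : ∀ x ∈ W.support, x ∉ W'.support) {x : ℝ × ℝ}
    (hx : x ∈ insert (D.pos u) (D.walkSet W)) : x ∉ D.walkSet W' := by
  rcases hx with rfl | hx
  · exact D.pos_notMem_walkSet (h u W.start_mem_support)
  · intro hx'
    simp only [walkSet, Set.mem_iUnion] at hx
    obtain ⟨e, he, hxe⟩ := hx
    revert he hxe
    induction e using Sym2.ind with
    | _ y z =>
      intro he hxe
      have := D.exists_vertex_of_mem_arc (W.adj_of_mem_edges he)
        (h z (W.snd_mem_support_of_mem_edges he)) hxe hx'
      exact h y (W.fst_mem_support_of_mem_edges he) this.1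

/-- A path from `a` to `b` splits into a first segment and the rest. -/
lemma exists_walkSet_eq {a b : V} {R : G.Walk a b} (hR : R.IsPath) (hab : a ≠ b) :
    ∃ (p : ℝ × ℝ) (T S : Set (ℝ × ℝ)) (ψ : ℝ × ℝ → ℝ),
      D.walkSet R = segment ℝ (D.pos a) p ∪ S ∧ D.pos a ≠ p ∧ D.pos a ∉ S ∧
      AngleAlong S p (D.pos b) ψ ∧ T ⊆ S ∧ IsPreconnected (insert p T) ∧
      D.pos (R.getVert 1) ∈ insert p T ∧
      segment ℝ (D.pos a) p ∪ T = D.arc s(a, R.getVert 1) ∧ G.Adj a (R.getVert 1) := by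
  cases R with
  | nil => exact absurd rfl hab
  | @cons _ r _ h R =>
    obtain ⟨p, T, ψ, hA, hap, haT, hψ, hT, hr⟩ := (D.isArc _ _ h).exists_first_segment
    obtain ⟨θ, hθ⟩ := D.exists_angleAlong_walkSet R
    rw [SimpleGraph.Walk.cons_isPath_iff] at hR
    refine ⟨p, T, T ∪ D.walkSet R, _, ?_, hap, ?_, hψ.trans hθ, Set.subset_union_left, hT, ?_, ?_, ?_⟩
    · rw [walkSet_cons, hA, Set.union_assoc]
    · rintro (h1 | h1)
      · exact haT h1
      · exact D.pos_notMem_walkSet hR.2 h1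
    · simpa using hr
    · simpa using hA.symm
    · simpa using h

end PlaneDrawing

/-- In a planar graph, three `a`-`b` paths cannot each have their second vertex joined to `t` by a
walk that avoids the other two paths (even if the three paths cross each other). -/
theorem IsPlanarGraph.false_of_three_paths {V : Type*} {G : SimpleGraph V} (hG : IsPlanarGraph G)
    {a b t : V} (hab : a ≠ b) (R : Fin 3 → G.Walk a b) (hR : ∀ i, (R i).IsPath)
    (W : ∀ i, G.Walk ((R i).getVert 1) t)
    (hW : ∀ i j, i ≠ j → ∀ x ∈ (W i).support, x ∉ (R j).support) : False := by
  obtain ⟨D⟩ := hG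
  choose p T S ψ hRS hap haS hψ hTS hT hr harc hadj using
    fun i => D.exists_walkSet_eq (hR i) hab
  have hdis : ∀ i j, i ≠ j → ∀ x ∈ D.arc s(a, (R i).getVert 1), x ∈ D.walkSet (R j) →
      x = D.pos a := fun i j hij x hx hx' =>
    (D.exists_vertex_of_mem_arc (hadj i) (hW i j hij _ (W i).start_mem_support) hx hx').2
  have hθ : ∀ i, AngleAlong (D.walkSet (R i)) (D.pos a) (D.pos b) (angleFrom (D.pos a) (p i) (ψ i)) :=
    fun i => by
      rw [hRS i]
      exact (hψ i).angleFrom _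
  have hpT : ∀ i, ∀ x ∈ insert (p i) (T i), x ∈ D.arc s(a, (R i).getVert 1) ∧ x ≠ D.pos a := by
    rintro i x (rfl | hx)
    · exact ⟨harc i ▸ Or.inl (right_mem_segment ℝ _ _), (hap i).symm⟩
    · refine ⟨harc i ▸ Or.inr hx, ?_⟩
      rintro rfl
      exact haS i (hTS i hx)
  -- The rest of the first edge of `R i` together with `W i` connects `p i` to `t` and avoids the
  -- other two paths, so the winding number is the same at both ends.
  have key : ∀ i j k, i ≠ j → i ≠ k →
      angleFrom (D.pos a) (p j) (ψ j) (p i) - angleFrom (D.pos a) (p k) (ψ k) (p i) =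
      angleFrom (D.pos a) (p j) (ψ j) (D.pos t) - angleFrom (D.pos a) (p k) (ψ k) (D.pos t) := by
    intro i j k hij hik
    obtain ⟨hc, ht⟩ := D.isPreconnected_insert_walkSet (W i)
    have hK := (hT i).union _ (hr i) (Set.mem_insert _ _) hc
    have hav : ∀ j, i ≠ j → ∀ x ∈ insert (p i) (T i) ∪
        insert (D.pos ((R i).getVert 1)) (D.walkSet (W i)), x ∉ D.walkSet (R j) := by
      rintro j hij x (hx | hx)
      · exact fun hx' => (hpT i x hx).2 (hdis i j hij x (hpT i x hx).1 hx')
      · exact D.disjoint_walkSet (hW i j hij) hx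
    exact (hθ j).sub_eq_sub (hθ k) hK (hav j hij) (hav k hik) (Or.inl (Set.mem_insert _ _))
      (Or.inr ht)
  refine angleFrom_sum_ne_zero hψ haS ?_ ?_
  · intro i j hij ε h0 h1 hmem
    have hx : D.pos a + ε • (p i - D.pos a) ∈ segment ℝ (D.pos a) (p i) :=
      ⟨1 - ε, ε, by linarith, h0.le, by ring, by module⟩
    rw [← hRS j] at hmem
    have h2 := hdis i j hij _ (harc i ▸ Or.inl hx) hmem
    rw [add_eq_left, smul_eq_zero, sub_eq_zero] at h2
    rcases h2 with h2 | h2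
    · exact h0.ne' h2
    · exact hap i h2.symm
  -- All three differences are now taken at the same point `t`, where they telescope to zero.
  · rw [key 0 1 2 (by decide) (by decide), key 1 2 0 (by decide) (by decide),
      key 2 0 1 (by decide) (by decide)]
    ring

/-! ### Breadth-first expansion -/

/-- The points reached from `X` within `r` steps along `E` into points of `A`. -/
def expand {V : Type*} (E : V → V → Prop) (A X : V → Prop) : ℕ → V → Prop
  | 0, w => X w
  | r + 1, w => expand E A X r w ∨ (A w ∧ ∃ u, expand E A X r u ∧ E u w)

section Expand

variable {V : Type*} {E : V → V → Prop} {A X A' X' : V → Prop}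

lemma expand_mono {r r' : ℕ} (h : r ≤ r') {w : V} (hw : expand E A X r w) :
    expand E A X r' w := by
  induction h with
  | refl => exact hw
  | step _ ih => exact Or.inl ih

lemma expand_step {r : ℕ} {u w : V} (hu : expand E A X r u) (hw : A w) (h : E u w) :
    expand E A X (r + 1) w :=
  Or.inr ⟨hw, u, hu, h⟩

lemma expand_trans {r r' : ℕ} {w : V} (hA : ∀ x, A x → A' x)
    (hX : ∀ x, X x → expand E A' X' r' x) (hw : expand E A X r w) :
    expand E A' X' (r' + r) w := by
  induction r generalizing w with
  | zero => exact hX w hw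
  | succ r ih =>
    rcases hw with hw | ⟨hAw, u, hu, h⟩
    · exact expand_mono (by omega) (ih hw)
    · exact expand_step (ih hu) (hA w hAw) h

lemma exists_expand_singleton {r : ℕ} {w : V} (hw : expand E A X r w) :
    ∃ x, X x ∧ expand E A (fun z => z = x) r w := by
  induction r generalizing w with
  | zero => exact ⟨w, hw, rfl⟩
  | succ r ih =>
    rcases hw with hw | ⟨hAw, u, hu, h⟩
    · obtain ⟨x, hx, hxw⟩ := ih hw
      exact ⟨x, hx, Or.inl hxw⟩
    · obtain ⟨x, hx, hxu⟩ := ih hu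
      exact ⟨x, hx, expand_step hxu hAw h⟩

end Expand

/-- Used with `P` the vertices of one color: jumping to the last of them removes that color from the
rest of the walk. -/
lemma SimpleGraph.Walk.exists_last_occurrence {V : Type*} {G : SimpleGraph V} (P : V → Prop)
    {x y : V} (W : G.Walk x y) (h : ∃ z ∈ W.support, P z) :
    ∃ (z : V) (W' : G.Walk z y), P z ∧ W'.support ⊆ W.support ∧ ∀ u ∈ W'.support.tail, ¬ P u := by
  induction W with
  | @nil x =>
    obtain ⟨z, hz, hP⟩ := h
    rw [SimpleGraph.Walk.support_nil, List.mem_singleton] at hz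
    subst hz
    exact ⟨_, .nil, hP, by simp, by simp⟩
  | @cons u v w e W ih =>
    by_cases h' : ∃ z ∈ W.support, P z
    · obtain ⟨z, W', h1, h2, h3⟩ := ih h'
      exact ⟨z, W', h1, fun a ha => by simp [h2 ha], h3⟩
    · obtain ⟨z, hz, hP⟩ := h
      rw [SimpleGraph.Walk.support_cons, List.mem_cons] at hz
      rcases hz with rfl | hz
      · refine ⟨_, .cons e W, hP, by simp, fun a ha hPa => h' ⟨a, ?_, hPa⟩⟩
        simpa using ha
      · exact absurd ⟨z, hz, hP⟩ h'

/-! ### The two redundancy tests and their soundness -/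

namespace ColoredPathStar

variable {n : ℕ} (I : ColoredPathStar n)

lemma mem_colors {u v : Fin n} {W : I.G.Walk u v} {c : ℕ} :
    c ∈ I.colors W ↔ ∃ x ∈ W.support, c ∈ I.χ x := by
  simp [colors]

lemma colors_subset_iff {u v : Fin n} {W : I.G.Walk u v} {p : Finset ℕ} :
    I.colors W ⊆ p ↔ ∀ x ∈ W.support, I.χ x ⊆ p := by
  simp [colors]

/-- `w` can be reached from `s` within `n` steps through vertices with all colors in `p`. -/
def Reach (p : Finset ℕ) : Fin n → Prop :=
  expand I.G.Adj (fun w => I.χ w ⊆ p) (fun w => w = I.s ∧ I.χ w ⊆ p) n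

/-- `u` and `w` are adjacent or share a color. -/
def Linked (u w : Fin n) : Prop :=
  I.G.Adj u w ∨ ∃ c ∈ I.χ u, c ∈ I.χ w

/-- `u` has at most `k` colors, and it is not an uncolored vertex reached by `p`. -/
def Allowed (p : Finset ℕ) (u : Fin n) : Prop :=
  (I.χ u).card ≤ I.k ∧ ¬ (I.χ u = ∅ ∧ I.Reach p u)

/-- `t` is linked to a color of `p` by few steps through allowed vertices. -/
def LinkedToTarget (p : Finset ℕ) : Prop :=
  expand I.Linked (I.Allowed p) (fun u => I.Allowed p u ∧ ∃ c ∈ I.χ u, c ∈ p) (3 * I.k) I.t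

/-- `p` does not reach `v`, or a proper subset of `p` does. -/
def NonMinimal (v : Fin n) (p : Finset ℕ) : Prop :=
  ¬ I.Reach p v ∨ ∃ c ∈ p, I.Reach (p.erase c) v

/-- A path has fewer than `n` edges, so `n` rounds suffice; conversely a search yields a walk, whose
bypass uses no further colors. -/
lemma reach_iff {p : Finset ℕ} {w : Fin n} : I.Reach p w ↔ I.ReachableBy I.s w p := by
  constructor
  · suffices H : ∀ r w, expand I.G.Adj (fun w => I.χ w ⊆ p) (fun w => w = I.s ∧ I.χ w ⊆ p) r w →
        ∃ W : I.G.Walk I.s w, I.colors W ⊆ p by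
      intro h
      obtain ⟨W, hW⟩ := H n w h
      refine ⟨W.bypass, W.bypass_isPath, ?_⟩
      rw [colors_subset_iff] at hW ⊢
      exact fun x hx => hW x (W.support_bypass_subset_support hx)
    intro r
    induction r with
    | zero =>
      rintro w ⟨rfl, h⟩
      exact ⟨.nil, by simpa [colors_subset_iff] using h⟩
    | succ r ih =>
      rintro w (h | ⟨h, u, hu, huw⟩)
      · exact ih w h
      · obtain ⟨W, hW⟩ := ih u hu
        refine ⟨W.concat huw, ?_⟩
        rw [colors_subset_iff] at hW ⊢
        intro x hx
        rw [SimpleGraph.Walk.support_concat, List.mem_append,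
          List.mem_singleton] at hx
        rcases hx with hx | rfl
        · exact hW x hx
        · exact h
  · rintro ⟨W, hW, hp⟩
    rw [colors_subset_iff] at hp
    have hlen : W.length < n := by simpa using hW.length_lt
    have H : ∀ r ≤ W.length, expand I.G.Adj (fun w => I.χ w ⊆ p)
        (fun w => w = I.s ∧ I.χ w ⊆ p) r (W.getVert r) := by
      intro r hr
      induction r with
      | zero => exact ⟨by simp, hp _ (W.getVert_mem_support 0)⟩
      | succ r ih =>
        exact expand_step (ih (by omega)) (hp _ (W.getVert_mem_support _))
          (W.adj_getVert_succ (by omega))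
    have := H _ le_rfl
    rw [W.getVert_length] at this
    exact expand_mono hlen.le this

variable {I}

/-- Reachability is monotone in the color set, so testing the deletion of single colors covers all
proper subsets. -/
lemma NonMinimal.not_minimallyCompletes {v : Fin n} {p : Finset ℕ} (h : I.NonMinimal v p)
    (Q : I.G.Walk v I.t) : ¬ I.MinimallyCompletes p Q := by
  rintro ⟨⟨⟨W, hW, hp⟩, -, -⟩, hmin⟩
  rcases h with h | ⟨c, hc, h⟩
  · exact h (I.reach_iff.2 ⟨W, hW, hp.subset⟩)
  · obtain ⟨W', hW', hp'⟩ := I.reach_iff.1 h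
    exact hmin ⟨_, lt_of_le_of_lt hp' (Finset.erase_ssubset hc), W', hW', rfl⟩

/-- A path that reaches `v` within `p` but misses some `c ∈ p` would reach `v` within `p.erase c`.
-/
lemma hasPath_of_not_nonMinimal {v : Fin n} {p : Finset ℕ} (h : ¬ I.NonMinimal v p) :
    I.HasPath I.s v p := by
  rw [NonMinimal, not_or, not_not] at h
  obtain ⟨W, hW, hp⟩ := I.reach_iff.1 h.1
  refine ⟨W, hW, ?_⟩
  by_contra hne
  obtain ⟨c, hc, hcW⟩ := Finset.exists_of_ssubset (lt_of_le_of_ne hp hne)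
  exact h.2 ⟨c, hc, I.reach_iff.2 ⟨W, hW, fun x hx => Finset.mem_erase.2
    ⟨fun hxc => hcW (hxc ▸ hx), hp hx⟩⟩⟩

lemma Irreducible.nonempty_of_adj (hI : I.Irreducible) {x y : Fin n} (h : I.G.Adj x y)
    (hx : I.χ x = ∅) : (I.χ y).Nonempty := by
  rw [Finset.nonempty_iff_ne_empty]
  intro hy
  exact hI ⟨x, y, h, hx.trans hy.symm⟩

/-- A walk with at most `κ` colors can be shortened to `3 κ` steps between linked vertices. -/
lemma Irreducible.expand_of_walk (hI : I.Irreducible) {A X : Fin n → Prop} (κ : ℕ) :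
    ∀ {x y : Fin n} (W : I.G.Walk x y) {r : ℕ}, (∀ z ∈ W.support, A z) → (I.χ x).Nonempty →
      (I.colors W).card ≤ κ → expand I.Linked A X r x → expand I.Linked A X (r + 3 * κ) y := by
  induction κ with
  | zero =>
    rintro x y W r - ⟨c, hc⟩ hW -
    rw [Nat.le_zero, Finset.card_eq_zero] at hW
    have : c ∈ I.colors W := I.mem_colors.2 ⟨x, W.start_mem_support, hc⟩
    simp [hW] at this
  | succ κ ih =>
    rintro x y W r hA ⟨c, hc⟩ hW hx
    obtain ⟨z, W', hz, hsub, hlast⟩ := W.exists_last_occurrence (fun u => c ∈ I.χ u)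
      ⟨x, W.start_mem_support, hc⟩
    -- One step jumps along `c` to its last vertex on the walk. Up to two more edges lead to the
    -- next colored vertex, and from there at most `κ` colors remain: three steps per color.
    have hxz : expand I.Linked A X (r + 1) z :=
      expand_step hx (hA z (hsub W'.start_mem_support)) (Or.inr ⟨c, hc, hz⟩)
    have hcolors : ∀ {a : Fin n} (W₂ : I.G.Walk a y), (∀ u ∈ W₂.support, u ∈ W'.support.tail) →
        (I.colors W₂).card ≤ κ := by
      intro a W₂ h2
      have hss : I.colors W₂ ⊆ (I.colors W).erase c := by
        intro d hd
        obtain ⟨u, hu, hdu⟩ := I.mem_colors.1 hd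
        refine Finset.mem_erase.2 ⟨?_, I.mem_colors.2 ⟨u, hsub (List.mem_of_mem_tail (h2 u hu)), hdu⟩⟩
        rintro rfl
        exact hlast u (h2 u hu) hdu
      have h3 := Finset.card_le_card hss
      rw [Finset.card_erase_of_mem (I.mem_colors.2 ⟨x, W.start_mem_support, hc⟩)] at h3
      omega
    cases W' with
    | nil => exact expand_mono (by omega) hxz
    | @cons _ y₁ _ h₁ W₁ =>
      have hA₁ : ∀ u ∈ W₁.support, A u := fun u hu => hA u (hsub (by simp [hu]))
      have hy₁ : expand I.Linked A X (r + 2) y₁ :=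
        expand_step hxz (hA₁ y₁ W₁.start_mem_support) (Or.inl h₁)
      by_cases hne : (I.χ y₁).Nonempty
      · exact expand_mono (by omega) (ih W₁ hA₁ hne (hcolors W₁ (by simp)) hy₁)
      · cases W₁ with
        | nil => exact expand_mono (by omega) hy₁
        | @cons _ y₂ _ h₂ W₂ =>
          have hA₂ : ∀ u ∈ W₂.support, A u := fun u hu => hA₁ u (by simp [hu])
          have hy₂ : expand I.Linked A X (r + 3) y₂ :=
            expand_step hy₁ (hA₂ y₂ W₂.start_mem_support) (Or.inl h₂)
          -- If `y₁` is uncolored, irreducibility makes its neighbor `y₂` colored, so the induction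
          -- can restart there.
          refine expand_mono (by omega) (ih W₂ hA₂ ?_ (hcolors W₂ ?_) hy₂)
          · exact hI.nonempty_of_adj h₂ (Finset.not_nonempty_iff_eq_empty.1 hne)
          · intro u hu
            simp [hu]

/-- If all sets of the family are minimal and `t` is not linked to `p`, then `p` is redundant. -/
lemma kRepresents_erase (hI : I.Irreducible) {v : Fin n} {l : ℕ}
    {L : Finset (Finset ℕ)} (hcard : ∀ p ∈ L, p.card = l)
    (hdis : ∀ p ∈ L, ∀ p' ∈ L, p ≠ p' → Disjoint p p') (hL : 1 < L.card)
    (hmin : ∀ p ∈ L, ¬ I.NonMinimal v p) {p : Finset ℕ} (hp : p ∈ L)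
    (hpt : ¬ I.LinkedToTarget p) : I.KRepresents (L.erase p) L v := by
  intro p₁ hp₁ Q hQ
  by_cases hne : p₁ = p
  swap
  · exact ⟨p₁, Finset.mem_erase.2 ⟨hne, hp₁⟩, hQ.1.2.1, le_rfl, hQ.1.1⟩
  subst hne
  obtain ⟨p', hp', hpp'⟩ := Finset.exists_mem_ne hL p₁
  -- The colors of `v` lie in every set of the family, and two of these sets are disjoint.
  have hv : I.χ v = ∅ := by
    have h1 : ∀ q ∈ L, I.χ v ⊆ q := by
      intro q hq
      obtain ⟨W, -, hW⟩ := hasPath_of_not_nonMinimal (hmin q hq)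
      exact I.colors_subset_iff.1 hW.subset v W.end_mem_support
    have h2 := hdis p₁ hp p' hp' hpp'.symm
    exact Finset.disjoint_self_iff_empty _ |>.1 (h2.mono (h1 p₁ hp) (h1 p' hp'))
  -- From a vertex of `Q` with a color of `p₁` on, `Q` consists of allowed vertices: it has at most
  -- `k` colors and, after `v`, nothing reachable by `p₁`. Shortening it would link `t` to `p₁`.
  have hcap : p₁ ∩ I.colors Q = ∅ := by
    by_contra hcap
    obtain ⟨c, hc⟩ := Finset.nonempty_iff_ne_empty.2 hcap
    rw [Finset.mem_inter] at hc
    obtain ⟨x, hx, hcx⟩ := I.mem_colors.1 hc.2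
    have hkQ : (I.colors Q).card ≤ I.k :=
      (Finset.card_le_card Finset.subset_union_right).trans hQ.1.2.1
    have htail : ∀ z ∈ Q.support.tail, I.Allowed p₁ z := by
      intro z hz
      refine ⟨(Finset.card_le_card ?_).trans hkQ, fun h => ?_⟩
      · intro d hd
        exact I.mem_colors.2 ⟨z, List.mem_of_mem_tail hz, hd⟩
      · exact hQ.1.2.2 z hz (I.reach_iff.1 h.2)
    apply hpt
    cases Q with
    | nil =>
      simp only [SimpleGraph.Walk.support_nil, List.mem_singleton] at hx
      subst hx
      simp [hv] at hcx
    | @cons _ q _ h Q =>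
      have hxQ : x ∈ Q.support := by
        simp only [SimpleGraph.Walk.support_cons, List.mem_cons] at hx
        rcases hx with rfl | hx
        · simp [hv] at hcx
        · exact hx
      have hall : ∀ z ∈ (Q.dropUntil x hxQ).support, I.Allowed p₁ z := fun z hz =>
        htail z (by simpa using Q.support_dropUntil_subset_support hxQ hz)
      have := hI.expand_of_walk (A := I.Allowed p₁)
        (X := fun u => I.Allowed p₁ u ∧ ∃ c ∈ I.χ u, c ∈ p₁) I.k (Q.dropUntil x hxQ) (r := 0)
        hall ⟨c, hcx⟩ ?_ ⟨hall x (SimpleGraph.Walk.start_mem_support _), c, hcx, hc.1⟩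
      · rwa [zero_add] at this
      · refine (Finset.card_le_card ?_).trans hkQ
        intro d hd
        obtain ⟨z, hz, hdz⟩ := I.mem_colors.1 hd
        exact I.mem_colors.2 ⟨z, by simp [Q.support_dropUntil_subset_support hxQ hz], hdz⟩
  refine ⟨p', Finset.mem_erase.2 ⟨hpp', hp'⟩, ?_, ?_, hasPath_of_not_nonMinimal (hmin p' hp')⟩
  -- With an empty intersection the union bound says `l + |χ(Q)| ≤ k`, which serves every set of
  -- size `l`.
  · have h1 := hQ.1.2.1
    rw [Finset.card_union_of_disjoint (Finset.disjoint_iff_inter_eq_empty.2 hcap)] at h1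
    refine (Finset.card_union_le _ _).trans ?_
    rw [hcard p' hp']
    rwa [hcard p₁ hp] at h1
  · simp [hcap]

/-- Two vertices of color `c` are joined by a walk through vertices of color `c`. -/
lemma exists_walk_of_color {c : ℕ} {x y : Fin n} (hx : c ∈ I.χ x) (hy : c ∈ I.χ y) :
    ∃ W : I.G.Walk x y, ∀ z ∈ W.support, c ∈ I.χ z := by
  obtain ⟨W⟩ := I.colorConnected c (I.χ_subset x hx) ⟨x, hx⟩ ⟨y, hy⟩
  refine ⟨W.map (SimpleGraph.Embedding.induce _).toHom, fun z hz => ?_⟩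
  erw [SimpleGraph.Walk.support_map, List.mem_map] at hz
  obtain ⟨a, -, rfl⟩ := hz
  exact a.2

open Classical in
/-- Few steps between linked vertices yield a walk that meets few sets of a family. -/
lemma exists_walk_of_expand {ι : Type*} {J : Finset ι} {S : ι → List (Fin n)} {M : ℕ}
    {A : Fin n → Prop} {x : Fin n} (hx : (J.filter fun j => x ∈ S j).card ≤ M)
    (hA : ∀ z, A z → (J.filter fun j => z ∈ S j).card ≤ M)
    (hc : ∀ c, (J.filter fun j => ∃ z ∈ S j, c ∈ I.χ z).card ≤ M) {r : ℕ} {y : Fin n}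
    (h : expand I.Linked A (fun z => z = x) r y) :
    ∃ W : I.G.Walk x y, (J.filter fun j => ∃ z ∈ W.support, z ∈ S j).card ≤ M * (r + 1) := by
  induction r generalizing y with
  | zero =>
    obtain rfl : y = x := h
    exact ⟨.nil, by simpa using hx⟩
  | succ r ih =>
    rcases h with h | ⟨hy, u, hu, huy⟩
    · obtain ⟨W, hW⟩ := ih h
      exact ⟨W, hW.trans (Nat.mul_le_mul_left _ (by omega))⟩
    · obtain ⟨W, hW⟩ := ih hu
      -- Only sets not met before are counted: an edge adds at most those containing `y`, and a link
      -- through `c` is realized by a walk inside color `c`.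
      have key : ∃ W' : I.G.Walk u y,
          (J.filter fun j => ∃ z ∈ W'.support, z ∈ S j ∧ z ∉ W.support).card ≤ M := by
        rcases huy with huy | ⟨c, hcu, hcy⟩
        · refine ⟨.cons huy .nil, le_trans (Finset.card_le_card ?_) (hA y hy)⟩
          intro j hj
          simp only [Finset.mem_filter] at hj ⊢
          refine ⟨hj.1, ?_⟩
          obtain ⟨z, hz, hzS, hzW⟩ := hj.2
          simp only [SimpleGraph.Walk.support_cons, SimpleGraph.Walk.support_nil,
            List.mem_cons, List.not_mem_nil, or_false] at hz
          rcases hz with rfl | rfl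
          · exact absurd W.end_mem_support hzW
          · exact hzS
        · obtain ⟨W', hW'⟩ := exists_walk_of_color hcu hcy
          refine ⟨W', le_trans (Finset.card_le_card ?_) (hc c)⟩
          intro j hj
          simp only [Finset.mem_filter] at hj ⊢
          obtain ⟨z, hz, hzS, -⟩ := hj.2
          exact ⟨hj.1, z, hzS, hW' z hz⟩
      obtain ⟨W', hW'⟩ := key
      refine ⟨W.append W', ?_⟩
      have hsub : (J.filter fun j => ∃ z ∈ (W.append W').support, z ∈ S j) ⊆
          (J.filter fun j => ∃ z ∈ W.support, z ∈ S j) ∪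
          (J.filter fun j => ∃ z ∈ W'.support, z ∈ S j ∧ z ∉ W.support) := by
        intro j hj
        simp only [Finset.mem_filter, Finset.mem_union, SimpleGraph.Walk.mem_support_append_iff]
          at hj ⊢
        obtain ⟨hjJ, z, hz, hzS⟩ := hj
        by_cases hzW : z ∈ W.support
        · exact Or.inl ⟨hjJ, z, hzW, hzS⟩
        · exact Or.inr ⟨hjJ, z, hz.resolve_left hzW, hzS, hzW⟩
      calc _ ≤ _ := Finset.card_le_card hsub
        _ ≤ M * (r + 1) + M := (Finset.card_union_le _ _).trans (add_le_add hW hW')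
        _ = M * (r + 1 + 1) := by ring

end ColoredPathStar

/-! ### Parts of paths, and choosing three independent indices -/

lemma SimpleGraph.Walk.getVert_idxOf {V : Type*} [DecidableEq V] {G : SimpleGraph V} {u v x : V}
    (W : G.Walk u v) (hx : x ∈ W.support) :
    W.getVert (W.support.idxOf x) = x ∧ W.support.idxOf x ≤ W.length := by
  have h := List.idxOf_lt_length_of_mem hx
  have h' : W.support.idxOf x ≤ W.length := by
    rw [W.length_support] at h
    omega
  refine ⟨?_, h'⟩
  rw [W.getVert_eq_support_getElem h']
  exact List.getElem_idxOf h

lemma SimpleGraph.Walk.IsPath.idxOf_getVert {V : Type*} [DecidableEq V] {G : SimpleGraph V}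
    {u v : V} {W : G.Walk u v} (hW : W.IsPath) {m : ℕ} (hm : m ≤ W.length) :
    W.support.idxOf (W.getVert m) = m := by
  have h := W.getVert_idxOf (W.getVert_mem_support m)
  exact hW.getVert_injOn h.2 hm h.1

/-- The part of a path from `x` on. -/
lemma SimpleGraph.Walk.IsPath.exists_tail {V : Type*} [DecidableEq V] {G : SimpleGraph V}
    {u v x : V} {W : G.Walk u v} (hW : W.IsPath) (hx : x ∈ W.support) :
    ∃ R : G.Walk x v, R.IsPath ∧ R.getVert 1 = W.getVert (W.support.idxOf x + 1) ∧
      ∀ z ∈ R.support, z ∈ W.support ∧ W.support.idxOf x ≤ W.support.idxOf z := by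
  obtain ⟨h1, h2⟩ := W.getVert_idxOf hx
  set m := W.support.idxOf x
  refine ⟨(W.drop m).copy h1 rfl, by simpa using hW.drop m, by simp, ?_⟩
  intro z hz
  rw [SimpleGraph.Walk.support_copy, SimpleGraph.Walk.mem_support_iff_exists_getVert] at hz
  obtain ⟨j, rfl, hj⟩ := hz
  rw [SimpleGraph.Walk.drop_getVert]
  rw [SimpleGraph.Walk.drop_length] at hj
  exact ⟨W.getVert_mem_support _, by rw [hW.idxOf_getVert (by omega)]; omega⟩

/-- The part of a path strictly after `x` up to a later vertex `y`. -/
lemma SimpleGraph.Walk.IsPath.exists_between {V : Type*} [DecidableEq V] {G : SimpleGraph V}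
    {u v x y : V} {W : G.Walk u v} (hW : W.IsPath) (hy : y ∈ W.support)
    (hxy : W.support.idxOf x < W.support.idxOf y) :
    ∃ R : G.Walk (W.getVert (W.support.idxOf x + 1)) y, ∀ z ∈ R.support,
      z ∈ W.support ∧ W.support.idxOf x < W.support.idxOf z ∧
        W.support.idxOf z ≤ W.support.idxOf y := by
  obtain ⟨h1, h2⟩ := W.getVert_idxOf hy
  set m := W.support.idxOf x
  set m' := W.support.idxOf y
  refine ⟨((W.drop (m + 1)).take (m' - (m + 1))).copy rfl ?_, ?_⟩
  · rw [SimpleGraph.Walk.drop_getVert, Nat.add_sub_cancel' hxy, h1]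
  · intro z hz
    rw [SimpleGraph.Walk.support_copy, SimpleGraph.Walk.mem_support_iff_exists_getVert] at hz
    obtain ⟨j, rfl, hj⟩ := hz
    rw [SimpleGraph.Walk.take_getVert, SimpleGraph.Walk.drop_getVert]
    rw [SimpleGraph.Walk.take_length] at hj
    refine ⟨W.getVert_mem_support _, ?_, ?_⟩ <;> rw [hW.idxOf_getVert (by omega)] <;> omega

lemma injective_vec3 {α : Type*} {x y z : α} (hxy : x ≠ y) (hxz : x ≠ z) (hyz : y ≠ z) :
    Function.Injective ![x, y, z] := by
  intro a b
  fin_cases a <;> fin_cases b <;> simp [hxy, hxz, hyz, hxy.symm, hxz.symm, hyz.symm]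

/-- A relation in which every element is related to at most `d` others has three pairwise
unrelated elements if there are at least `4 d + 3` elements. -/
lemma exists_three_unrelated {ι : Type*} {J : Finset ι} {d : ℕ} {r : ι → ι → Prop}
    [DecidableRel r] (h : ∀ i ∈ J, (J.filter fun j => r i j).card ≤ d) (hJ : 4 * d + 3 ≤ J.card) :
    ∃ i : Fin 3 → ι, Function.Injective i ∧ (∀ a, i a ∈ J) ∧ ∀ a b, a ≠ b → ¬ r (i a) (i b) := by
  classical
  -- Out-degrees are at most `d`, so the average in-degree is too.
  have pick : ∀ K ⊆ J, K.Nonempty → ∃ x ∈ K, (K.filter fun j => r j x).card ≤ d := by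
    intro K hK hne
    by_contra hcon
    push Not at hcon
    have h1 : ∑ i ∈ K, (K.filter fun j => r i j).card = ∑ j ∈ K, (K.filter fun i => r i j).card :=
      Finset.sum_card_bipartiteAbove_eq_sum_card_bipartiteBelow r
    have h2 : ∑ i ∈ K, (K.filter fun j => r i j).card ≤ ∑ i ∈ K, d :=
      Finset.sum_le_sum fun i hi =>
        (Finset.card_le_card (Finset.filter_subset_filter _ hK)).trans (h i (hK hi))
    have h3 : ∑ i ∈ K, d < ∑ j ∈ K, (K.filter fun i => r i j).card :=
      Finset.sum_lt_sum_of_nonempty hne hcon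
    omega
  -- Removing `x` and its neighbors in both directions costs at most `2 * d + 1` elements; doing
  -- this twice leaves one of `4 * d + 3`.
  have step : ∀ K ⊆ J, K.Nonempty → ∃ x ∈ K, ∃ K' ⊆ K, K.card ≤ K'.card + (2 * d + 1) ∧
      ∀ y ∈ K', y ≠ x ∧ ¬ r x y ∧ ¬ r y x := by
    intro K hK hne
    obtain ⟨x, hx, hxd⟩ := pick K hK hne
    refine ⟨x, hx, K \ ((K.filter fun j => r j x) ∪ (K.filter fun j => r x j) ∪ {x}),
      Finset.sdiff_subset, ?_, ?_⟩
    · have h1 := Finset.le_card_sdiff ((K.filter fun j => r j x) ∪ (K.filter fun j => r x j) ∪ {x}) K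
      have h2 := Finset.card_union_le ((K.filter fun j => r j x) ∪ (K.filter fun j => r x j)) {x}
      have h3 := Finset.card_union_le (K.filter fun j => r j x) (K.filter fun j => r x j)
      have h4 := (Finset.card_le_card (Finset.filter_subset_filter (fun j => r x j) hK)).trans
        (h x (hK hx))
      rw [Finset.card_singleton] at h2
      omega
    · intro y hy
      simp only [Finset.mem_sdiff, Finset.mem_union, Finset.mem_filter, Finset.mem_singleton,
        not_or, not_and] at hy
      exact ⟨hy.2.2, hy.2.1.2 hy.1, hy.2.1.1 hy.1⟩
  obtain ⟨x, hx, K, hKJ, hK, hxK⟩ := step J le_rfl (Finset.card_pos.1 (by omega))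
  obtain ⟨y, hy, K', hKK, hK', hyK⟩ := step K hKJ (Finset.card_pos.1 (by omega))
  obtain ⟨z, hz⟩ : K'.Nonempty := Finset.card_pos.1 (by omega)
  have hxy := hxK y hy
  have hxz := hxK z (hKK hz)
  have hyz := hyK z hz
  refine ⟨![x, y, z], ?_, ?_, ?_⟩
  · exact injective_vec3 hxy.1.symm hxz.1.symm hyz.1.symm
  · intro a
    fin_cases a
    exacts [hx, hKJ hy, hKJ (hKK hz)]
  · intro a b hab
    fin_cases a <;> fin_cases b <;> simp_all

/-! ### Hub systems -/

namespace ColoredPathStar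

variable {n : ℕ} {I : ColoredPathStar n} {v t : Fin n} {ι : Type*} {P : ι → I.G.Walk I.s v}

/-- The position of `x` on the `i`-th path. -/
def position (P : ι → I.G.Walk I.s v) (i : ι) (x : Fin n) : ℕ :=
  (P i).support.idxOf x

/-- The vertex after `x` on the `i`-th path. -/
def next (P : ι → I.G.Walk I.s v) (i : ι) (x : Fin n) : Fin n :=
  (P i).getVert (position P i x + 1)

lemma next_mem_support (i : ι) (x : Fin n) : next P i x ∈ (P i).support :=
  (P i).getVert_mem_support _

lemma adj_next {i : ι} {x : Fin n} (hx : x ∈ (P i).support) (hxv : x ≠ v) :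
    I.G.Adj x (next P i x) := by
  obtain ⟨h1, h2⟩ := (P i).getVert_idxOf hx
  have h3 : (P i).support.idxOf x < (P i).length := by
    refine lt_of_le_of_ne h2 fun h => hxv ?_
    rw [← h1, h, (P i).getVert_length]
  have := (P i).adj_getVert_succ h3
  rwa [h1] at this

lemma position_lt_or_lt {i : ι} {x y : Fin n} (hx : x ∈ (P i).support) (hxy : x ≠ y) :
    position P i x < position P i y ∨ position P i y < position P i x := by
  rw [← Nat.ne_iff_lt_or_gt]
  intro h
  exact hxy ((List.idxOf_inj hx).1 h)

/-- Three of the paths cannot each have the vertex after the common vertex `h` joined to `t` by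
a walk that avoids the other two paths from `h` on. -/
lemma false_of_three_tails (hP : ∀ i, (P i).IsPath) {i : Fin 3 → ι} {h : Fin n} (hv : h ≠ v)
    (hmem : ∀ a, h ∈ (P (i a)).support) (W : ∀ a, I.G.Walk (next P (i a) h) t)
    (hW : ∀ a b, a ≠ b → ∀ x ∈ (W a).support, x ∈ (P (i b)).support →
      position P (i b) x < position P (i b) h) : False := by
  choose R hR hR1 hRs using fun a => (hP (i a)).exists_tail (hmem a)
  replace hR1 : ∀ a, (R a).getVert 1 = next P (i a) h := hR1
  refine I.planar.false_of_three_paths hv R hR (fun a => (W a).copy (hR1 a).symm rfl) ?_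
  intro a b hab x hx hxb
  rw [SimpleGraph.Walk.support_copy] at hx
  have h1 := hRs b x hxb
  exact absurd (hW a b hab x hx h1.1) (not_lt.2 h1.2)

lemma notMem_support_of_mem_colors (hdis : ∀ i j, i ≠ j → Disjoint (I.colors (P i)) (I.colors (P j)))
    {i j : ι} (hij : i ≠ j) {c : ℕ} (hc : c ∈ I.colors (P i)) {x : Fin n} (hx : c ∈ I.χ x) :
    x ∉ (P j).support := fun h =>
  Finset.disjoint_left.1 (hdis i j hij) hc (I.mem_colors.2 ⟨x, h, hx⟩)

/-- At most two paths have a common color after each of two common vertices. -/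
lemma false_of_three_common_colors (hP : ∀ i, (P i).IsPath)
    (hdis : ∀ i j, i ≠ j → Disjoint (I.colors (P i)) (I.colors (P j)))
    {i : Fin 3 → ι} (hi : Function.Injective i) {g h : Fin n} (hgv : g ≠ v) (hv : h ≠ v)
    (hg : ∀ a, g ∈ (P (i a)).support) (hh : ∀ a, h ∈ (P (i a)).support)
    (hgh : ∀ a, position P (i a) g < position P (i a) h)
    (hc : ∀ a, ∃ c ∈ I.χ (next P (i a) g), c ∈ I.χ (next P (i a) h)) : False := by
  -- The earlier hub `g` plays the role of the common target: walk inside the shared color from the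
  -- vertex after `h` to the vertex after `g`, then back to `g`. The color is private to the path,
  -- and `g` precedes `h` on all of them.
  have key : ∀ a, ∃ W : I.G.Walk (next P (i a) h) g, ∀ x ∈ W.support, x = g ∨
      ∃ c ∈ I.colors (P (i a)), c ∈ I.χ x := by
    intro a
    obtain ⟨c, hcg, hch⟩ := hc a
    obtain ⟨W, hW⟩ := exists_walk_of_color hch hcg
    refine ⟨W.concat (adj_next (hg a) hgv).symm, fun x hx => ?_⟩
    rw [SimpleGraph.Walk.support_concat, List.mem_append, List.mem_singleton] at hx
    rcases hx with hx | hx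
    · exact Or.inr ⟨c, I.mem_colors.2 ⟨_, next_mem_support _ _, hch⟩, hW x hx⟩
    · exact Or.inl hx
  choose W hW using key
  refine false_of_three_tails hP hv hh W ?_
  intro a b hab x hx hxb
  rcases hW a x hx with rfl | ⟨c, hc, hcx⟩
  · exact hgh b
  · exact absurd hxb (notMem_support_of_mem_colors hdis (fun h => hab (hi h)) hc hcx)

/-- The paths with index in `J` pass the uncolored vertices in `H` in the same order. -/
structure HubSystem (P : ι → I.G.Walk I.s v) (H : Finset (Fin n)) (J : Finset ι) : Prop where
  mem : ∀ i ∈ J, ∀ h ∈ H, h ∈ (P i).support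
  ne : ∀ h ∈ H, h ≠ v
  uncolored : ∀ h ∈ H, I.χ h = ∅
  order : ∀ i ∈ J, ∀ j ∈ J, ∀ g ∈ H, ∀ h ∈ H,
    position P i g < position P i h → position P j g < position P j h

/-- Each ordered pair of hubs spoils at most two paths by a color repeated after both. With more
than `2 * |H| ^ 2` paths, one is unspoiled; on it, choosing a color of the vertex after each hub is
an injection into at most `k` colors. -/
lemma HubSystem.card_le (hI : I.Irreducible) (hP : ∀ i, (P i).IsPath)
    (hdis : ∀ i j, i ≠ j → Disjoint (I.colors (P i)) (I.colors (P j)))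
    {H : Finset (Fin n)} {J : Finset ι} (hHJ : HubSystem P H J)
    (hk : ∀ i, (I.colors (P i)).card ≤ I.k) (hJ : 2 * H.card ^ 2 < J.card) : H.card ≤ I.k := by
  classical
  let bad : Fin n × Fin n → Finset ι := fun x => J.filter fun i =>
    position P i x.1 < position P i x.2 ∧ ∃ c ∈ I.χ (next P i x.1), c ∈ I.χ (next P i x.2)
  have hbad : ∀ x ∈ H ×ˢ H, (bad x).card ≤ 2 := by
    rintro ⟨g, h⟩ hgh
    rw [Finset.mem_product] at hgh
    by_contra hcon
    rw [not_le, Finset.two_lt_card] at hcon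
    obtain ⟨a, ha, b, hb, c, hc, hab, hac, hbc⟩ := hcon
    simp only [bad, Finset.mem_filter] at ha hb hc
    have hall : ∀ m : Fin 3, ![a, b, c] m ∈ J ∧
        position P (![a, b, c] m) g < position P (![a, b, c] m) h ∧
        ∃ d ∈ I.χ (next P (![a, b, c] m) g), d ∈ I.χ (next P (![a, b, c] m) h) := by
      intro m
      fin_cases m
      exacts [ha, hb, hc]
    refine false_of_three_common_colors hP hdis (i := ![a, b, c]) ?_ (hHJ.ne g hgh.1)
      (hHJ.ne h hgh.2) (fun m => hHJ.mem _ (hall m).1 g hgh.1)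
      (fun m => hHJ.mem _ (hall m).1 h hgh.2) (fun m => (hall m).2.1) (fun m => (hall m).2.2)
    exact injective_vec3 hab hac hbc
  have hcard : ((H ×ˢ H).biUnion bad).card < J.card := by
    refine lt_of_le_of_lt (Finset.card_biUnion_le_card_mul _ _ 2 hbad) ?_
    rw [Finset.card_product]
    linarith [sq H.card]
  obtain ⟨i, hiJ, hi⟩ := Finset.exists_mem_notMem_of_card_lt_card hcard
  have hne : ∀ h ∈ H, ∃ c, c ∈ I.χ (next P i h) := fun h hh =>
    hI.nonempty_of_adj (adj_next (hHJ.mem i hiJ h hh) (hHJ.ne h hh)) (hHJ.uncolored h hh)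
  choose! c hc using hne
  refine le_trans (Finset.card_le_card_of_injOn c (fun h hh => ?_) ?_) (hk i)
  · exact I.mem_colors.2 ⟨_, next_mem_support _ _, hc h hh⟩
  · have hlt : ∀ g ∈ H, ∀ h ∈ H, c g = c h → ¬ position P i g < position P i h := by
      intro g hg h hh hgh hpos
      apply hi
      rw [Finset.mem_biUnion]
      exact ⟨(g, h), Finset.mem_product.2 ⟨hg, hh⟩,
        Finset.mem_filter.2 ⟨hiJ, hpos, c g, hc g hg, hgh ▸ hc h hh⟩⟩
    intro g hg h hh hgh
    by_contra hne
    rcases position_lt_or_lt (hHJ.mem i hiJ g hg) hne with h1 | h1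
    · exact hlt g hg h hh hgh h1
    · exact hlt h hh g hg hgh.symm h1

-- Sort the paths through `z` by the set of hubs that they pass before `z`. Within one of the at
-- most `2 ^ |H|` classes the order of the enlarged system is constant.
open Classical in
lemma HubSystem.exists_insert {H : Finset (Fin n)} {J : Finset ι} (hHJ : HubSystem P H J)
    {z : Fin n} (hz : z ∉ H) (hzv : z ≠ v) (hz0 : I.χ z = ∅) {m : ℕ}
    (hm : 2 ^ H.card * m ≤ (J.filter fun i => z ∈ (P i).support).card) :
    ∃ J' ⊆ J, m ≤ J'.card ∧ HubSystem P (insert z H) J' := by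
  let f : ι → Finset (Fin n) := fun i => H.filter fun h => position P i h < position P i z
  obtain ⟨B, hB, hBm⟩ := Finset.exists_le_card_fiber_of_mul_le_card_of_maps_to
    (s := J.filter fun i => z ∈ (P i).support) (t := H.powerset) (f := f) (n := m)
    (fun i _ => Finset.mem_powerset.2 (Finset.filter_subset _ _)) ⟨∅, by simp⟩
    (by rwa [Finset.card_powerset])
  refine ⟨_, (Finset.filter_subset _ _).trans (Finset.filter_subset _ _), hBm, ?_, ?_, ?_, ?_⟩
  · intro i hi h hh
    simp only [Finset.mem_filter] at hi
    rcases Finset.mem_insert.1 hh with rfl | hh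
    · exact hi.1.2
    · exact hHJ.mem i hi.1.1 h hh
  · intro h hh
    rcases Finset.mem_insert.1 hh with rfl | hh
    · exact hzv
    · exact hHJ.ne h hh
  · intro h hh
    rcases Finset.mem_insert.1 hh with rfl | hh
    · exact hz0
    · exact hHJ.uncolored h hh
  · intro i hi j hj g hg h hh hgh
    simp only [Finset.mem_filter] at hi hj
    have hlt : ∀ x ∈ H, position P i x < position P i z ↔ position P j x < position P j z := by
      intro x hx
      have h1 : x ∈ f i ↔ x ∈ f j := by rw [hi.2, hj.2]
      simpa [f, hx] using h1
    rcases Finset.mem_insert.1 hg with rfl | hg' <;> rcases Finset.mem_insert.1 hh with rfl | hh'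
    · exact absurd hgh (lt_irrefl _)
    · have h1 : ¬ position P j h < position P j g := by
        rw [← hlt h hh']
        omega
      exact (position_lt_or_lt hj.1.2 (fun h2 => hz (h2 ▸ hh'))).resolve_right h1
    · exact (hlt g hg').1 hgh
    · exact hHJ.order i hi.1.1 j hj.1.1 g hg' h hh' hgh

open Classical in
/-- A hub system that cannot be extended: every other vertex is on few of the paths. -/
lemma exists_maximal_hubSystem [Fintype ι] (hI : I.Irreducible) (hP : ∀ i, (P i).IsPath)
    (hdis : ∀ i j, i ≠ j → Disjoint (I.colors (P i)) (I.colors (P j)))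
    (hk : ∀ i, (I.colors (P i)).card ≤ I.k) (hs : I.χ I.s = ∅) (hsv : I.s ≠ v) {B : ℕ}
    (hB : 2 * (I.k + 1) ^ 2 < B) (hι : B ^ (I.k + 1) ≤ Fintype.card ι) :
    ∃ (H : Finset (Fin n)) (J : Finset ι) (m : ℕ), HubSystem P H J ∧ I.s ∈ H ∧ H.card ≤ I.k ∧
      1 ≤ m ∧ B * m ≤ J.card ∧
      ∀ z, z ∉ H → z ≠ v → (J.filter fun i => z ∈ (P i).support).card ≤ 2 ^ I.k * m := by
  have hB1 : 1 ≤ B := by omega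
  -- Each new hub may cost a factor `B`. The exponent is still `1` at `r = k + 1`, so that
  -- `HubSystem.card_le` applies there and excludes this value.
  let Q : ℕ → Prop := fun r => ∃ (H : Finset (Fin n)) (J : Finset ι), HubSystem P H J ∧
    I.s ∈ H ∧ H.card = r ∧ B ^ (I.k + 2 - r) ≤ J.card
  have hQ1 : Q 1 := by
    refine ⟨{I.s}, Finset.univ, ⟨?_, ?_, ?_, ?_⟩, by simp, by simp, ?_⟩
    · intro i _ h hh
      rw [Finset.mem_singleton.1 hh]
      exact (P i).start_mem_support
    · intro h hh
      rwa [Finset.mem_singleton.1 hh]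
    · intro h hh
      rwa [Finset.mem_singleton.1 hh]
    · intro i _ j _ g hg h hh hgh
      rw [Finset.mem_singleton.1 hg, Finset.mem_singleton.1 hh] at hgh
      exact absurd hgh (lt_irrefl _)
    · simpa using hι
  have hQk : ∀ r, r ≤ I.k + 1 → Q r → r ≤ I.k := by
    rintro r hr ⟨H, J, hHJ, -, rfl, hJ⟩
    refine hHJ.card_le hI hP hdis hk ?_
    calc 2 * H.card ^ 2 ≤ 2 * (I.k + 1) ^ 2 := by gcongr
      _ < B := hB
      _ = B ^ 1 := (pow_one B).symm
      _ ≤ B ^ (I.k + 2 - H.card) := Nat.pow_le_pow_right hB1 (by omega)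
      _ ≤ _ := hJ
  have hfg := Nat.findGreatest_spec (P := Q) (n := I.k + 1) (m := 1) (by omega) hQ1
  set r := Nat.findGreatest Q (I.k + 1) with hr
  have hrk : r ≤ I.k := hQk r (Nat.findGreatest_le _) hfg
  obtain ⟨H, J, hHJ, hsH, hHr, hJ⟩ := hfg
  refine ⟨H, J, B ^ (I.k + 1 - r), hHJ, hsH, hHr ▸ hrk, Nat.one_le_pow _ _ hB1, ?_, ?_⟩
  · rw [← pow_succ']
    refine le_trans (le_of_eq ?_) hJ
    congr 1
    omega
  · intro z hz hzv
    by_cases hz0 : I.χ z = ∅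
    -- An uncolored vertex on too many paths would be a further hub, against the maximality of `r`.
    · by_contra hcon
      push Not at hcon
      have hle : 2 ^ H.card * B ^ (I.k + 1 - r) ≤
          (J.filter fun i => z ∈ (P i).support).card := by
        refine le_trans ?_ hcon.le
        gcongr
        · norm_num
        · omega
      obtain ⟨J', hJ', hm, hsys⟩ := hHJ.exists_insert hz hzv hz0 hle
      have hQr : Q (r + 1) := ⟨_, J', hsys, Finset.mem_insert_of_mem hsH,
        by rw [Finset.card_insert_of_notMem hz, hHr], by
          rwa [show I.k + 2 - (r + 1) = I.k + 1 - r by omega]⟩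
      have := Nat.le_findGreatest (P := Q) (n := I.k + 1) (by omega : r + 1 ≤ I.k + 1) hQr
      omega
    -- A colored vertex is on at most one path, the color sets being disjoint.
    · have h1 : (J.filter fun i => z ∈ (P i).support).card ≤ 1 := by
        obtain ⟨c, hc⟩ := Finset.nonempty_iff_ne_empty.2 hz0
        rw [Finset.card_le_one]
        intro i hi j hj
        by_contra hij
        rw [Finset.mem_filter] at hi hj
        exact notMem_support_of_mem_colors hdis hij (I.mem_colors.2 ⟨z, hi.2, hc⟩) hc hj.2
      refine h1.trans (Nat.one_le_iff_ne_zero.2 ?_)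
      positivity

end ColoredPathStar

/-! ### Large families contain an unlinked set -/

lemma two_mul_sq_lt_two_pow (k : ℕ) : 2 * (k + 1) ^ 2 < 2 ^ (20 * (k + 1)) := by
  have h1 : k + 1 < 2 ^ (k + 1) := Nat.lt_two_pow_self
  calc 2 * (k + 1) ^ 2 < 2 * (2 ^ (k + 1)) ^ 2 := by gcongr
    _ = 2 ^ (2 * (k + 1) + 1) := by ring
    _ ≤ 2 ^ (20 * (k + 1)) := Nat.pow_le_pow_right (by norm_num) (by omega)

/-- Pigeonhole over `k` hubs must leave `4 * d + 3` paths, where `d` is the number of paths met by a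
walk from `3 * k + (1 + 3 * k)` links whose vertices are on at most `2 ^ k * m` paths each. -/
lemma hub_bound (k m : ℕ) (hm : 1 ≤ m) :
    k * (4 * (2 ^ k * m * (3 * k + (1 + 3 * k) + 1)) + 3) ≤ 2 ^ (20 * (k + 1)) * m := by
  have h1 : k ≤ 2 ^ k := Nat.lt_two_pow_self.le
  have h2 : 1 ≤ 2 ^ k := Nat.one_le_two_pow
  have h3 : 3 * k + (1 + 3 * k) + 1 ≤ 8 * 2 ^ k := by omega
  calc k * (4 * (2 ^ k * m * (3 * k + (1 + 3 * k) + 1)) + 3)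
      ≤ 2 ^ k * (4 * (2 ^ k * m * (8 * 2 ^ k)) + 3 * (2 ^ k * 2 ^ k * m)) := by
        gcongr
        have : 1 ≤ 2 ^ k * 2 ^ k * m := Nat.one_le_iff_ne_zero.2 (by positivity)
        omega
    _ = 35 * 2 ^ (k * 3) * m := by ring
    _ ≤ 2 ^ 6 * 2 ^ (k * 3) * m := by gcongr; norm_num
    _ = 2 ^ (6 + k * 3) * m := by ring
    _ ≤ 2 ^ (20 * (k + 1)) * m := by gcongr <;> omega

namespace ColoredPathStar

variable {n : ℕ} {I : ColoredPathStar n} {v : Fin n}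

/-- The links from a path to a color and from the color to `t`, put together. -/
lemma expand_next_of_linkedToTarget (hI : I.Irreducible) {ι : Type*} {P : ι → I.G.Walk I.s v}
    {i : ι} (hP : (P i).IsPath) (hk : (I.colors (P i)).card ≤ I.k) {H : Finset (Fin n)}
    (hH : ∀ h ∈ H, h ∈ (P i).support) (hH0 : ∀ h ∈ H, I.χ h = ∅) (hv : I.χ v = ∅)
    {a u w : Fin n} {c : ℕ} (ha : a ∈ H) (hav : a ≠ v) (hu : u ∈ (P i).support)
    (hau : position P i a < position P i u)
    (hlast : ∀ h ∈ H, position P i h < position P i u → position P i h ≤ position P i a)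
    (hcu : c ∈ I.χ u) (hcw : c ∈ I.χ w)
    (hw : expand I.Linked (I.Allowed (I.colors (P i))) (fun z => z = w) (3 * I.k) I.t) :
    expand I.Linked (fun z => z ∉ H ∧ z ≠ v) (fun z => z = next P i a)
      (3 * I.k + (1 + 3 * I.k)) I.t := by
  have hcolored : ∀ z c, c ∈ I.χ z → z ∉ H ∧ z ≠ v := by
    intro z c hc
    constructor
    · intro hz
      rw [hH0 z hz] at hc
      exact Finset.notMem_empty _ hc
    · rintro rfl
      rw [hv] at hc
      exact Finset.notMem_empty _ hc
  obtain ⟨R, hR⟩ := hP.exists_between hu hau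
  -- The part from `a` to `u` meets no hub since `a` is the last one before `u`, and it ends at the
  -- colored vertex `u`, hence before `v`.
  have hR' : ∀ z ∈ R.support, z ∉ H ∧ z ≠ v := by
    intro z hz
    obtain ⟨h1, h2, h3⟩ := hR z hz
    by_cases hzu : z = u
    · exact hzu ▸ hcolored u c hcu
    have h4 : position P i z < position P i u :=
      (position_lt_or_lt h1 hzu).resolve_right (not_lt.2 h3)
    refine ⟨fun hzH => absurd h2 (not_lt.2 (hlast z hzH h4)), ?_⟩
    rintro rfl
    have h5 : position P i z = (P i).length := by
      have := hP.idxOf_getVert le_rfl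
      rwa [(P i).getVert_length] at this
    have h6 : position P i u ≤ (P i).length := ((P i).getVert_idxOf hu).2
    omega
  have hnext : (I.χ (next P i a)).Nonempty :=
    hI.nonempty_of_adj (adj_next (hH a ha) hav) (hH0 a ha)
  have h1 := hI.expand_of_walk (A := fun z => z ∉ H ∧ z ≠ v) (X := fun z => z = next P i a)
    I.k R (r := 0) hR' hnext ((Finset.card_le_card fun d hd => by
      obtain ⟨z, hz, hdz⟩ := I.mem_colors.1 hd
      exact I.mem_colors.2 ⟨z, (hR z hz).1, hdz⟩).trans hk) rfl
  have h2 := expand_step h1 (hcolored w c hcw) (Or.inr ⟨c, hcu, hcw⟩)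
  have h3 := expand_trans (A' := fun z => z ∉ H ∧ z ≠ v) (X' := fun z => z = next P i a)
    (fun z hz => ?_) (fun x hx => by rw [hx]; exact h2) hw
  · exact expand_mono (by omega) h3
  -- Hubs and `v` are uncolored vertices on the path, hence reached by its colors and not allowed:
  -- this is why allowed vertices stay off them.
  · have hreach : ∀ x ∈ (P i).support, I.Reach (I.colors (P i)) x := by
      intro x hx
      refine I.reach_iff.2 ⟨(P i).takeUntil x hx, hP.takeUntil hx, ?_⟩
      intro d hd
      obtain ⟨y, hy, hdy⟩ := I.mem_colors.1 hd
      exact I.mem_colors.2 ⟨y, (P i).support_takeUntil_subset_support hx hy, hdy⟩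
    constructor
    · exact fun hzH => hz.2 ⟨hH0 z hzH, hreach z (hH z hzH)⟩
    · rintro rfl
      exact hz.2 ⟨hv, hreach _ (P i).end_mem_support⟩

open Classical in
/-- In a large family of disjoint minimal color sets, some set is not linked to `t`. -/
theorem exists_not_linkedToTarget_of_paths (hI : I.Irreducible) {ι : Type*} [Fintype ι]
    {P : ι → I.G.Walk I.s v} (hP : ∀ i, (P i).IsPath)
    (hdis : ∀ i j, i ≠ j → Disjoint (I.colors (P i)) (I.colors (P j)))
    (hk : ∀ i, (I.colors (P i)).card ≤ I.k) (hs : I.χ I.s = ∅) (hv : I.χ v = ∅)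
    (hsv : I.s ≠ v) {B : ℕ} (hB : 2 * (I.k + 1) ^ 2 < B)
    (hBm : ∀ m, 1 ≤ m →
      I.k * (4 * (2 ^ I.k * m * (3 * I.k + (1 + 3 * I.k) + 1)) + 3) ≤ B * m)
    (hι : B ^ (I.k + 1) ≤ Fintype.card ι) :
    ∃ i, ¬ I.LinkedToTarget (I.colors (P i)) := by
  by_contra hcon
  push Not at hcon
  obtain ⟨H, J, m, hHJ, hsH, hHk, hm, hJ, hlow⟩ := exists_maximal_hubSystem hI hP hdis hk hs hsv hB hι
  have hlink : ∀ i, ∃ w u c, u ∈ (P i).support ∧ c ∈ I.χ u ∧ c ∈ I.χ w ∧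
      expand I.Linked (I.Allowed (I.colors (P i))) (fun z => z = w) (3 * I.k) I.t := by
    intro i
    obtain ⟨w, ⟨-, c, hcw, hc⟩, hw⟩ := exists_expand_singleton (hcon i)
    obtain ⟨u, hu, hcu⟩ := I.mem_colors.1 hc
    exact ⟨w, u, c, hu, hcu, hcw, hw⟩
  choose w u c hu hcu hcw hw using hlink
  have hsu : ∀ i, position P i I.s < position P i (u i) := by
    intro i
    have hne : I.s ≠ u i := by
      intro h
      have := hcu i
      rw [← h, hs] at this
      exact Finset.notMem_empty _ this
    have h0 : position P i I.s = 0 := by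
      have := (hP i).idxOf_getVert (Nat.zero_le _)
      rwa [(P i).getVert_zero] at this
    have := position_lt_or_lt (P i).start_mem_support hne
    omega
  have hmax : ∀ i, ∃ a ∈ H, position P i a < position P i (u i) ∧
      ∀ h ∈ H, position P i h < position P i (u i) → position P i h ≤ position P i a := by
    intro i
    obtain ⟨a, ha, hamax⟩ := Finset.exists_max_image
      (H.filter fun h => position P i h < position P i (u i)) (position P i)
      ⟨I.s, Finset.mem_filter.2 ⟨hsH, hsu i⟩⟩
    rw [Finset.mem_filter] at ha
    exact ⟨a, ha.1, ha.2, fun h hh hlt => hamax h (Finset.mem_filter.2 ⟨hh, hlt⟩)⟩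
  choose a haH hau hlast using hmax
  set M := 2 ^ I.k * m with hM
  have hM1 : 1 ≤ M := Nat.one_le_iff_ne_zero.2 (by positivity)
  set d := M * (3 * I.k + (1 + 3 * I.k) + 1) with hd
  -- Many paths have the same last hub `b` before the vertex where their link starts.
  obtain ⟨b, hbH, hb⟩ := Finset.exists_le_card_fiber_of_mul_le_card_of_maps_to
    (s := J) (t := H) (f := a) (n := 4 * d + 3) (fun i _ => haH i) ⟨_, hsH⟩
    ((Nat.mul_le_mul_right _ hHk).trans ((hBm m hm).trans hJ))
  set K := J.filter fun i => a i = b with hK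
  have hcol : ∀ c, (J.filter fun j => ∃ z ∈ (P j).support, c ∈ I.χ z).card ≤ M := by
    intro c
    refine le_trans (Finset.card_le_one.2 ?_) hM1
    intro i hi j hj
    by_contra hij
    simp only [Finset.mem_filter] at hi hj
    obtain ⟨-, x, hx, hcx⟩ := hi
    obtain ⟨-, y, hy, hcy⟩ := hj
    exact notMem_support_of_mem_colors hdis hij (I.mem_colors.2 ⟨x, hx, hcx⟩) hcy hy
  have hwalk : ∀ i ∈ K, ∃ W : I.G.Walk (next P i b) I.t,
      (J.filter fun j => ∃ z ∈ W.support, z ∈ (P j).support).card ≤ d := by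
    intro i hi
    rw [hK, Finset.mem_filter] at hi
    obtain ⟨hiJ, rfl⟩ := hi
    have hnext := hI.nonempty_of_adj (adj_next (hHJ.mem i hiJ _ hbH) (hHJ.ne _ hbH))
      (hHJ.uncolored _ hbH)
    refine exists_walk_of_expand (J := J) (S := fun j => (P j).support)
      (A := fun z => z ∉ H ∧ z ≠ v) (M := M) ?_
      (fun z hz => hlow z hz.1 hz.2) hcol
      (expand_next_of_linkedToTarget hI (hP i) (hk i) (hHJ.mem i hiJ) hHJ.uncolored hv hbH
        (hHJ.ne _ hbH) (hu i) (hau i) (hlast i) (hcu i) (hcw i) (hw i))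
    refine hlow _ (fun h => ?_) (fun h => ?_)
    · exact hnext.ne_empty (hHJ.uncolored _ h)
    · exact hnext.ne_empty (h.symm ▸ hv)
  choose W hW using hwalk
  -- Relate `i` to `j` if the walk of `i` meets the path of `j`; every walk meets at most `d` paths.
  obtain ⟨i, hi, hiK, hindep⟩ := exists_three_unrelated (J := K) (d := d)
    (r := fun i j => ∃ h : i ∈ K, ∃ z ∈ (W i h).support, z ∈ (P j).support) (fun i hi => by
      refine (Finset.card_le_card ?_).trans (hW i hi)
      intro j hj
      rw [Finset.mem_filter] at hj ⊢
      obtain ⟨hjK, h, z, hz⟩ := hj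
      exact ⟨(Finset.mem_filter.1 hjK).1, z, hz⟩) hb
  refine false_of_three_tails hP (hHJ.ne b hbH)
    (fun e => hHJ.mem (i e) (Finset.mem_filter.1 (hiK e)).1 b hbH) (fun e => W (i e) (hiK e)) ?_
  intro e e' hee x hx hx'
  exact absurd ⟨hiK e, x, hx, hx'⟩ (hindep e e' hee)

/-- Two disjoint sets force `s` and `v` to be uncolored, and `s ≠ v` because otherwise all sets
would be empty. The bound is `B ^ (k + 1)` with `B = 2 ^ (20 * (k + 1))`. -/
theorem exists_not_linkedToTarget (hI : I.Irreducible) {l : ℕ} (hl : l ≤ I.k)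
    {L : Finset (Finset ℕ)} (hcard : ∀ p ∈ L, p.card = l)
    (hdis : ∀ p ∈ L, ∀ p' ∈ L, p ≠ p' → Disjoint p p')
    (hmin : ∀ p ∈ L, ¬ I.NonMinimal v p) (hL : 2 ^ (20 * (I.k + 1) ^ 2) < L.card) :
    ∃ p ∈ L, ¬ I.LinkedToTarget p := by
  have hL1 : 1 < L.card := lt_of_le_of_lt Nat.one_le_two_pow hL
  choose P hP hPc using fun p : {p // p ∈ L} => hasPath_of_not_nonMinimal (hmin p.1 p.2)
  have hends : ∀ x, (∀ p, x ∈ (P p).support) → I.χ x = ∅ := by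
    intro x hx
    obtain ⟨p, hp, p', hp', hne⟩ := Finset.one_lt_card.1 hL1
    have h1 : ∀ q (hq : q ∈ L), I.χ x ⊆ q := fun q hq =>
      I.colors_subset_iff.1 (hPc ⟨q, hq⟩).subset x (hx ⟨q, hq⟩)
    exact Finset.disjoint_self_iff_empty _ |>.1 ((hdis p hp p' hp' hne).mono (h1 p hp) (h1 p' hp'))
  have hs := hends I.s fun p => (P p).start_mem_support
  have hv := hends v fun p => (P p).end_mem_support
  have hsv : I.s ≠ v := by
    rintro rfl
    obtain ⟨p, hp, p', hp', hne⟩ := Finset.one_lt_card.1 hL1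
    have h1 : ∀ q (hq : q ∈ L), q = ∅ := by
      intro q hq
      refine (hPc ⟨q, hq⟩).symm.trans ?_
      rw [(SimpleGraph.Walk.isPath_iff_nil.1 (hP ⟨q, hq⟩)).eq_nil]
      simp [colors, hs]
    exact hne ((h1 p hp).trans (h1 p' hp').symm)
  obtain ⟨i, hi⟩ := exists_not_linkedToTarget_of_paths hI hP (fun i j hij => by
      rw [hPc, hPc]
      exact hdis i.1 i.2 j.1 j.2 (fun h => hij (Subtype.ext h)))
    (fun i => by rw [hPc, hcard i.1 i.2]; exact hl) hs hv hsv (two_mul_sq_lt_two_pow I.k) (hub_bound I.k)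
    (by rw [← pow_mul, mul_assoc, ← sq, Fintype.card_coe]; exact hL.le)
  exact ⟨i.1, i.2, hPc i ▸ hi⟩

end ColoredPathStar

/-! ### Reasoning about random access machines -/

/-- Started with memory `m`, the program halts within `T` steps with memory contents in `Q`. -/
def Runs (inp : List (List ℕ)) (A : RamProgram) (m : ℕ → ℕ) (T : ℕ) (Q : (ℕ → ℕ) → Prop) : Prop :=
  ∃ T' m', RamExec inp A m T' m' ∧ T' ≤ T ∧ Q m'

/-- Sequential composition of programs. -/
infixr:60 " ;; " => RamProgram.seq

/-- The entry `c` of row `r` of the input. -/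
def entry (inp : List (List ℕ)) (r c : ℕ) : ℕ :=
  (inp.getD r []).getD c 0

namespace Runs

variable {inp : List (List ℕ)} {A B : RamProgram} {m : ℕ → ℕ} {T T₁ T₂ : ℕ}
  {Q Q' : (ℕ → ℕ) → Prop} {a b d c : ℕ}

lemma mono (h : Runs inp A m T₁ Q) (hT : T₁ ≤ T₂) (hQ : ∀ m', Q m' → Q' m') :
    Runs inp A m T₂ Q' := by
  obtain ⟨T', m', h1, h2, h3⟩ := h
  exact ⟨T', m', h1, h2.trans hT, hQ m' h3⟩

lemma seq (h : Runs inp A m T₁ Q') (h' : ∀ m', Q' m' → Runs inp B m' T₂ Q) :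
    Runs inp (A ;; B) m (T₁ + T₂) Q := by
  obtain ⟨t₁, m₁, e₁, l₁, q₁⟩ := h
  obtain ⟨t₂, m₂, e₂, l₂, q₂⟩ := h' m₁ q₁
  exact ⟨_, m₂, .seq e₁ e₂, add_le_add l₁ l₂, q₂⟩

lemma const_end (h : Q (Function.update m d c)) : Runs inp (.const d c) m (T + 1) Q :=
  ⟨1, _, .const d c m, by omega, h⟩

lemma add_end (h : Q (Function.update m d (m a + m b))) : Runs inp (.add d a b) m (T + 1) Q :=
  ⟨1, _, .add d a b m, by omega, h⟩

lemma sub_end (h : Q (Function.update m d (m a - m b))) : Runs inp (.sub d a b) m (T + 1) Q :=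
  ⟨1, _, .sub d a b m, by omega, h⟩

lemma load_end (h : Q (Function.update m d (m (m a)))) : Runs inp (.load d a) m (T + 1) Q :=
  ⟨1, _, .load d a m, by omega, h⟩

lemma store_end (h : Q (Function.update m (m d) (m a))) : Runs inp (.store d a) m (T + 1) Q :=
  ⟨1, _, .store d a m, by omega, h⟩

lemma seq_of_step {m' : ℕ → ℕ} (e : RamExec inp A m 1 m') (h : Runs inp B m' T Q) :
    Runs inp (A ;; B) m (T + 1) Q := by
  obtain ⟨t, m₂, e₂, l₂, q₂⟩ := h
  exact ⟨_, m₂, .seq e e₂, by omega, q₂⟩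

lemma const (h : Runs inp B (Function.update m d c) T Q) :
    Runs inp (.const d c ;; B) m (T + 1) Q := seq_of_step (.const d c m) h

lemma add (h : Runs inp B (Function.update m d (m a + m b)) T Q) :
    Runs inp (.add d a b ;; B) m (T + 1) Q := seq_of_step (.add d a b m) h

lemma sub (h : Runs inp B (Function.update m d (m a - m b)) T Q) :
    Runs inp (.sub d a b ;; B) m (T + 1) Q := seq_of_step (.sub d a b m) h

lemma read (h : Runs inp B (Function.update m d (entry inp (m a) (m b))) T Q) :
    Runs inp (.read d a b ;; B) m (T + 1) Q := seq_of_step (.read d a b m) h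

lemma cond (h : m a ≠ 0 → Runs inp A m T Q) (h' : m a = 0 → Runs inp B m T Q) :
    Runs inp (.cond a A B) m (T + 1) Q := by
  by_cases ha : m a = 0
  · obtain ⟨t, m', e, l, q⟩ := h' ha
    exact ⟨_, m', .cond_false ha e, by omega, q⟩
  · obtain ⟨t, m', e, l, q⟩ := h ha
    exact ⟨_, m', .cond_true ha e, by omega, q⟩

end Runs

/-- `for mem[i] := 0, …, mem[N] - 1 do A`, with the test in the cell `c`. -/
def RamProgram.forLoop (i N c : ℕ) (A : RamProgram) : RamProgram :=
  .const i 0 ;; .sub c N i ;; .loop c (A ;; .const c 1 ;; .add i i c ;; .sub c N i)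

/-- The cell `c` holds the number of remaining rounds. Besides the body, a round costs one test and
three bookkeeping steps, which touch only `i` and `c`; `hstable` says that the invariant ignores
them. -/
lemma Runs.forLoop {inp : List (List ℕ)} {A : RamProgram} {m : ℕ → ℕ} {i N c Nv τ : ℕ}
    (Inv : ℕ → (ℕ → ℕ) → Prop) (hic : i ≠ c) (hNi : N ≠ i) (hNc : N ≠ c)
    (hstable : ∀ j m m', (∀ x, x ≠ i → x ≠ c → m' x = m x) → Inv j m → Inv j m')
    (hN : ∀ j m, Inv j m → m N = Nv) (h0 : Inv 0 m)
    (hbody : ∀ j m, j < Nv → Inv j m → m i = j →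
      Runs inp A m τ fun m' => m' i = j ∧ Inv (j + 1) m') :
    Runs inp (RamProgram.forLoop i N c A) m (3 + Nv * (τ + 4)) (Inv Nv) := by
  have hloop : ∀ r j m, r + j = Nv → Inv j m → m i = j → m c = Nv - j →
      Runs inp (.loop c (A ;; .const c 1 ;; .add i i c ;; .sub c N i)) m (r * (τ + 4) + 1)
        (Inv Nv) := by
    intro r
    induction r with
    | zero =>
      intro j m hj hI hi hc
      obtain rfl : j = Nv := by omega
      exact ⟨1, m, .loop_done (by omega), by omega, hI⟩
    | succ r ih =>
      intro j m hj hI hi hc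
      have h1 : Runs inp (A ;; .const c 1 ;; .add i i c ;; .sub c N i) m (τ + 3)
          (fun m' => Inv (j + 1) m' ∧ m' i = j + 1 ∧ m' c = Nv - (j + 1)) := by
        refine Runs.seq (hbody j m (by omega) hI hi) ?_
        rintro m' ⟨hi', hI'⟩
        refine Runs.const (Runs.add (Runs.sub_end ?_))
        have hN' := hN _ _ hI'
        refine ⟨hstable _ _ _ (fun x hxi hxc => ?_) hI', ?_, ?_⟩
        · simp [Function.update_apply, hxi, hxc]
        · simp [hic, hi']
        · simp [hic, hNi, hNc, hi', hN']
      obtain ⟨t₁, m₁, e₁, l₁, hI₁, hi₁, hc₁⟩ := h1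
      obtain ⟨t₂, m₂, e₂, l₂, q₂⟩ := ih (j + 1) m₁ (by omega) hI₁ hi₁ hc₁
      exact ⟨_, m₂, .loop_step (by omega) e₁ e₂, by ring_nf; ring_nf at l₂; omega, q₂⟩
  refine (Runs.const (Runs.sub (hloop Nv 0 _ rfl ?_ ?_ ?_))).mono (by omega) fun _ h => h
  · exact hstable _ _ _ (fun x hxi hxc => by simp [hxi, hxc]) h0
  · simp [hic]
  · have := hN 0 m h0
    simp [hNi, this]

/-! ### Counting common colors -/

/-- Contribution of two positions to the number of common entries of two rows. -/
def hit (inp : List (List ℕ)) (a b j x y : ℕ) : ℕ :=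
  if y + 1 ≠ j ∧ entry inp b (y + 1) = entry inp a (x + 1) then 1 else 0

/-- Number of common entries of the rows `a` and `b`, without position `j` of row `b`. -/
def commonCount (inp : List (List ℕ)) (a b j : ℕ) : ℕ :=
  ∑ x ∈ Finset.range (entry inp a 0), ∑ y ∈ Finset.range (entry inp b 0), hit inp a b j x y

namespace RamProgram

/-- One comparison: the color in cell `8` with entry `mem[9] + 1` of row `mem[21]`. -/
def countStep : RamProgram :=
  .const 13 1 ;; .add 11 9 13 ;; .read 12 21 11 ;; .sub 14 12 8 ;; .sub 15 8 12 ;; .add 14 14 15 ;;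
  .sub 15 11 22 ;; .sub 16 22 11 ;; .add 15 15 16 ;;
  .cond 14 (.const 14 0) (.cond 15 (.add 1 1 13) (.const 14 0))

/-- The inner loop of `count`. -/
def countRow : RamProgram :=
  .const 7 1 ;; .add 7 7 5 ;; .read 8 20 7 ;; forLoop 9 4 10 countStep

/-- `mem[1] := ` number of common entries of the rows `mem[20]` and `mem[21]` of the input, without
position `mem[22]` of the latter. -/
def count : RamProgram :=
  .const 2 0 ;; .read 3 20 2 ;; .read 4 21 2 ;; .const 1 0 ;; forLoop 5 3 6 countRow

end RamProgram

/-- Equality is tested by adding the truncated differences in both directions, a sum that vanishes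
exactly for equal numbers. -/
lemma runs_countStep {inp : List (List ℕ)} (m : ℕ → ℕ) {a x : ℕ}
    (h8 : m 8 = entry inp a (x + 1)) :
    Runs inp RamProgram.countStep m 12 fun m' =>
      m' 1 = m 1 + hit inp a (m 21) (m 22) x (m 9) ∧
      ∀ z, z ≠ 1 → (z < 11 ∨ 16 < z) → m' z = m z := by
  refine Runs.const (Runs.add (Runs.read (Runs.sub (Runs.sub (Runs.add (Runs.sub (Runs.sub
    (Runs.add (Runs.cond (fun h => Runs.const_end ?_) fun h => Runs.cond
      (fun h' => Runs.add_end ?_) fun h' => Runs.const_end ?_)))))))))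
  all_goals
    simp [h8] at *
    refine ⟨?_, fun z h1 h2 => ?_⟩
    · simp only [hit]
      split_ifs <;> omega
    · simp (disch := omega) [Function.update_of_ne]

lemma runs_countRow {inp : List (List ℕ)} (m : ℕ → ℕ) :
    Runs inp RamProgram.countRow m (6 + m 4 * 16) fun m' =>
      m' 1 = m 1 + ∑ y ∈ Finset.range (m 4), hit inp (m 20) (m 21) (m 22) (m 5) y ∧
      ∀ z, z ≠ 1 → (z < 7 ∨ 16 < z) → m' z = m z := by
  refine (Runs.const (Runs.add (Runs.read (Runs.forLoop (Nv := m 4) (τ := 12)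
    (fun j m' => m' 1 = m 1 + ∑ y ∈ Finset.range j, hit inp (m 20) (m 21) (m 22) (m 5) y ∧
      m' 8 = entry inp (m 20) (m 5 + 1) ∧ ∀ z, z ≠ 1 → (z < 7 ∨ 16 < z) → m' z = m z)
    (by decide) (by decide) (by decide) ?_ ?_ ?_ ?_)))).mono (by omega) fun m' h => ⟨h.1, h.2.2⟩
  · rintro j m₁ m₂ h ⟨h1, h2, h3⟩
    exact ⟨(h 1 (by decide) (by decide)).trans h1, (h 8 (by decide) (by decide)).trans h2,
      fun z hz hz' => (h z (by omega) (by omega)).trans (h3 z hz hz')⟩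
  · rintro j m₁ ⟨h1, h2, h3⟩
    exact h3 4 (by decide) (by decide)
  · refine ⟨by simp, by simp [add_comm], fun z hz hz' => ?_⟩
    simp (disch := omega) [Function.update_of_ne]
  · rintro j m₁ hj ⟨h1, h2, h3⟩ h9
    refine (runs_countStep m₁ h2).mono le_rfl ?_
    rintro m₂ ⟨h4, h5⟩
    refine ⟨(h5 9 (by decide) (by decide)).trans h9, ?_, (h5 8 (by decide) (by decide)).trans h2,
      fun z hz hz' => (h5 z hz (by omega)).trans (h3 z hz hz')⟩
    rw [h4, h1, Finset.sum_range_succ, h9, h3 21 (by decide) (by decide),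
      h3 22 (by decide) (by decide), add_assoc]

lemma runs_count {inp : List (List ℕ)} (m : ℕ → ℕ) {b : ℕ} (ha : entry inp (m 20) 0 ≤ b)
    (hb : entry inp (m 21) 0 ≤ b) :
    Runs inp RamProgram.count m (30 * (b + 1) ^ 2) fun m' =>
      m' 1 = commonCount inp (m 20) (m 21) (m 22) ∧ ∀ z, (z = 0 ∨ 16 < z) → m' z = m z := by
  refine (Runs.const (Runs.read (Runs.read (Runs.const (Runs.forLoop (Nv := entry inp (m 20) 0)
    (τ := 6 + b * 16)
    (fun j m' => m' 1 = ∑ x ∈ Finset.range j, ∑ y ∈ Finset.range (entry inp (m 21) 0),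
        hit inp (m 20) (m 21) (m 22) x y ∧
      m' 3 = entry inp (m 20) 0 ∧ m' 4 = entry inp (m 21) 0 ∧
      ∀ z, (z = 0 ∨ 16 < z) → m' z = m z)
    (by decide) (by decide) (by decide) ?_ ?_ ?_ ?_))))).mono ?_ fun m' h => ⟨h.1, h.2.2.2⟩
  · rintro j m₁ m₂ h ⟨h1, h2, h3, h4⟩
    exact ⟨(h 1 (by decide) (by decide)).trans h1, (h 3 (by decide) (by decide)).trans h2,
      (h 4 (by decide) (by decide)).trans h3,
      fun z hz => (h z (by omega) (by omega)).trans (h4 z hz)⟩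
  · rintro j m₁ ⟨h1, h2, h3, h4⟩
    exact h2
  · refine ⟨by simp, by simp, by simp, fun z hz => ?_⟩
    simp (disch := omega) [Function.update_of_ne]
  · rintro j m₁ hj ⟨h1, h2, h3, h4⟩ h5
    have h20 := h4 20 (by decide)
    have h21 := h4 21 (by decide)
    have h22 := h4 22 (by decide)
    refine (runs_countRow m₁).mono (by rw [h3]; omega) ?_
    rintro m₂ ⟨h6, h7⟩
    refine ⟨(h7 5 (by decide) (by decide)).trans h5, ?_, (h7 3 (by decide) (by decide)).trans h2,
      (h7 4 (by decide) (by decide)).trans h3, fun z hz => (h7 z (by omega) (by omega)).trans (h4 z hz)⟩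
    rw [h6, h1, h3, h20, h21, h22, h5, Finset.sum_range_succ]
  · have := Nat.mul_le_mul_right (6 + b * 16 + 4) ha
    nlinarith

/-! ### Arrays

The cells from `100` on hold three interleaved arrays: entry `i` of array `a < 3` is in the cell
`100 + 4 * i + a`. -/

namespace RamProgram

/-- `mem[17] := 100 + 4 * mem[i] + a` -/
def address (a i : ℕ) : RamProgram :=
  .add 17 i i ;; .add 17 17 17 ;; .const 18 (100 + a) ;; .add 17 17 18

/-- `mem[d] := ` entry `mem[i]` of array `a` -/
def loadEntry (a i d : ℕ) : RamProgram :=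
  address a i ;; .load d 17

/-- entry `mem[i]` of array `a` `:= mem[x]` -/
def storeEntry (a i x : ℕ) : RamProgram :=
  address a i ;; .store 17 x

end RamProgram

lemma runs_address {inp : List (List ℕ)} (m : ℕ → ℕ) (a : ℕ) (i : ℕ) :
    Runs inp (RamProgram.address a i) m 4 fun m' =>
      m' 17 = 100 + 4 * m i + a ∧ ∀ z, z ≠ 17 → z ≠ 18 → m' z = m z := by
  refine Runs.add (Runs.add (Runs.const (Runs.add_end ⟨?_, fun z h1 h2 => ?_⟩)))
  · simp
    omega
  · simp [h1, h2]

lemma runs_loadEntry {inp : List (List ℕ)} (m : ℕ → ℕ) (a : ℕ) {i d : ℕ} :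
    Runs inp (RamProgram.loadEntry a i d) m 5 fun m' =>
      m' d = m (100 + 4 * m i + a) ∧ ∀ z, z ≠ 17 → z ≠ 18 → z ≠ d → m' z = m z := by
  refine Runs.seq (T₁ := 4) (T₂ := 1) (runs_address m a i) fun m' h => ?_
  refine Runs.load_end (T := 0) ⟨?_, fun z h1 h2 h3 => ?_⟩
  · rw [Function.update_self, h.1, h.2 _ (by omega) (by omega)]
  · rw [Function.update_of_ne h3, h.2 z h1 h2]

lemma runs_storeEntry {inp : List (List ℕ)} (m : ℕ → ℕ) (a : ℕ) {i x : ℕ}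
    (hx : 18 < x) :
    Runs inp (RamProgram.storeEntry a i x) m 5 fun m' =>
      m' (100 + 4 * m i + a) = m x ∧
        ∀ z, z ≠ 17 → z ≠ 18 → z ≠ 100 + 4 * m i + a → m' z = m z := by
  refine Runs.seq (T₁ := 4) (T₂ := 1) (runs_address m a i) fun m' h => ?_
  refine Runs.store_end (T := 0) ⟨?_, fun z h1 h2 h3 => ?_⟩
  · rw [h.1, Function.update_self, h.2 x (by omega) (by omega)]
  · rw [h.1, Function.update_of_ne h3, h.2 z h1 h2]

/-! ### Closure under edges -/

/-- The test for an edge: an entry of the adjacency matrix or, if `mode ≠ 0`, a common color. -/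
def EdgeTest (inp : List (List ℕ)) (base mode u w : ℕ) : Prop :=
  entry inp (2 + u) w ≠ 0 ∨ (mode ≠ 0 ∧ commonCount inp (base + u) (base + w) 0 ≠ 0)

namespace RamProgram

/-- If entry `u` of array `1` and the test for the edge `uw` are positive, increase `mem[46]`,
where `u`, `w` are in the cells `48`, `44`. -/
def edgeStep : RamProgram :=
  loadEntry 1 48 50 ;;
  .cond 50
    (.const 19 2 ;; .add 51 48 19 ;; .read 51 51 44 ;;
      .cond 41 (.add 20 66 48 ;; .add 21 66 44 ;; .const 22 0 ;; count ;; .add 51 51 1)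
        (.const 19 0) ;;
      .add 46 46 51)
    (.const 19 0)

/-- Compute entry `mem[44]` of array `2`. -/
def vertexStep : RamProgram :=
  loadEntry 1 44 46 ;; loadEntry 0 44 47 ;;
  .cond 46 (.const 19 0) (.cond 47 (forLoop 48 60 49 edgeStep) (.const 19 0)) ;;
  storeEntry 2 44 46

/-- Copy entry `mem[44]` of array `2` to array `1`. -/
def copyStep : RamProgram :=
  loadEntry 2 44 46 ;; storeEntry 1 44 46

/-- One round of expansion of array `1` inside array `0`. -/
def round : RamProgram :=
  forLoop 44 60 45 vertexStep ;; forLoop 44 60 45 copyStep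

/-- `mem[40]` rounds of expansion of array `1` inside array `0`. -/
def closure : RamProgram :=
  forLoop 42 40 43 round

end RamProgram

/-- Row sizes need a bound only where `count` is executed, that is, for a marked `u` and with the
color mode on. In the application such vertices have at most `k` colors. -/
lemma runs_edgeStep {inp : List (List ℕ)} (m : ℕ → ℕ) {b : ℕ}
    (hu : m 41 ≠ 0 → m (101 + 4 * m 48) ≠ 0 → entry inp (m 66 + m 48) 0 ≤ b)
    (hw : m 41 ≠ 0 → entry inp (m 66 + m 44) 0 ≤ b) :
    Runs inp RamProgram.edgeStep m (30 * (b + 1) ^ 2 + 20) fun m' =>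
      (m' 46 ≠ 0 ↔ m 46 ≠ 0 ∨
        (m (101 + 4 * m 48) ≠ 0 ∧ EdgeTest inp (m 66) (m 41) (m 48) (m 44))) ∧
      ∀ z, (z = 0 ∨ 22 < z) → z ≠ 46 → z ≠ 50 → z ≠ 51 → m' z = m z := by
  refine (Runs.seq (runs_loadEntry (d := 50) m 1) (T₂ := 30 * (b + 1) ^ 2 + 15)
    fun m₁ h₁ => ?_).mono (by omega) fun _ h => h
  obtain ⟨h50, hm₁⟩ := h₁
  rw [show 100 + 4 * m 48 + 1 = 101 + 4 * m 48 by ring] at h50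
  refine Runs.cond (fun hc => ?_) fun hc => Runs.const_end ⟨?_, fun z hz h46 h50 h51 => ?_⟩
  · refine Runs.const (Runs.add (Runs.read ?_))
    refine (Runs.seq (T₁ := 30 * (b + 1) ^ 2 + 6) (T₂ := 1)
      (Q' := fun m₂ => (m₂ 51 ≠ 0 ↔ EdgeTest inp (m 66) (m 41) (m 48) (m 44)) ∧
      ∀ z, (z = 0 ∨ 22 < z) → z ≠ 50 → z ≠ 51 → m₂ z = m z) ?_ ?_).mono (by omega) fun _ h => h
    · have e41 := hm₁ 41 (by decide) (by decide) (by decide)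
      have e44 := hm₁ 44 (by decide) (by decide) (by decide)
      have e48 := hm₁ 48 (by decide) (by decide) (by decide)
      have e66 := hm₁ 66 (by decide) (by decide) (by decide)
      refine Runs.cond (fun hc' => ?_) fun hc' => Runs.const_end ⟨?_, fun z hz h50 h51 => ?_⟩
      · refine Runs.add (Runs.add (Runs.const ?_))
        simp [e41] at hc'
        refine (Runs.seq (T₂ := 1) (runs_count _ (b := b) ?_ ?_) fun m₂ h₂ =>
          Runs.add_end ⟨?_, fun z hz h50 h51 => ?_⟩).mono (by omega) fun _ h => h
        · simpa [e66, e48] using hu hc' (by rwa [← h50])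
        · simpa [e66, e44] using hw hc'
        · have h51 := h₂.2 51 (by decide)
          have h1 := h₂.1
          simp [e66, e48, e44] at h51 h1
          simp [h51, h1, EdgeTest, hc', add_comm]
          tauto
        · have := h₂.2 z (by omega)
          rw [Function.update_of_ne h51, this]
          simp (disch := omega) [Function.update_of_ne, hm₁]
      · simp [e41] at hc'
        simp [EdgeTest, hc', e48, e44, add_comm]
      · simp (disch := omega) [Function.update_of_ne, hm₁]
    · rintro m₂ ⟨h51, hm₂⟩
      refine Runs.add_end ⟨?_, fun z hz h46 h50 h51 => ?_⟩
      · have e46 := hm₂ 46 (by decide) (by decide) (by decide)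
        have h50' : m (101 + 4 * m 48) ≠ 0 := by rwa [← h50]
        rw [Function.update_self, ← h51, e46]
        simp only [ne_eq, h50', not_false_eq_true, true_and]
        omega
      · rw [Function.update_of_ne h46, hm₂ z hz h50 h51]
  · rw [← h50]
    simp [hc, hm₁]
  · rw [Function.update_of_ne (by omega), hm₁ z (by omega) (by omega) h50]

section Closure

variable {inp : List (List ℕ)} {n : ℕ} {A X : Fin n → Prop} {E : Fin n → Fin n → Prop}

lemma runs_vertexStep (m : ℕ → ℕ) {b : ℕ} (hn : m 60 = n) (w : Fin n) (hw : m 44 = w)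
    (hA : m (100 + 4 * w) ≠ 0 ↔ A w) (hX : ∀ u : Fin n, m (101 + 4 * u) ≠ 0 ↔ X u)
    (hE : ∀ u : Fin n, EdgeTest inp (m 66) (m 41) u w ↔ E u w)
    (hAb : m 41 ≠ 0 → A w → entry inp (m 66 + w) 0 ≤ b)
    (hXb : m 41 ≠ 0 → ∀ u : Fin n, X u → entry inp (m 66 + u) 0 ≤ b) :
    Runs inp RamProgram.vertexStep m (30 + n * (30 * (b + 1) ^ 2 + 24)) fun m' =>
      (m' (102 + 4 * w) ≠ 0 ↔ X w ∨ (A w ∧ ∃ u, X u ∧ E u w)) ∧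
      ∀ z : ℕ, (z = 0 ∨ 22 < z) → (z < 46 ∨ 51 < z) → z ≠ 102 + 4 * w → m' z = m z := by
  refine (Runs.seq (runs_loadEntry (d := 46) m 1)
    (T₂ := 5 + ((8 + n * (30 * (b + 1) ^ 2 + 24)) + 5)) fun m₁ h₁ => ?_).mono (by omega)
    fun _ h => h
  obtain ⟨h46, hm₁⟩ := h₁
  refine Runs.seq (runs_loadEntry (d := 47) m₁ 0) fun m₂ h₂ => ?_
  obtain ⟨h47, hm₂⟩ := h₂
  have e44 := hm₁ 44 (by decide) (by decide) (by decide)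
  have hm₂' : ∀ z, z ≠ 17 → z ≠ 18 → z ≠ 46 → z ≠ 47 → m₂ z = m z := fun z h1 h2 h3 h4 =>
    (hm₂ z h1 h2 h4).trans (hm₁ z h1 h2 h3)
  replace h46 : m₂ 46 ≠ 0 ↔ X w := by
    rw [hm₂ 46 (by decide) (by decide) (by decide), h46, hw,
      show 100 + 4 * (w : ℕ) + 1 = 101 + 4 * w by ring, hX]
  replace h47 : m₂ 47 ≠ 0 ↔ A w := by
    rw [h47, e44, hw, add_zero, hm₁ _ (by omega) (by omega) (by omega), hA]
  refine Runs.seq (Q' := fun m₃ => (m₃ 46 ≠ 0 ↔ X w ∨ (A w ∧ ∃ u, X u ∧ E u w)) ∧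
      ∀ z, (z = 0 ∨ 22 < z) → (z < 46 ∨ 51 < z) → m₃ z = m z) ?_ ?_
  · refine (Runs.cond (T := 7 + n * (30 * (b + 1) ^ 2 + 24)) (fun hc => ?_)
      fun hc => ?_).mono (by omega) fun _ h => h
    · refine (Runs.const_end (T := 0) ⟨?_, fun z hz hz' => ?_⟩).mono (by omega) fun _ h => h
      · have := h46.1 hc
        simp [hc, this]
      · rw [Function.update_of_ne (by omega), hm₂' z (by omega) (by omega) (by omega) (by omega)]
    have hXw : ¬ X w := fun h => h46.2 h hc
    refine (Runs.cond (T := 6 + n * (30 * (b + 1) ^ 2 + 24)) (fun hc' => ?_)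
      fun hc' => ?_).mono (by omega) fun _ h => h
    · have hAw := h47.1 hc'
      refine (Runs.forLoop (Nv := n) (τ := 30 * (b + 1) ^ 2 + 20)
        (fun j m₃ => (m₃ 46 ≠ 0 ↔ ∃ u : Fin n, (u : ℕ) < j ∧ X u ∧ E u w) ∧
          ∀ z, (z = 0 ∨ 22 < z) → (z < 46 ∨ 51 < z) → m₃ z = m z)
        (by decide) (by decide) (by decide) ?_ ?_ ?_ ?_).mono (by simp only [Nat.add_assoc, Nat.reduceAdd]; omega) ?_
      · rintro j m₃ m₄ h ⟨h1, h2⟩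
        exact ⟨by rw [h 46 (by decide) (by decide)]; exact h1,
          fun z hz hz' => (h z (by omega) (by omega)).trans (h2 z hz hz')⟩
      · rintro j m₃ ⟨h1, h2⟩
        rw [h2 60 (by decide) (by decide), hn]
      · exact ⟨by simp [hc], fun z hz hz' => hm₂' z (by omega) (by omega) (by omega) (by omega)⟩
      · rintro j m₃ hj ⟨h1, h2⟩ h48
        have f41 := h2 41 (by decide) (by decide)
        have f44 := h2 44 (by decide) (by decide)
        have f66 := h2 66 (by decide) (by decide)
        have fX : m₃ (101 + 4 * m₃ 48) ≠ 0 ↔ X ⟨j, hj⟩ := by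
          rw [h48, h2 _ (by omega) (by omega)]
          exact hX ⟨j, hj⟩
        refine (runs_edgeStep m₃ (b := b) ?_ ?_).mono (by omega) ?_
        · intro h41 hx
          rw [f66, h48]
          exact hXb (f41 ▸ h41) ⟨j, hj⟩ (fX.1 hx)
        · intro h41
          rw [f66, f44, hw]
          exact hAb (f41 ▸ h41) hAw
        · rintro m₄ ⟨h3, h4⟩
          refine ⟨(h4 48 (by decide) (by decide) (by decide) (by decide)).trans h48, ?_,
            fun z hz hz' => (h4 z hz (by omega) (by omega) (by omega)).trans (h2 z hz hz')⟩
          rw [h3, h1, fX, f66, f41, f44, h48, hw, hE ⟨j, hj⟩]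
          constructor
          · rintro (⟨u, hu, h⟩ | h)
            · exact ⟨u, by omega, h⟩
            · exact ⟨⟨j, hj⟩, by simp, h⟩
          · rintro ⟨u, hu, h⟩
            by_cases huj : (u : ℕ) = j
            · obtain rfl : u = ⟨j, hj⟩ := Fin.ext huj
              exact Or.inr h
            · exact Or.inl ⟨u, by omega, h⟩
      · rintro m₃ ⟨h1, h2⟩
        refine ⟨?_, h2⟩
        rw [h1]
        simp [hXw, hAw]
    · refine (Runs.const_end (T := 0) ⟨?_, fun z hz hz' => ?_⟩).mono (by omega) fun _ h => h
      · have hAw : ¬ A w := fun h => h47.2 h hc'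
        simp [hc, hXw, hAw]
      · rw [Function.update_of_ne (by omega), hm₂' z (by omega) (by omega) (by omega) (by omega)]
  · rintro m₃ ⟨h1, h2⟩
    refine (runs_storeEntry m₃ 2 (by norm_num)).mono le_rfl ?_
    rintro m₄ ⟨h3, h4⟩
    rw [h2 44 (by decide) (by decide), hw] at h3 h4
    rw [show 100 + 4 * (w : ℕ) + 2 = 102 + 4 * w by ring] at h3 h4
    exact ⟨by rw [h3]; exact h1,
      fun z hz hz' hzw => (h4 z (by omega) (by omega) hzw).trans (h2 z hz hz')⟩

lemma runs_copyStep (m : ℕ → ℕ) :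
    Runs inp RamProgram.copyStep m 10 fun m' =>
      m' (101 + 4 * m 44) = m (102 + 4 * m 44) ∧
      ∀ z, (z = 0 ∨ 22 < z) → z ≠ 46 → z ≠ 101 + 4 * m 44 → m' z = m z := by
  refine Runs.seq (T₁ := 5) (T₂ := 5) (runs_loadEntry (d := 46) m 2) fun m₁ h₁ => ?_
  refine (runs_storeEntry m₁ 1 (by norm_num)).mono le_rfl ?_
  rintro m₂ ⟨h3, h4⟩
  have e44 := h₁.2 44 (by decide) (by decide) (by decide)
  rw [e44, show 100 + 4 * m 44 + 1 = 101 + 4 * m 44 by ring] at h3 h4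
  refine ⟨?_, fun z hz h46 hz' => ?_⟩
  · rw [h3, h₁.1, show 100 + 4 * m 44 + 2 = 102 + 4 * m 44 by ring]
  · rw [h4 z (by omega) (by omega) hz', h₁.2 z (by omega) (by omega) h46]

/-- New marks go to array `2` and are copied at the end, so that all of them are computed from the
marks before the round. -/
lemma runs_round (m : ℕ → ℕ) {b : ℕ} (hn : m 60 = n)
    (hA : ∀ w : Fin n, m (100 + 4 * w) ≠ 0 ↔ A w) (hX : ∀ u : Fin n, m (101 + 4 * u) ≠ 0 ↔ X u)
    (hE : ∀ u w : Fin n, EdgeTest inp (m 66) (m 41) u w ↔ E u w)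
    (hAb : m 41 ≠ 0 → ∀ w : Fin n, A w → entry inp (m 66 + w) 0 ≤ b)
    (hXb : m 41 ≠ 0 → ∀ u : Fin n, X u → entry inp (m 66 + u) 0 ≤ b) :
    Runs inp RamProgram.round m (6 + n * (50 + n * (30 * (b + 1) ^ 2 + 24))) fun m' =>
      (∀ w : Fin n, m' (100 + 4 * w) ≠ 0 ↔ A w) ∧
      (∀ w : Fin n, m' (101 + 4 * w) ≠ 0 ↔ X w ∨ (A w ∧ ∃ u, X u ∧ E u w)) ∧
      ∀ z, z < 100 → (z = 0 ∨ 22 < z) → (z < 44 ∨ 51 < z) → m' z = m z := by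
  refine (Runs.seq (T₁ := 3 + n * (30 + n * (30 * (b + 1) ^ 2 + 24) + 4))
    (T₂ := 3 + n * (10 + 4)) (Q' := fun m₁ =>
      (∀ w : Fin n, m₁ (100 + 4 * w) ≠ 0 ↔ A w) ∧
      (∀ w : Fin n, m₁ (102 + 4 * w) ≠ 0 ↔ X w ∨ (A w ∧ ∃ u, X u ∧ E u w)) ∧
      ∀ z, z < 100 → (z = 0 ∨ 22 < z) → (z < 44 ∨ 51 < z) → m₁ z = m z) ?_ ?_).mono
    (by ring_nf; omega) fun _ h => h
  · refine (Runs.forLoop (Nv := n)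
      (fun j m₁ => (∀ w : Fin n, (w : ℕ) < j →
          (m₁ (102 + 4 * w) ≠ 0 ↔ X w ∨ (A w ∧ ∃ u, X u ∧ E u w))) ∧
        ∀ z, (z < 100 ∨ z % 4 ≠ 2) → (z = 0 ∨ 22 < z) → (z < 44 ∨ 51 < z) → m₁ z = m z)
      (by decide) (by decide) (by decide) ?_ ?_ ?_ ?_).mono le_rfl ?_
    · rintro j m₁ m₂ h ⟨h1, h2⟩
      exact ⟨fun w hw => by rw [h _ (by omega) (by omega)]; exact h1 w hw,
        fun z hz hz' hz'' => (h z (by omega) (by omega)).trans (h2 z hz hz' hz'')⟩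
    · rintro j m₁ ⟨h1, h2⟩
      rw [h2 60 (by decide) (by decide) (by decide), hn]
    · exact ⟨fun w hw => absurd hw (by omega), fun z _ _ _ => rfl⟩
    · rintro j m₁ hj ⟨h1, h2⟩ h44
      have f41 := h2 41 (by decide) (by decide) (by decide)
      have f66 := h2 66 (by decide) (by decide) (by decide)
      refine (runs_vertexStep m₁ (b := b) (n := n) (A := A) (X := X) (E := E)
        ((h2 60 (by decide) (by decide) (by decide)).trans hn) ⟨j, hj⟩ h44 ?_ ?_ ?_ ?_ ?_).mono
        le_rfl ?_
      · rw [h2 _ (by simp only; omega) (by omega) (by omega)]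
        exact hA _
      · intro u
        rw [h2 _ (by omega) (by omega) (by omega)]
        exact hX u
      · rw [f41, f66]
        exact fun u => hE u _
      · rw [f41, f66]
        exact fun h => hAb h _
      · rw [f41, f66]
        exact hXb
      · rintro m₂ ⟨h3, h4⟩
        simp only at h4
        refine ⟨(h4 44 (by decide) (by decide) (by omega)).trans h44, fun w hw => ?_,
          fun z hz hz' hz'' => ?_⟩
        · by_cases hwj : (w : ℕ) = j
          · obtain rfl : w = ⟨j, hj⟩ := Fin.ext hwj
            exact h3
          · rw [h4 _ (by omega) (by omega) (by omega)]
            exact h1 w (by omega)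
        · rw [h4 z hz' (by omega) (by omega), h2 z hz hz' hz'']
    · rintro m₁ ⟨h1, h2⟩
      refine ⟨fun w => ?_, fun w => h1 w w.2, fun z hz hz' hz'' => h2 z (Or.inl hz) hz' hz''⟩
      rw [h2 _ (by omega) (by omega) (by omega)]
      exact hA w
  · rintro m₁ ⟨hA₁, hX₁, hm₁⟩
    refine (Runs.forLoop (Nv := n)
      (fun j m₂ => (∀ w : Fin n, (w : ℕ) < j →
          (m₂ (101 + 4 * w) ≠ 0 ↔ X w ∨ (A w ∧ ∃ u, X u ∧ E u w))) ∧
        ∀ z, (z < 100 ∨ z % 4 ≠ 1) → (z = 0 ∨ 22 < z) → (z < 44 ∨ 51 < z) → m₂ z = m₁ z)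
      (by decide) (by decide) (by decide) ?_ ?_ ?_ ?_).mono le_rfl ?_
    · rintro j m₁ m₂ h ⟨h1, h2⟩
      exact ⟨fun w hw => by rw [h _ (by omega) (by omega)]; exact h1 w hw,
        fun z hz hz' hz'' => (h z (by omega) (by omega)).trans (h2 z hz hz' hz'')⟩
    · rintro j m₂ ⟨h1, h2⟩
      rw [h2 60 (by decide) (by decide) (by decide), hm₁ 60 (by decide) (by decide) (by decide), hn]
    · exact ⟨fun w hw => absurd hw (by omega), fun z _ _ _ => rfl⟩
    · rintro j m₂ hj ⟨h1, h2⟩ h44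
      refine (runs_copyStep m₂).mono le_rfl ?_
      rintro m₃ ⟨h3, h4⟩
      rw [h44] at h3 h4
      refine ⟨(h4 44 (by decide) (by decide) (by omega)).trans h44, fun w hw => ?_,
          fun z hz hz' hz'' => ?_⟩
      · by_cases hwj : (w : ℕ) = j
        · rw [hwj, h3, h2 _ (by omega) (by omega) (by omega), ← hwj]
          exact hX₁ w
        · rw [h4 _ (by omega) (by omega) (by omega)]
          exact h1 w (by omega)
      · rw [h4 z hz' (by omega) (by omega), h2 z hz hz' hz'']
    · rintro m₂ ⟨h1, h2⟩
      refine ⟨fun w => ?_, fun w => h1 w w.2, fun z hz hz' hz'' => ?_⟩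
      · rw [h2 _ (by omega) (by omega) (by omega)]
        exact hA₁ w
      · rw [h2 z (Or.inl hz) hz' hz'', hm₁ z hz hz' hz'']

lemma runs_closure (m : ℕ → ℕ) {b : ℕ} (hn : m 60 = n) (hnb : n ≤ b) (hr : m 40 ≤ 3 * b)
    (hA : ∀ w : Fin n, m (100 + 4 * w) ≠ 0 ↔ A w) (hX : ∀ u : Fin n, m (101 + 4 * u) ≠ 0 ↔ X u)
    (hE : ∀ u w : Fin n, EdgeTest inp (m 66) (m 41) u w ↔ E u w)
    (hAb : m 41 ≠ 0 → ∀ w : Fin n, A w → entry inp (m 66 + w) 0 ≤ b)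
    (hXb : m 41 ≠ 0 → ∀ u : Fin n, X u → entry inp (m 66 + u) 0 ≤ b) :
    Runs inp RamProgram.closure m (500 * (b + 1) ^ 5) fun m' =>
      (∀ w : Fin n, m' (101 + 4 * w) ≠ 0 ↔ expand E A X (m 40) w) ∧
      ∀ z, z < 100 → (z = 0 ∨ 22 < z) → (z < 42 ∨ 51 < z) → m' z = m z := by
  refine (Runs.forLoop (Nv := m 40) (τ := 6 + n * (50 + n * (30 * (b + 1) ^ 2 + 24)))
    (fun j m₁ => (∀ w : Fin n, m₁ (100 + 4 * w) ≠ 0 ↔ A w) ∧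
      (∀ w : Fin n, m₁ (101 + 4 * w) ≠ 0 ↔ expand E A X j w) ∧
      ∀ z, z < 100 → (z = 0 ∨ 22 < z) → (z < 42 ∨ 51 < z) → m₁ z = m z)
    (by decide) (by decide) (by decide) ?_ ?_ ?_ ?_).mono ?_ fun m₁ h => h.2
  · rintro j m₁ m₂ h ⟨h1, h2, h3⟩
    refine ⟨fun w => ?_, fun w => ?_, fun z hz hz' hz'' => ?_⟩
    · rw [h _ (by omega) (by omega)]
      exact h1 w
    · rw [h _ (by omega) (by omega)]
      exact h2 w
    · rw [h _ (by omega) (by omega), h3 z hz hz' hz'']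
  · rintro j m₁ ⟨h1, h2, h3⟩
    exact h3 40 (by decide) (by decide) (by decide)
  · exact ⟨hA, hX, fun z _ _ _ => rfl⟩
  · rintro j m₁ hj ⟨h1, h2, h3⟩ h42
    have f41 := h3 41 (by decide) (by decide) (by decide)
    have f66 := h3 66 (by decide) (by decide) (by decide)
    refine (runs_round m₁ (b := b) (A := A) (X := expand E A X j) (E := E)
      ((h3 60 (by decide) (by decide) (by decide)).trans hn) h1 h2 (by rwa [f41, f66])
      (by rwa [f41, f66]) ?_).mono le_rfl ?_
    · rw [f41, f66]
      intro h u hu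
      cases j with
      | zero => exact hXb h u hu
      | succ j =>
        -- Vertices added by the search belong to `A`, so the size bound survives every round.
        have : ∀ j u, expand E A X j u → entry inp (m 66 + (u : Fin n)) 0 ≤ b := by
          intro j
          induction j with
          | zero => exact hXb h
          | succ j ih =>
            rintro u (hu | hu)
            · exact ih u hu
            · exact hAb h u hu.1
        exact this _ u hu
    · rintro m₂ ⟨h4, h5, h6⟩
      exact ⟨(h6 42 (by decide) (by decide) (by decide)).trans h42, h4, h5,
        fun z hz hz' hz'' => (h6 z hz hz' (by omega)).trans (h3 z hz hz' hz'')⟩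
  · have h1 : n * (30 * (b + 1) ^ 2 + 24) ≤ (b + 1) * (30 * (b + 1) ^ 2 + 24) :=
      Nat.mul_le_mul_right _ (by omega)
    have h2 : n * (50 + n * (30 * (b + 1) ^ 2 + 24)) ≤
        (b + 1) * (50 + (b + 1) * (30 * (b + 1) ^ 2 + 24)) := Nat.mul_le_mul (by omega) (by omega)
    have h3 : m 40 * (6 + n * (50 + n * (30 * (b + 1) ^ 2 + 24)) + 4) ≤
        (3 * (b + 1)) * (6 + (b + 1) * (50 + (b + 1) * (30 * (b + 1) ^ 2 + 24)) + 4) :=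
      Nat.mul_le_mul (by omega) (by omega)
    have hp : ∀ e, e ≤ 5 → (b + 1) ^ e ≤ (b + 1) ^ 5 := fun e he =>
      Nat.pow_le_pow_right (by omega) he
    have p0 := hp 0 (by omega)
    have p1 := hp 1 (by omega)
    have p2 := hp 2 (by omega)
    have p3 := hp 3 (by omega)
    have p4 := hp 4 (by omega)
    have h4 : 3 * (b + 1) * (6 + (b + 1) * (50 + (b + 1) * (30 * (b + 1) ^ 2 + 24)) + 4) =
        90 * (b + 1) ^ 5 + 72 * (b + 1) ^ 3 + 150 * (b + 1) ^ 2 + 30 * (b + 1) ^ 1 := by ring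
    rw [h4] at h3
    simp only [pow_zero] at p0
    omega

end Closure

/-! ### Color sets in the input -/

/-- The elements of `B` without the `j`-th smallest one, where positions start with `1`. -/
def Finset.withoutNth (B : Finset ℕ) (j : ℕ) : Finset ℕ :=
  {c ∈ B | ∀ y < B.card, (B.sort (· ≤ ·)).getD y 0 = c → y + 1 ≠ j}

lemma Finset.withoutNth_zero (B : Finset ℕ) : B.withoutNth 0 = B := by
  simp [Finset.withoutNth]

lemma Finset.getD_sort_mem {B : Finset ℕ} {y : ℕ} (hy : y < B.card) :
    (B.sort (· ≤ ·)).getD y 0 ∈ B := by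
  rw [List.getD_eq_getElem _ _ (by simpa using hy)]
  exact (Finset.mem_sort (· ≤ ·)).1 (List.getElem_mem _)

lemma Finset.getD_sort_injective {B : Finset ℕ} {x y : ℕ} (hx : x < B.card) (hy : y < B.card)
    (h : (B.sort (· ≤ ·)).getD x 0 = (B.sort (· ≤ ·)).getD y 0) : x = y := by
  rw [List.getD_eq_getElem _ _ (by simpa using hx), List.getD_eq_getElem _ _ (by simpa using hy)] at h
  exact (List.Nodup.getElem_inj_iff (B.sort_nodup (· ≤ ·))).1 h

lemma Finset.exists_getD_sort_eq {B : Finset ℕ} {c : ℕ} (hc : c ∈ B) :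
    ∃ y < B.card, (B.sort (· ≤ ·)).getD y 0 = c := by
  obtain ⟨y, hy, rfl⟩ := List.getElem_of_mem ((Finset.mem_sort (· ≤ ·)).2 hc)
  exact ⟨y, by simpa using hy, List.getD_eq_getElem _ _ hy⟩

lemma Finset.withoutNth_succ (B : Finset ℕ) {j : ℕ} (hj : j < B.card) :
    B.withoutNth (j + 1) = B.erase ((B.sort (· ≤ ·)).getD j 0) := by
  ext c
  simp only [Finset.withoutNth, Finset.mem_filter, Finset.mem_erase]
  constructor
  · rintro ⟨h1, h2⟩
    exact ⟨fun h => h2 j hj h.symm rfl, h1⟩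
  · rintro ⟨h1, h2⟩
    refine ⟨h2, fun y hy h h' => h1 ?_⟩
    obtain rfl : y = j := by omega
    exact h.symm

/-- Row `r` of the input is the color set `A`. -/
def IsColorRow (inp : List (List ℕ)) (r : ℕ) (A : Finset ℕ) : Prop :=
  inp.getD r [] = encodeColorSet A

section Rows

variable {inp : List (List ℕ)} {a b : ℕ} {A B : Finset ℕ}

lemma IsColorRow.entry_zero (h : IsColorRow inp a A) : entry inp a 0 = A.card := by
  simp only [IsColorRow] at h
  simp only [entry, h, encodeColorSet, List.getD_cons_zero]

lemma IsColorRow.entry_succ (h : IsColorRow inp a A) (x : ℕ) :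
    entry inp a (x + 1) = (A.sort (· ≤ ·)).getD x 0 := by
  simp only [IsColorRow] at h
  simp only [entry, h, encodeColorSet, List.getD_cons_succ]

/-- Rows have no repeated colors, so for each entry of `a` the inner sum is the indicator of
membership in `B.withoutNth j`. -/
lemma commonCount_eq_card (ha : IsColorRow inp a A) (hb : IsColorRow inp b B) (j : ℕ) :
    commonCount inp a b j = (A ∩ B.withoutNth j).card := by
  have h1 : ∀ x, ∑ y ∈ Finset.range (entry inp b 0), hit inp a b j x y =
      if (A.sort (· ≤ ·)).getD x 0 ∈ B.withoutNth j then 1 else 0 := by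
    intro x
    simp only [hit, hb.entry_zero, hb.entry_succ, ha.entry_succ]
    split_ifs with h
    · obtain ⟨h2, h3⟩ := Finset.mem_filter.1 h
      obtain ⟨y, hy, hyx⟩ := Finset.exists_getD_sort_eq h2
      rw [Finset.sum_eq_single y]
      · rw [if_pos ⟨h3 y hy hyx, hyx⟩]
      · rintro z hz hzy
        rw [if_neg]
        rintro ⟨-, h⟩
        exact hzy (Finset.getD_sort_injective (Finset.mem_range.1 hz) hy (h.trans hyx.symm))
      · exact fun h => absurd (Finset.mem_range.2 hy) h
    · refine Finset.sum_eq_zero fun y hy => if_neg ?_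
      rintro ⟨h2, h3⟩
      have hy := Finset.mem_range.1 hy
      refine h (Finset.mem_filter.2 ⟨h3 ▸ Finset.getD_sort_mem hy, fun z hz hzx => ?_⟩)
      rwa [Finset.getD_sort_injective hz hy (hzx.trans h3.symm)]
  rw [commonCount, Finset.sum_congr rfl fun x _ => h1 x, ha.entry_zero, ← Finset.card_filter]
  refine Finset.card_bij (fun x _ => (A.sort (· ≤ ·)).getD x 0) ?_ ?_ ?_
  · intro x hx
    rw [Finset.mem_filter, Finset.mem_range] at hx
    exact Finset.mem_inter.2 ⟨Finset.getD_sort_mem hx.1, hx.2⟩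
  · intro x hx y hy h
    rw [Finset.mem_filter, Finset.mem_range] at hx hy
    exact Finset.getD_sort_injective hx.1 hy.1 h
  · intro c hc
    obtain ⟨h2, h3⟩ := Finset.mem_inter.1 hc
    obtain ⟨x, hx, rfl⟩ := Finset.exists_getD_sort_eq h2
    exact ⟨x, Finset.mem_filter.2 ⟨Finset.mem_range.2 hx, h3⟩, rfl⟩

lemma commonCount_ne_zero (ha : IsColorRow inp a A) (hb : IsColorRow inp b B) :
    commonCount inp a b 0 ≠ 0 ↔ ∃ c ∈ A, c ∈ B := by
  rw [commonCount_eq_card ha hb, Finset.withoutNth_zero, Finset.card_ne_zero]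
  simp [Finset.Nonempty]

lemma card_le_commonCount (ha : IsColorRow inp a A) (hb : IsColorRow inp b B) (j : ℕ) :
    entry inp a 0 ≤ commonCount inp a b j ↔ A ⊆ B.withoutNth j := by
  rw [commonCount_eq_card ha hb, ha.entry_zero]
  constructor
  · intro h
    exact Finset.inter_eq_left.1 (Finset.eq_of_subset_of_card_le Finset.inter_subset_left h)
  · intro h
    rw [Finset.inter_eq_left.2 h]

end Rows

namespace ColoredPathStar

variable {n : ℕ} (I : ColoredPathStar n) (v : Fin n) (L : List (Finset ℕ))

lemma encodeInput_header :
    entry (encodeInput I v L) 0 0 = n ∧ entry (encodeInput I v L) 0 1 = L.length ∧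
    entry (encodeInput I v L) 0 2 = I.s ∧ entry (encodeInput I v L) 0 3 = I.t ∧
    entry (encodeInput I v L) 0 4 = v ∧ entry (encodeInput I v L) 0 5 = I.k := by
  simp [entry, encodeInput]

lemma encodeInput_adj (u w : Fin n) : entry (encodeInput I v L) (2 + u) w ≠ 0 ↔ I.G.Adj u w := by
  classical
  have h : (encodeInput I v L).getD (2 + u) [] =
      (List.finRange n).map fun w => if I.G.Adj u w then 1 else 0 := by
    simp only [encodeInput, List.cons_append, add_comm 2, List.getD_cons_succ]
    rw [List.append_assoc, List.getD_append _ _ _ _ (by simp), List.getD_eq_getElem _ _ (by simp)]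
    simp
  rw [entry, h, List.getD_eq_getElem _ _ (by simp)]
  simp

lemma isColorRow_vertex (u : Fin n) : IsColorRow (encodeInput I v L) (2 + n + u) (I.χ u) := by
  have : 2 + n + (u : ℕ) = (n + u) + 2 := by ring
  simp only [IsColorRow, encodeInput, List.cons_append, this, List.getD_cons_succ]
  rw [List.append_assoc, List.getD_append_right _ _ _ _ (by simp),
    List.getD_append _ _ _ _ (by simp), List.getD_eq_getElem _ _ (by simp)]
  simp

lemma isColorRow_family {i : ℕ} (hi : i < L.length) :
    IsColorRow (encodeInput I v L) (2 + 2 * n + i) L[i] := by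
  have : 2 + 2 * n + i = (n + (n + i)) + 2 := by ring
  simp only [IsColorRow, encodeInput, List.cons_append, this, List.getD_cons_succ]
  rw [List.append_assoc, List.getD_append_right _ _ _ _ (by simp),
    List.getD_append_right _ _ _ _ (by simp), List.getD_eq_getElem _ _ (by simp; omega)]
  simp

lemma edgeTest_zero (u w : Fin n) : EdgeTest (encodeInput I v L) (2 + n) 0 u w ↔ I.G.Adj u w := by
  simp [EdgeTest, ← encodeInput_adj I v L]

lemma edgeTest_one (u w : Fin n) : EdgeTest (encodeInput I v L) (2 + n) 1 u w ↔ I.Linked u w := by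
  simp only [EdgeTest, encodeInput_adj, Linked, ne_eq, one_ne_zero, not_false_eq_true, true_and]
  rw [← ne_eq, commonCount_ne_zero (isColorRow_vertex I v L u) (isColorRow_vertex I v L w)]

end ColoredPathStar

/-! ### The algorithm -/

namespace RamProgram

/-- Entry `mem[30]` of array `0` `:= mem[34]`, entry `mem[30]` of array `1` `:= mem[37]`. -/
def storeCell : RamProgram :=
  storeEntry 0 30 34 ;; storeEntry 1 30 37

/-- `mem[34] := 1` if the colors of vertex `mem[30]` occur in row `mem[69]` outside of position
`mem[79]`, and `0` otherwise. -/
def subsetTest : RamProgram :=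
  .add 20 66 30 ;; .const 19 0 ;; .read 32 20 19 ;; .sub 33 32 65 ;;
  .cond 33 (.const 34 0)
    (.add 21 69 19 ;; .add 22 79 19 ;; count ;; .sub 33 32 1 ;;
      .cond 33 (.const 34 0) (.const 34 1))

/-- Initialize the arrays for the vertex `mem[30]` for the search from `s` in the row `mem[69]`
without position `mem[79]`. -/
def reachCell : RamProgram :=
  subsetTest ;; .sub 35 30 62 ;; .sub 36 62 30 ;; .add 35 35 36 ;;
  .cond 35 (.const 37 0) (.add 37 34 35) ;; storeCell

/-- `mem[34] := 1` if vertex `mem[30]` is allowed, and `mem[37] := 1` if it moreover has a color of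
row `mem[69]`. -/
def linkTest : RamProgram :=
  .add 20 66 30 ;; .const 19 0 ;; .read 32 20 19 ;; .sub 33 32 65 ;;
  .cond 33 (.const 34 0 ;; .const 37 0)
    (loadEntry 1 30 35 ;;
      .cond 32 (.const 34 1) (.cond 35 (.const 34 0) (.const 34 1)) ;;
      .add 21 69 33 ;; .const 22 0 ;; count ;; .cond 1 (.add 37 34 33) (.const 37 0))

/-- Initialize the arrays for the vertex `mem[30]` for the search from the row `mem[69]`. -/
def linkCell : RamProgram :=
  linkTest ;; storeCell

/-- Apply `A` to all vertices. -/
def fill (A : RamProgram) : RamProgram :=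
  forLoop 30 60 31 A

/-- Set `mem[73]` to `1` if row `mem[69]` without position `mem[77] - mem[72]` witnesses that the
row is not minimal. -/
def reachStep : RamProgram :=
  .sub 79 77 72 ;; fill reachCell ;; .const 41 0 ;; .add 40 60 41 ;; closure ;;
  loadEntry 1 64 78 ;;
  .cond 79 (.cond 78 (.const 73 1) (.const 41 0)) (.cond 78 (.const 41 0) (.const 73 1))

/-- Set `mem[73]` to `1` or `0`, depending on whether the set number `mem[70]` is not minimal, and
the arrays to the vertices reached by it. -/
def minimalityTest : RamProgram :=
  .add 69 67 70 ;; .const 77 0 ;; .read 77 69 77 ;; .const 75 1 ;; .add 75 77 75 ;;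
  .const 73 0 ;; forLoop 72 75 74 reachStep

/-- Make `mem[80]` nonzero if the set number `mem[70]` is linked to `t`. -/
def targetTest : RamProgram :=
  fill linkCell ;; .const 41 0 ;; .add 40 68 41 ;; .const 41 1 ;; closure ;; loadEntry 1 63 80

/-- Update the output `mem[0]` for the set number `mem[70]`. -/
def update : RamProgram :=
  .const 41 0 ;;
  .cond 73 (.const 81 1 ;; .add 0 70 41)
    (.cond 81 (.const 41 0) (.cond 80 (.const 41 0) (.add 0 70 41)))

/-- Process the set number `mem[70]`. -/
def processSet : RamProgram :=
  minimalityTest ;; targetTest ;; update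

/-- Read the numbers in the first row of the input. -/
def readHeader : RamProgram :=
  .read 60 1 1 ;; .const 2 1 ;; .read 61 1 2 ;; .const 2 2 ;; .read 62 1 2 ;; .const 2 3 ;;
  .read 63 1 2 ;; .const 2 4 ;; .read 64 1 2 ;; .const 2 5 ;; .read 65 1 2 ;;
  .const 2 2 ;; .add 66 2 60 ;; .add 67 66 60 ;; .add 68 65 65 ;; .add 68 68 65

/-- Find a set that can be removed from the family. -/
def findRedundantSet : RamProgram :=
  readHeader ;; forLoop 70 61 71 processSet

end RamProgram

/-! ### Correctness and running time of the subprograms -/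

lemma runs_storeCell {inp : List (List ℕ)} (m : ℕ → ℕ) :
    Runs inp RamProgram.storeCell m 10 fun m' =>
      m' (100 + 4 * m 30) = m 34 ∧ m' (101 + 4 * m 30) = m 37 ∧
      ∀ z, (z = 0 ∨ 22 < z) → z ≠ 100 + 4 * m 30 → z ≠ 101 + 4 * m 30 → m' z = m z := by
  refine Runs.seq (T₁ := 5) (T₂ := 5) (runs_storeEntry m 0 (by norm_num)) fun m₁ h₁ => ?_
  refine (runs_storeEntry m₁ 1 (by norm_num)).mono le_rfl ?_
  rintro m₂ ⟨h3, h4⟩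
  have e30 := h₁.2 30 (by decide) (by decide) (by omega)
  have e37 := h₁.2 37 (by decide) (by decide) (by omega)
  rw [e30, show 100 + 4 * m 30 + 1 = 101 + 4 * m 30 by ring] at h3 h4
  refine ⟨?_, h3.trans e37, fun z hz h5 h6 => ?_⟩
  · rw [h4 _ (by omega) (by omega) (by omega)]
    exact h₁.1
  · rw [h4 z (by omega) (by omega) h6, h₁.2 z (by omega) (by omega) h5]

/-- When vertex `w` is processed, its own entries still have their old values. `linkCell` depends on
this: it reads the mark of the previous search before overwriting it. -/
lemma runs_fill {inp : List (List ℕ)} {n : ℕ} {S X : Fin n → Prop} {A : RamProgram} (m : ℕ → ℕ)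
    {τ : ℕ} (hn : m 60 = n)
    (hcell : ∀ (w : Fin n) (m₁ : ℕ → ℕ), m₁ 30 = w →
      (∀ z, z < 100 → (z = 0 ∨ 22 < z) → (z < 30 ∨ 37 < z) → m₁ z = m z) →
      (∀ z, 100 + 4 * (w : ℕ) ≤ z → m₁ z = m z) →
      Runs inp A m₁ τ fun m' =>
        (m' (100 + 4 * w) ≠ 0 ↔ S w) ∧ (m' (101 + 4 * w) ≠ 0 ↔ X w) ∧
        ∀ z : ℕ, (z = 0 ∨ 22 < z) → (z < 32 ∨ 37 < z) → z ≠ 100 + 4 * w → z ≠ 101 + 4 * w →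
          m' z = m₁ z) :
    Runs inp (RamProgram.fill A) m (3 + n * (τ + 4)) fun m' =>
      (∀ w : Fin n, m' (100 + 4 * w) ≠ 0 ↔ S w) ∧ (∀ w : Fin n, m' (101 + 4 * w) ≠ 0 ↔ X w) ∧
      ∀ z, z < 100 → (z = 0 ∨ 22 < z) → (z < 30 ∨ 37 < z) → m' z = m z := by
  refine (Runs.forLoop (Nv := n) (τ := τ)
    (fun j m₁ => (∀ w : Fin n, (w : ℕ) < j →
        ((m₁ (100 + 4 * w) ≠ 0 ↔ S w) ∧ (m₁ (101 + 4 * w) ≠ 0 ↔ X w))) ∧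
      (∀ z, z < 100 → (z = 0 ∨ 22 < z) → (z < 30 ∨ 37 < z) → m₁ z = m z) ∧
      (∀ z, 100 + 4 * j ≤ z → m₁ z = m z))
    (by decide) (by decide) (by decide) ?_ ?_ ?_ ?_).mono le_rfl ?_
  · rintro j m₁ m₂ h ⟨h1, h2, h3⟩
    refine ⟨fun w hw => ?_, fun z hz hz' hz'' => ?_, fun z hz => ?_⟩
    · rw [h _ (by omega) (by omega), h _ (by omega) (by omega)]
      exact h1 w hw
    · rw [h _ (by omega) (by omega), h2 z hz hz' hz'']
    · rw [h _ (by omega) (by omega), h3 z hz]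
  · rintro j m₁ ⟨h1, h2, h3⟩
    rw [h2 60 (by decide) (by decide) (by decide), hn]
  · exact ⟨fun w hw => absurd hw (by omega), fun z _ _ _ => rfl, fun z _ => rfl⟩
  · rintro j m₁ hj ⟨h1, h2, h3⟩ h30
    refine (hcell ⟨j, hj⟩ m₁ h30 h2 h3).mono le_rfl ?_
    rintro m₂ ⟨h4, h5, h6⟩
    simp only at h4 h5 h6
    refine ⟨(h6 30 (by decide) (by decide) (by omega) (by omega)).trans h30, fun w hw => ?_,
      fun z hz hz' hz'' => ?_, fun z hz => ?_⟩
    · by_cases hwj : (w : ℕ) = j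
      · obtain rfl : w = ⟨j, hj⟩ := Fin.ext hwj
        exact ⟨h4, h5⟩
      · rw [h6 _ (by omega) (by omega) (by omega) (by omega),
          h6 _ (by omega) (by omega) (by omega) (by omega)]
        exact h1 w (by omega)
    · rw [h6 z hz' (by omega) (by omega) (by omega), h2 z hz hz' hz'']
    · rw [h6 z (by omega) (by omega) (by omega) (by omega), h3 z (by omega)]
  · rintro m₁ ⟨h1, h2, h3⟩
    exact ⟨fun w => (h1 w w.2).1, fun w => (h1 w w.2).2, h2⟩

namespace ColoredPathStar

variable {n : ℕ} (I : ColoredPathStar n) (v : Fin n) (L : List (Finset ℕ))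

/-- The cells `60`, …, `68` hold the parameters of the instance. -/
def Header (m : ℕ → ℕ) : Prop :=
  m 60 = n ∧ m 61 = L.length ∧ m 62 = I.s ∧ m 63 = I.t ∧ m 64 = v ∧ m 65 = I.k ∧ m 66 = 2 + n ∧
    m 67 = 2 + 2 * n ∧ m 68 = 3 * I.k

variable {I v L}

lemma Header.congr {m m' : ℕ → ℕ} (h : I.Header v L m)
    (hm : ∀ z, 60 ≤ z → z ≤ 68 → m' z = m z) : I.Header v L m' := by
  obtain ⟨h0, h1, h2, h3, h4, h5, h6, h7, h8⟩ := h
  refine ⟨?_, ?_, ?_, ?_, ?_, ?_, ?_, ?_, ?_⟩ <;> rw [hm _ (by decide) (by decide)] <;> assumption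

variable {b i : ℕ} {p : Finset ℕ}

/-- More than `k` colors cannot fit into `p`, so large rows are rejected by their size entry and
never scanned. -/
lemma runs_subsetTest {m : ℕ → ℕ} (hm : I.Header v L m) (hk : I.k ≤ b) (w : Fin n)
    (hw : m 30 = w) (hp : IsColorRow (encodeInput I v L) (m 69) p) (hpk : p.card ≤ I.k) :
    Runs (encodeInput I v L) RamProgram.subsetTest m (30 * (b + 1) ^ 2 + 20) fun m' =>
      (m' 34 ≠ 0 ↔ I.χ w ⊆ p.withoutNth (m 79)) ∧
      ∀ z, (z = 0 ∨ 22 < z) → (z < 32 ∨ 37 < z) → m' z = m z := by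
  have hrow := isColorRow_vertex I v L w
  have h66 := hm.2.2.2.2.2.2.1
  have h65 := hm.2.2.2.2.2.1
  refine (Runs.add (Runs.const (Runs.read (Runs.sub (T := 30 * (b + 1) ^ 2 + 10)
    (Runs.cond (T := 30 * (b + 1) ^ 2 + 9) (fun hc => ?_) fun hc => ?_))))).mono (by omega)
    fun _ h => h
  · refine (Runs.const_end (T := 0) ⟨?_, fun z hz hz' => ?_⟩).mono (by omega) fun _ h => h
    · simp [h66, h65, hw, hrow.entry_zero] at hc
      simp only [Function.update_self, ne_eq, not_true_eq_false, false_iff]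
      intro h
      have := Finset.card_le_card (h.trans (Finset.filter_subset _ _))
      omega
    · simp (disch := omega) [Function.update_of_ne]
  · simp [h66, h65, hw, hrow.entry_zero] at hc
    refine (Runs.add (Runs.add (Runs.seq (T₂ := 4) (runs_count _ (b := b) ?_ ?_) fun m₁ h₁ =>
      ?_))).mono (by omega) fun _ h => h
    · simp [h66, hw, hrow.entry_zero]
      omega
    · simp [hp.entry_zero]
      omega
    · obtain ⟨h1, h2⟩ := h₁
      have e32 := h2 32 (by decide)
      simp [h66, hw] at h1 e32
      have hle := card_le_commonCount hrow hp (m 79)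
      refine (Runs.sub (Runs.cond (T := 1) (fun hc' => Runs.const_end (T := 0) ⟨?_, fun z hz hz' => ?_⟩)
        fun hc' => Runs.const_end (T := 0) ⟨?_, fun z hz hz' => ?_⟩)).mono (by omega) fun _ h => h
      · simp [h1, e32] at hc'
        rw [← hle]
        simp
        omega
      · rw [Function.update_of_ne (by omega), Function.update_of_ne (by omega), h2 z (by omega)]
        simp (disch := omega) [Function.update_of_ne]
      · simp [h1, e32] at hc'
        rw [← hle]
        simp
        omega
      · rw [Function.update_of_ne (by omega), Function.update_of_ne (by omega), h2 z (by omega)]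
        simp (disch := omega) [Function.update_of_ne]

lemma runs_reachCell {m : ℕ → ℕ} (hm : I.Header v L m) (hk : I.k ≤ b) (w : Fin n)
    (hw : m 30 = w) (hp : IsColorRow (encodeInput I v L) (m 69) p) (hpk : p.card ≤ I.k) :
    Runs (encodeInput I v L) RamProgram.reachCell m (30 * (b + 1) ^ 2 + 40) fun m' =>
      (m' (100 + 4 * w) ≠ 0 ↔ I.χ w ⊆ p.withoutNth (m 79)) ∧
      (m' (101 + 4 * w) ≠ 0 ↔ w = I.s ∧ I.χ w ⊆ p.withoutNth (m 79)) ∧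
      ∀ z : ℕ, (z = 0 ∨ 22 < z) → (z < 32 ∨ 37 < z) → z ≠ 100 + 4 * w → z ≠ 101 + 4 * w →
        m' z = m z := by
  refine (Runs.seq (T₂ := 15) (runs_subsetTest hm hk w hw hp hpk) fun m₁ h₁ => ?_).mono (by omega)
    fun _ h => h
  obtain ⟨h1, h2⟩ := h₁
  have e30 := h2 30 (by decide) (by decide)
  have e62 := h2 62 (by decide) (by decide)
  have h62 := hm.2.2.1
  refine (Runs.sub (Runs.sub (Runs.add (Runs.seq (T₁ := 2) (T₂ := 10) (Q' := fun m₂ =>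
    m₂ 34 = m₁ 34 ∧ (m₂ 37 ≠ 0 ↔ w = I.s ∧ m₁ 34 ≠ 0) ∧
    ∀ z, (z = 0 ∨ 22 < z) → (z < 32 ∨ 37 < z) → m₂ z = m z) ?_ ?_)))).mono (by omega) fun _ h => h
  · refine Runs.cond (T := 1) (fun hc => Runs.const_end (T := 0) ⟨?_, ?_, fun z hz hz' => ?_⟩)
      fun hc => Runs.add_end (T := 0) ⟨?_, ?_, fun z hz hz' => ?_⟩
    · simp
    · simp [e30, e62, hw, h62] at hc
      have : w ≠ I.s := by
        rintro rfl
        omega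
      simp [this]
    · simp (disch := omega) [Function.update_of_ne, h2]
    · simp
    · simp [e30, e62, hw, h62] at hc
      have : w = I.s := Fin.ext (by omega)
      simp [e30, e62, hw, h62, this]
    · simp (disch := omega) [Function.update_of_ne, h2]
  · rintro m₂ ⟨h3, h4, h5⟩
    refine (runs_storeCell m₂).mono le_rfl ?_
    rintro m₃ ⟨h6, h7, h8⟩
    rw [h5 30 (by decide) (by decide), hw] at h6 h7 h8
    refine ⟨by rw [h6, h3, h1], by rw [h7, h4, h1], fun z hz hz' hz0 hz1 => ?_⟩
    rw [h8 z hz hz0 hz1, h5 z hz hz']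

lemma runs_linkTest {m : ℕ → ℕ} (hm : I.Header v L m) (hk : I.k ≤ b) (w : Fin n)
    (hw : m 30 = w) (hp : IsColorRow (encodeInput I v L) (m 69) p) (hpk : p.card ≤ I.k)
    (hX : m (101 + 4 * w) ≠ 0 ↔ I.Reach p w) :
    Runs (encodeInput I v L) RamProgram.linkTest m (30 * (b + 1) ^ 2 + 30) fun m' =>
      (m' 34 ≠ 0 ↔ I.Allowed p w) ∧
      (m' 37 ≠ 0 ↔ I.Allowed p w ∧ ∃ c ∈ I.χ w, c ∈ p) ∧
      ∀ z, (z = 0 ∨ 22 < z) → (z < 32 ∨ 37 < z) → m' z = m z := by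
  have hrow := isColorRow_vertex I v L w
  have h66 := hm.2.2.2.2.2.2.1
  have h65 := hm.2.2.2.2.2.1
  refine (Runs.add (Runs.const (Runs.read (Runs.sub (T := 30 * (b + 1) ^ 2 + 20)
    (Runs.cond (T := 30 * (b + 1) ^ 2 + 19) (fun hc => ?_) fun hc => ?_))))).mono (by omega)
    fun _ h => h
  · simp [h66, h65, hw, hrow.entry_zero] at hc
    have hA : ¬ I.Allowed p w := fun h => by have := h.1; omega
    refine (Runs.const (Runs.const_end (T := 0) ⟨?_, ?_, fun z hz hz' => ?_⟩)).mono (by omega)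
      fun _ h => h
    · simp [hA]
    · simp [hA]
    · simp (disch := omega) [Function.update_of_ne]
  · simp [h66, h65, hw, hrow.entry_zero] at hc
    refine (Runs.seq (T₂ := 30 * (b + 1) ^ 2 + 12) (runs_loadEntry (d := 35) _ 1) fun m₁ h₁ =>
      ?_).mono (by omega) fun _ h => h
    obtain ⟨h1, h2⟩ := h₁
    have e32 := h2 32 (by decide) (by decide) (by decide)
    have e33 := h2 33 (by decide) (by decide) (by decide)
    have e20 := h2 20 (by decide) (by decide) (by decide)
    simp [hw, h66, h65, hrow.entry_zero] at e32 e33 e20 h1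
    rw [show 100 + 4 * (w : ℕ) + 1 = 101 + 4 * w by ring] at h1
    simp (disch := omega) only [Function.update_of_ne] at h1
    -- In this branch the cell `33` is zero, and the program goes on to use it as the constant `0`.
    replace e33 : m₁ 33 = 0 := by omega
    replace h2 : ∀ z, (z = 0 ∨ 22 < z) → (z < 32 ∨ 37 < z) → m₁ z = m z := fun z hz hz' => by
      rw [h2 z (by omega) (by omega) (by omega)]
      simp (disch := omega) [Function.update_of_ne]
    refine (Runs.seq (T₁ := 3) (T₂ := 30 * (b + 1) ^ 2 + 9) (Q' := fun m₂ =>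
      (m₂ 34 ≠ 0 ↔ I.Allowed p w) ∧ (m₂ 33 = 0 ∧ m₂ 20 = 2 + n + w) ∧
      ∀ z, (z = 0 ∨ 22 < z) → (z < 32 ∨ 37 < z) → m₂ z = m z) ?_ ?_).mono (by omega) fun _ h => h
    · refine Runs.cond (T := 2) (fun hc' => ?_) fun hc' => ?_
      · refine Runs.const_end (T := 1) ⟨?_, ?_, fun z hz hz' => ?_⟩
        · rw [e32] at hc'
          have hne : I.χ w ≠ ∅ := fun h => hc' (by simp [h])
          simp only [Function.update_self, ne_eq, one_ne_zero, not_false_eq_true, true_iff]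
          exact ⟨by omega, fun h => hne h.1⟩
        · simp [e33, e20]
        · rw [Function.update_of_ne (by omega), h2 z hz hz']
      · rw [e32, Finset.card_eq_zero] at hc'
        have hA : I.Allowed p w ↔ ¬ I.Reach p w := by simp [Allowed, hc']
        refine Runs.cond (T := 1)
          (fun hc₂ => Runs.const_end (T := 0) ⟨?_, ?_, fun z hz hz' => ?_⟩)
          fun hc₂ => Runs.const_end (T := 0) ⟨?_, ?_, fun z hz hz' => ?_⟩
        · rw [h1] at hc₂
          simp [hA, hX.1 hc₂]
        · simp [e33, e20]
        · rw [Function.update_of_ne (by omega), h2 z hz hz']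
        · rw [h1] at hc₂
          have : ¬ I.Reach p w := fun h => hX.2 h hc₂
          simp [hA, this]
        · simp [e33, e20]
        · rw [Function.update_of_ne (by omega), h2 z hz hz']
    · rintro m₂ ⟨h3, ⟨h4, h20⟩, h5⟩
      have f66 := (h5 66 (by decide) (by decide)).trans h66
      have f69 := h5 69 (by decide) (by decide)
      refine (Runs.add (Runs.const (Runs.seq (T₂ := 2) (runs_count _ (b := b) ?_ ?_) fun m₃ h₃ =>
        ?_))).mono (by omega) fun _ h => h
      · simp [h20, hrow.entry_zero]
        omega
      · simp [h4, f69, hp.entry_zero]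
        omega
      · obtain ⟨h6, h7⟩ := h₃
        have g34 := h7 34 (by decide)
        have g33 := h7 33 (by decide)
        simp [h4, h20, f69] at h6 g34 g33
        have hc1 := commonCount_ne_zero hrow hp
        have hfr : ∀ z, (z = 0 ∨ 22 < z) → (z < 32 ∨ 37 < z) → m₃ z = m z := fun z hz hz' => by
          rw [h7 z (by omega), Function.update_of_ne (by omega), Function.update_of_ne (by omega),
            h5 z hz hz']
        refine Runs.cond (T := 1) (fun hc' => Runs.add_end (T := 0) ⟨?_, ?_, fun z hz hz' => ?_⟩)
          fun hc' => Runs.const_end (T := 0) ⟨?_, ?_, fun z hz hz' => ?_⟩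
        · rw [Function.update_of_ne (by decide), g34, h3]
        · rw [h6, hc1] at hc'
          rw [Function.update_self, g33, g34, add_zero, h3]
          exact (and_iff_left hc').symm
        · rw [Function.update_of_ne (by omega), hfr z hz hz']
        · rw [Function.update_of_ne (by decide), g34, h3]
        · rw [h6] at hc'
          have : ¬ ∃ c ∈ I.χ w, c ∈ p := fun h => hc1.2 h hc'
          simp [this]
        · rw [Function.update_of_ne (by omega), hfr z hz hz']

lemma runs_linkCell {m : ℕ → ℕ} (hm : I.Header v L m) (hk : I.k ≤ b) (w : Fin n)
    (hw : m 30 = w) (hp : IsColorRow (encodeInput I v L) (m 69) p) (hpk : p.card ≤ I.k)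
    (hX : m (101 + 4 * w) ≠ 0 ↔ I.Reach p w) :
    Runs (encodeInput I v L) RamProgram.linkCell m (30 * (b + 1) ^ 2 + 40) fun m' =>
      (m' (100 + 4 * w) ≠ 0 ↔ I.Allowed p w) ∧
      (m' (101 + 4 * w) ≠ 0 ↔ I.Allowed p w ∧ ∃ c ∈ I.χ w, c ∈ p) ∧
      ∀ z : ℕ, (z = 0 ∨ 22 < z) → (z < 32 ∨ 37 < z) → z ≠ 100 + 4 * w → z ≠ 101 + 4 * w →
        m' z = m z := by
  refine Runs.seq (runs_linkTest hm hk w hw hp hpk hX) (T₂ := 10) ?_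
  rintro m₂ ⟨h3, h4, h5⟩
  refine (runs_storeCell m₂).mono le_rfl ?_
  rintro m₃ ⟨h6, h7, h8⟩
  rw [h5 30 (by decide) (by decide), hw] at h6 h7 h8
  refine ⟨by rw [h6, h3], by rw [h7, h4], fun z hz hz' hz0 hz1 => ?_⟩
  rw [h8 z hz hz0 hz1, h5 z hz hz']

/-- The search for the position `j` shows that `p` is not minimal. -/
def RefutedAt (I : ColoredPathStar n) (v : Fin n) (p : Finset ℕ) (j : ℕ) : Prop :=
  if j = 0 then ¬ I.Reach p v else I.Reach (p.withoutNth j) v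

/-- Positions are tried downwards from `p.card`. Position `0`, which deletes nothing, comes last, so
the marks left behind are those of `p` itself, as the target test needs. -/
lemma exists_refutedAt_iff :
    (∃ j < p.card + 1, I.RefutedAt v p (p.card - j)) ↔ I.NonMinimal v p := by
  constructor
  · rintro ⟨j, hj, h⟩
    rw [RefutedAt] at h
    split_ifs at h with h0
    · exact Or.inl h
    · obtain ⟨i, hi⟩ := Nat.exists_eq_succ_of_ne_zero h0
      rw [hi, Nat.succ_eq_add_one, Finset.withoutNth_succ _ (by omega)] at h
      exact Or.inr ⟨_, Finset.getD_sort_mem (by omega), h⟩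
  · rintro (h | ⟨c, hc, h⟩)
    · exact ⟨p.card, by omega, by simpa [RefutedAt] using h⟩
    · obtain ⟨y, hy, rfl⟩ := Finset.exists_getD_sort_eq hc
      refine ⟨p.card - (y + 1), by omega, ?_⟩
      rw [show p.card - (p.card - (y + 1)) = y + 1 by omega, RefutedAt, if_neg (by omega),
        Finset.withoutNth_succ _ hy]
      exact h

lemma runs_reachStep {m : ℕ → ℕ} (hm : I.Header v L m) (hk : I.k ≤ b) (hn : n ≤ b)
    (hp : IsColorRow (encodeInput I v L) (m 69) p) (hpk : p.card ≤ I.k) (h77 : m 77 = p.card) :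
    Runs (encodeInput I v L) RamProgram.reachStep m (650 * (b + 1) ^ 5) fun m' =>
      (∀ w : Fin n, m' (101 + 4 * w) ≠ 0 ↔ I.Reach (p.withoutNth (p.card - m 72)) w) ∧
      (m' 73 ≠ 0 ↔ m 73 ≠ 0 ∨ I.RefutedAt v p (p.card - m 72)) ∧
      ∀ z, z < 100 → (z = 0 ∨ 51 < z) → z ≠ 73 → z ≠ 78 → z ≠ 79 → m' z = m z := by
  set j := p.card - m 72 with hj
  have hpow : (b + 1) ^ 3 ≤ (b + 1) ^ 5 := Nat.pow_le_pow_right (by omega) (by norm_num)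
  have hpow' : 1 ≤ (b + 1) ^ 5 := Nat.one_le_pow _ _ (by omega)
  have hfill : 3 + n * (30 * (b + 1) ^ 2 + 40 + 4) ≤ 80 * (b + 1) ^ 3 := by
    calc 3 + n * (30 * (b + 1) ^ 2 + 40 + 4) ≤ 3 + (b + 1) * (30 * (b + 1) ^ 2 + 40 + 4) := by
          gcongr
          omega
      _ ≤ 80 * (b + 1) ^ 3 := by ring_nf; omega
  refine (Runs.sub (Runs.seq (T₁ := 80 * (b + 1) ^ 3) (T₂ := 500 * (b + 1) ^ 5 + 10)
    (Q' := fun m₁ => (∀ w : Fin n, m₁ (100 + 4 * w) ≠ 0 ↔ I.χ w ⊆ p.withoutNth j) ∧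
      (∀ w : Fin n, m₁ (101 + 4 * w) ≠ 0 ↔ w = I.s ∧ I.χ w ⊆ p.withoutNth j) ∧ m₁ 79 = j ∧
      ∀ z, z < 100 → (z = 0 ∨ 22 < z) → (z < 30 ∨ 37 < z) → z ≠ 79 → m₁ z = m z) ?_ ?_)).mono
    (by omega) fun _ h => h
  · refine (runs_fill _ (by simp [hm.1]) (S := fun w => I.χ w ⊆ p.withoutNth j)
      (X := fun w => w = I.s ∧ I.χ w ⊆ p.withoutNth j) (τ := 30 * (b + 1) ^ 2 + 40) ?_).mono hfill ?_
    · intro w m₁ hw h1 h2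
      have e79 := h1 79 (by decide) (by decide) (by decide)
      have e69 := h1 69 (by decide) (by decide) (by decide)
      simp [h77, ← hj] at e79 e69
      have := runs_reachCell (hm.congr (m' := m₁) fun z hz hz' => by
        rw [h1 z (by omega) (by omega) (by omega), Function.update_of_ne (by omega)]) hk w hw
        (e69 ▸ hp) hpk
      rwa [e79] at this
    · rintro m₁ ⟨h1, h2, h3⟩
      refine ⟨h1, h2, ?_, fun z hz hz' hz'' h79 => ?_⟩
      · rw [h3 79 (by decide) (by decide) (by decide)]
        simp [h77, ← hj]
      · rw [h3 z hz hz' hz'', Function.update_of_ne h79]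
  · rintro m₁ ⟨h1, h2, h79, h3⟩
    have hm₁ : I.Header v L m₁ := hm.congr fun z hz hz' =>
      h3 z (by omega) (by omega) (by omega) (by omega)
    refine (Runs.const (Runs.add (Runs.seq (T₂ := 8) (runs_closure _ (n := n) (b := b)
      (A := fun w => I.χ w ⊆ p.withoutNth j) (X := fun w => w = I.s ∧ I.χ w ⊆ p.withoutNth j)
      (E := I.G.Adj) ?_ hn ?_ ?_ ?_ ?_ ?_ ?_) ?_))).mono (by omega) fun _ h => h
    · simp [hm₁.1]
    · simp [hm₁.1]
      omega
    · intro w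
      simp (disch := omega) only [Function.update_of_ne, h1]
    · intro w
      simp (disch := omega) only [Function.update_of_ne, h2]
    · intro u w
      simp [hm₁.2.2.2.2.2.2.1, ← edgeTest_zero I v L]
    · simp
    · simp
    · rintro m₂ ⟨h4, h5⟩
      have h4' : ∀ w : Fin n, m₂ (101 + 4 * w) ≠ 0 ↔ I.Reach (p.withoutNth j) w := by
        intro w
        rw [h4 w]
        simp [hm₁.1, Reach]
      replace h5 : ∀ z, z < 100 → (z = 0 ∨ 51 < z) → m₂ z = m₁ z := fun z hz hz' => by
        rw [h5 z hz (by omega) (by omega), Function.update_of_ne (by omega),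
          Function.update_of_ne (by omega)]
      refine (Runs.seq (T₂ := 3) (runs_loadEntry (d := 78) m₂ 1) ?_).mono (by omega) fun _ h => h
      rintro m₃ ⟨h78, h6⟩
      rw [h5 64 (by decide) (by decide), hm₁.2.2.2.2.1,
        show 100 + 4 * (v : ℕ) + 1 = 101 + 4 * v by ring] at h78
      have e79 : m₃ 79 = j := by
        rw [h6 79 (by decide) (by decide) (by decide), h5 79 (by decide) (by decide), h79]
      have e73 : m₃ 73 = m 73 := by
        rw [h6 73 (by decide) (by decide) (by decide), h5 73 (by decide) (by decide),
          h3 73 (by decide) (by decide) (by decide) (by decide)]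
      have hX : ∀ w : Fin n, m₃ (101 + 4 * w) ≠ 0 ↔ I.Reach (p.withoutNth j) w := fun w => by
        rw [h6 _ (by omega) (by omega) (by omega), h4']
      have hfr : ∀ z, z < 100 → (z = 0 ∨ 51 < z) → z ≠ 78 → z ≠ 79 → m₃ z = m z :=
        fun z hz hz' h78 h79 => by
          rw [h6 z (by omega) (by omega) h78, h5 z hz hz', h3 z hz (by omega) (by omega) h79]
      have hv := h4' v
      rw [← h78] at hv
      refine Runs.cond (T := 2)
        (fun hc => Runs.cond (T := 1)
          (fun hc' => Runs.const_end (T := 0) ⟨fun w => ?_, ?_, fun z hz hz' hz1 hz2 hz3 => ?_⟩)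
          fun hc' => Runs.const_end (T := 0) ⟨fun w => ?_, ?_, fun z hz hz' hz1 hz2 hz3 => ?_⟩)
        fun hc => Runs.cond (T := 1)
          (fun hc' => Runs.const_end (T := 0) ⟨fun w => ?_, ?_, fun z hz hz' hz1 hz2 hz3 => ?_⟩)
          fun hc' => Runs.const_end (T := 0) ⟨fun w => ?_, ?_, fun z hz hz' hz1 hz2 hz3 => ?_⟩
      all_goals try rw [Function.update_of_ne (by omega), hX]
      all_goals try rw [Function.update_of_ne (by omega), hfr z hz hz' hz2 hz3]
      all_goals rw [e79] at hc
      · simp [RefutedAt, hc, hv.1 hc']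
      · have : ¬ I.Reach (p.withoutNth j) v := fun h => hv.2 h hc'
        simp [RefutedAt, hc, this, e73]
      · have := hv.1 hc'
        rw [hc, Finset.withoutNth_zero] at this
        simp [RefutedAt, hc, this, e73]
      · have : ¬ I.Reach (p.withoutNth j) v := fun h => hv.2 h hc'
        rw [hc, Finset.withoutNth_zero] at this
        simp [RefutedAt, hc, this]

end ColoredPathStar

namespace ColoredPathStar

variable {n : ℕ} {I : ColoredPathStar n} {v : Fin n} {L : List (Finset ℕ)} {b i : ℕ} {p : Finset ℕ}

lemma runs_minimalityTest {m : ℕ → ℕ} (hm : I.Header v L m) (hk : I.k ≤ b) (hn : n ≤ b)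
    (hi : i < L.length) (hmi : m 70 = i) (hpk : L[i].card ≤ I.k) :
    Runs (encodeInput I v L) RamProgram.minimalityTest m (700 * (b + 1) ^ 6) fun m' =>
      (∀ w : Fin n, m' (101 + 4 * w) ≠ 0 ↔ I.Reach L[i] w) ∧
      (m' 73 ≠ 0 ↔ I.NonMinimal v L[i]) ∧ m' 69 = 2 + 2 * n + i ∧
      ∀ z, z < 100 → (z = 0 ∨ 51 < z) → (z < 69 ∨ 79 < z ∨ z = 70) → m' z = m z := by
  have hrow := isColorRow_family I v L hi
  set p := L[i] with hp
  have h67 := hm.2.2.2.2.2.2.2.1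
  have htime : 9 + (p.card + 1) * (650 * (b + 1) ^ 5 + 4) ≤ 700 * (b + 1) ^ 6 := by
    have h1 : 1 ≤ (b + 1) ^ 6 := Nat.one_le_pow _ _ (by omega)
    have h2 : (b + 1) ^ 1 ≤ (b + 1) ^ 6 := Nat.pow_le_pow_right (by omega) (by norm_num)
    calc 9 + (p.card + 1) * (650 * (b + 1) ^ 5 + 4) ≤ 9 + (b + 1) * (650 * (b + 1) ^ 5 + 4) := by
          gcongr
          omega
      _ = 9 + 650 * (b + 1) ^ 6 + 4 * (b + 1) ^ 1 := by ring
      _ ≤ 700 * (b + 1) ^ 6 := by omega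
  refine (Runs.add (Runs.const (Runs.read (Runs.const (Runs.add (Runs.const (Runs.forLoop
    (Nv := p.card + 1) (τ := 650 * (b + 1) ^ 5)
    (fun j m₁ => (∀ w : Fin n, 0 < j →
        (m₁ (101 + 4 * w) ≠ 0 ↔ I.Reach (p.withoutNth (p.card + 1 - j)) w)) ∧
      (m₁ 73 ≠ 0 ↔ ∃ y < j, I.RefutedAt v p (p.card - y)) ∧ m₁ 69 = 2 + 2 * n + i ∧
      m₁ 75 = p.card + 1 ∧ m₁ 77 = p.card ∧
      ∀ z, z < 100 → (z = 0 ∨ 51 < z) → (z < 69 ∨ 79 < z ∨ z = 70) → m₁ z = m z)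
    (by decide) (by decide) (by decide) ?_ ?_ ?_ ?_))))))).mono (by omega) ?_
  · rintro j m₁ m₂ h ⟨h1, h2, h3, h4, h5, h6⟩
    refine ⟨fun w hj => ?_, ?_, (h _ (by decide) (by decide)).trans h3,
      (h _ (by decide) (by decide)).trans h4, (h _ (by decide) (by decide)).trans h5,
      fun z hz hz' hz'' => ?_⟩
    · rw [h _ (by omega) (by omega)]
      exact h1 w hj
    · rw [h _ (by omega) (by omega)]
      exact h2
    · rw [h _ (by omega) (by omega), h6 z hz hz' hz'']
  · rintro j m₁ ⟨h1, h2, h3, h4, h5, h6⟩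
    exact h4
  · have e77 : entry (encodeInput I v L) (m 67 + m 70) 0 = p.card := by
      rw [h67, hmi, hrow.entry_zero]
    refine ⟨fun w hj => absurd hj (by omega), by simp, by simp [h67, hmi], ?_, ?_,
      fun z hz hz' hz'' => ?_⟩
    · simp [e77, add_comm]
    · simp [e77]
    · simp (disch := omega) only [Function.update_of_ne]
  · rintro j m₁ hj ⟨h1, h2, h3, h4, h5, h6⟩ h72
    have hm₁ : I.Header v L m₁ := hm.congr fun z hz hz' => h6 z (by omega) (by omega) (by omega)
    refine (runs_reachStep hm₁ hk hn (h3 ▸ hrow) hpk h5).mono le_rfl ?_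
    rw [h72]
    rintro m₂ ⟨h7, h8, h9⟩
    refine ⟨(h9 72 (by decide) (by decide) (by decide) (by decide) (by decide)).trans h72,
      fun w _ => ?_, ?_, (h9 69 (by decide) (by decide) (by decide) (by decide) (by decide)).trans h3,
      (h9 75 (by decide) (by decide) (by decide) (by decide) (by decide)).trans h4,
      (h9 77 (by decide) (by decide) (by decide) (by decide) (by decide)).trans h5,
      fun z hz hz' hz'' => (h9 z hz hz' (by omega) (by omega) (by omega)).trans (h6 z hz hz' hz'')⟩
    · rw [h7, Nat.add_sub_add_right]
    · rw [h8, h2]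
      constructor
      · rintro (⟨y, hy, h⟩ | h)
        · exact ⟨y, by omega, h⟩
        · exact ⟨j, by omega, h⟩
      · rintro ⟨y, hy, h⟩
        by_cases hyj : y = j
        · exact Or.inr (hyj ▸ h)
        · exact Or.inl ⟨y, by omega, h⟩
  · rintro m₁ ⟨h1, h2, h3, h4, h5, h6⟩
    refine ⟨fun w => ?_, h2.trans exists_refutedAt_iff, h3, h6⟩
    rw [h1 w (by omega), Nat.sub_self, Finset.withoutNth_zero]

lemma runs_targetTest {m : ℕ → ℕ} (hm : I.Header v L m) (hk : I.k ≤ b) (hn : n ≤ b)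
    (hp : IsColorRow (encodeInput I v L) (m 69) p) (hpk : p.card ≤ I.k)
    (hX : ∀ w : Fin n, m (101 + 4 * w) ≠ 0 ↔ I.Reach p w) :
    Runs (encodeInput I v L) RamProgram.targetTest m (650 * (b + 1) ^ 5) fun m' =>
      (m' 80 ≠ 0 ↔ I.LinkedToTarget p) ∧
      ∀ z, z < 100 → (z = 0 ∨ 51 < z) → z ≠ 80 → m' z = m z := by
  have hpow : (b + 1) ^ 3 ≤ (b + 1) ^ 5 := Nat.pow_le_pow_right (by omega) (by norm_num)
  have hpow' : 1 ≤ (b + 1) ^ 5 := Nat.one_le_pow _ _ (by omega)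
  have hfill : 3 + n * (30 * (b + 1) ^ 2 + 40 + 4) ≤ 80 * (b + 1) ^ 3 := by
    calc 3 + n * (30 * (b + 1) ^ 2 + 40 + 4) ≤ 3 + (b + 1) * (30 * (b + 1) ^ 2 + 40 + 4) := by
          gcongr
          omega
      _ ≤ 80 * (b + 1) ^ 3 := by ring_nf; omega
  refine (Runs.seq (T₁ := 80 * (b + 1) ^ 3) (T₂ := 500 * (b + 1) ^ 5 + 10)
    ((runs_fill m hm.1 (S := I.Allowed p) (X := fun w => I.Allowed p w ∧ ∃ c ∈ I.χ w, c ∈ p)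
      (τ := 30 * (b + 1) ^ 2 + 40) ?_).mono hfill fun _ h => h) ?_).mono (by omega) fun _ h => h
  · intro w m₁ hw h1 h2
    have e69 := h1 69 (by decide) (by decide) (by decide)
    exact runs_linkCell (hm.congr (m' := m₁) fun z hz hz' => h1 z (by omega) (by omega) (by omega))
      hk w hw (e69 ▸ hp) hpk (by rw [h2 _ (by omega), hX])
  · rintro m₁ ⟨h1, h2, h3⟩
    have hm₁ : I.Header v L m₁ := hm.congr fun z hz hz' => h3 z (by omega) (by omega) (by omega)
    have hsize : ∀ w : Fin n, I.Allowed p w → entry (encodeInput I v L) (2 + n + w) 0 ≤ b :=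
      fun w hw => by
        rw [(isColorRow_vertex I v L w).entry_zero]
        exact hw.1.trans hk
    refine (Runs.const (Runs.add (Runs.const (Runs.seq (T₂ := 5) (runs_closure _ (n := n) (b := b)
      (A := I.Allowed p) (X := fun w => I.Allowed p w ∧ ∃ c ∈ I.χ w, c ∈ p)
      (E := I.Linked) ?_ hn ?_ ?_ ?_ ?_ ?_ ?_) ?_)))).mono (by omega) fun _ h => h
    · simp [hm₁.1]
    · simp [hm₁.2.2.2.2.2.2.2.2]
      omega
    · intro w
      simp (disch := omega) only [Function.update_of_ne, h1]
    · intro w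
      simp (disch := omega) only [Function.update_of_ne, h2]
    · intro u w
      simp [hm₁.2.2.2.2.2.2.1, ← edgeTest_one I v L]
    · simpa [hm₁.2.2.2.2.2.2.1] using hsize
    · simpa [hm₁.2.2.2.2.2.2.1] using fun w hw _ _ _ => hsize w hw
    · rintro m₂ ⟨h4, h5⟩
      have h4' : m₂ (101 + 4 * I.t) ≠ 0 ↔ I.LinkedToTarget p := by
        rw [h4 I.t]
        simp [hm₁.2.2.2.2.2.2.2.2, LinkedToTarget]
      replace h5 : ∀ z, z < 100 → (z = 0 ∨ 51 < z) → m₂ z = m z := fun z hz hz' => by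
        rw [h5 z hz (by omega) (by omega), Function.update_of_ne (by omega),
          Function.update_of_ne (by omega), Function.update_of_ne (by omega),
          h3 z hz (by omega) (by omega)]
      refine (runs_loadEntry (d := 80) m₂ 1).mono le_rfl ?_
      rintro m₃ ⟨h80, h6⟩
      rw [h5 63 (by decide) (by decide), hm.2.2.2.1,
        show 100 + 4 * (I.t : ℕ) + 1 = 101 + 4 * I.t by ring] at h80
      refine ⟨by rw [h80, h4'], fun z hz hz' h => ?_⟩
      rw [h6 z (by omega) (by omega) h, h5 z hz hz']

lemma runs_processSet {m : ℕ → ℕ} (hm : I.Header v L m) (hk : I.k ≤ b) (hn : n ≤ b)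
    (hi : i < L.length) (hmi : m 70 = i) (hpk : L[i].card ≤ I.k) :
    Runs (encodeInput I v L) RamProgram.processSet m (1400 * (b + 1) ^ 6) fun m' =>
      (I.NonMinimal v L[i] → m' 0 = i ∧ m' 81 ≠ 0) ∧
      (¬ I.NonMinimal v L[i] → m' 81 = m 81 ∧
        (m 81 ≠ 0 ∨ I.LinkedToTarget L[i] → m' 0 = m 0) ∧
        (m 81 = 0 → ¬ I.LinkedToTarget L[i] → m' 0 = i)) ∧
      ∀ z, 60 ≤ z → z < 69 ∨ z = 70 → m' z = m z := by
  have hpow : (b + 1) ^ 5 ≤ (b + 1) ^ 6 := Nat.pow_le_pow_right (by omega) (by norm_num)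
  have hpow' : 1 ≤ (b + 1) ^ 6 := Nat.one_le_pow _ _ (by omega)
  refine (Runs.seq (runs_minimalityTest hm hk hn hi hmi hpk) (T₂ := 650 * (b + 1) ^ 5 + 6) ?_).mono
    (by omega) fun _ h => h
  rintro m₁ ⟨h1, h2, h3, h4⟩
  refine Runs.seq (runs_targetTest (hm.congr fun z hz hz' => h4 z (by omega) (by omega) (by omega))
    hk hn (h3 ▸ isColorRow_family I v L hi) hpk h1) ?_
  rintro m₂ ⟨h5, h6⟩
  have e0 : m₂ 0 = m 0 := by
    rw [h6 0 (by decide) (by decide) (by decide), h4 0 (by decide) (by decide) (by decide)]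
  have e81 : m₂ 81 = m 81 := by
    rw [h6 81 (by decide) (by decide) (by decide), h4 81 (by decide) (by decide) (by decide)]
  have e70 : m₂ 70 = i := by
    rw [h6 70 (by decide) (by decide) (by decide), h4 70 (by decide) (by decide) (by decide), hmi]
  have e73 : m₂ 73 ≠ 0 ↔ I.NonMinimal v L[i] := by
    rw [h6 73 (by decide) (by decide) (by decide), h2]
  have hfr : ∀ z, 60 ≤ z → z < 69 ∨ z = 70 → m₂ z = m z := fun z hz hz' => by
    rw [h6 z (by omega) (by omega) (by omega), h4 z (by omega) (by omega) (by omega)]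
  refine (Runs.const (T := 5) (Runs.cond (T := 4) (fun hc => ?_) fun hc => Runs.cond (T := 3)
    (fun hc' => ?_) fun hc' => Runs.cond (T := 2) (fun hc₂ => ?_) fun hc₂ => ?_)).mono (by omega)
    fun _ h => h
  all_goals rw [Function.update_of_ne (by decide)] at hc
  · have h := e73.1 hc
    refine Runs.const (Runs.add_end ⟨fun _ => ?_, fun h' => absurd h h', fun z hz hz' => ?_⟩)
    · simp [e70]
    · simp (disch := omega) only [Function.update_of_ne, hfr]
  all_goals
    rw [Function.update_of_ne (by decide), e81] at hc'
    have h : ¬ I.NonMinimal v L[i] := fun h => e73.2 h hc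
  · refine Runs.const_end ⟨fun h' => absurd h' h, fun _ => ⟨?_, ?_, ?_⟩, fun z hz hz' => ?_⟩
    · simp [e81]
    · simp [e0]
    · exact fun h' => absurd h' hc'
    · simp (disch := omega) only [Function.update_of_ne, hfr]
  all_goals rw [Function.update_of_ne (by decide)] at hc₂
  · refine Runs.const_end ⟨fun h' => absurd h' h, fun _ => ⟨?_, ?_, ?_⟩, fun z hz hz' => ?_⟩
    · simp [e81]
    · simp [e0]
    · exact fun _ h' => absurd (h5.1 hc₂) h'
    · simp (disch := omega) only [Function.update_of_ne, hfr]
  · refine Runs.add_end ⟨fun h' => absurd h' h, fun _ => ⟨?_, ?_, ?_⟩, fun z hz hz' => ?_⟩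
    · simp [e81]
    · rintro (h' | h')
      · exact absurd hc' h'
      · exact absurd hc₂ (h5.2 h')
    · simp [e70]
    · simp (disch := omega) only [Function.update_of_ne, hfr]

lemma runs_readHeader :
    Runs (encodeInput I v L) RamProgram.readHeader (fun _ => 0) 16 fun m' =>
      I.Header v L m' ∧ m' 81 = 0 := by
  obtain ⟨h0, h1, h2, h3, h4, h5⟩ := encodeInput_header I v L
  refine Runs.read (Runs.const (Runs.read (Runs.const (Runs.read (Runs.const (Runs.read
    (Runs.const (Runs.read (Runs.const (Runs.read (Runs.const (Runs.add (Runs.add (Runs.add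
      (Runs.add_end ?_)))))))))))))))
  simp [Header, h0, h1, h2, h3, h4, h5]
  omega

/-- The set number `j` is not minimal, or it is not linked to `t` and all sets are minimal. -/
def Redundant (I : ColoredPathStar n) (v : Fin n) (L : List (Finset ℕ)) (j : ℕ) : Prop :=
  ∃ h : j < L.length, I.NonMinimal v L[j] ∨
    ((∀ p ∈ L, ¬ I.NonMinimal v p) ∧ ¬ I.LinkedToTarget L[j])

lemma runs_findRedundantSet (hk : I.k ≤ b) (hn : n ≤ b) (hL : L.length ≤ b)
    (hcard : ∀ p ∈ L, p.card ≤ I.k) (hex : ∃ j, I.Redundant v L j) :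
    Runs (encodeInput I v L) RamProgram.findRedundantSet (fun _ => 0) (1500 * (b + 1) ^ 7) fun m' =>
      I.Redundant v L (m' 0) := by
  have htime : 19 + L.length * (1400 * (b + 1) ^ 6 + 4) ≤ 1500 * (b + 1) ^ 7 := by
    have h1 : 1 ≤ (b + 1) ^ 7 := Nat.one_le_pow _ _ (by omega)
    have h2 : (b + 1) ^ 1 ≤ (b + 1) ^ 7 := Nat.pow_le_pow_right (by omega) (by norm_num)
    calc 19 + L.length * (1400 * (b + 1) ^ 6 + 4) ≤ 19 + (b + 1) * (1400 * (b + 1) ^ 6 + 4) := by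
          gcongr
          omega
      _ = 19 + 1400 * (b + 1) ^ 7 + 4 * (b + 1) ^ 1 := by ring
      _ ≤ 1500 * (b + 1) ^ 7 := by omega
  refine (Runs.seq runs_readHeader (T₂ := 3 + L.length * (1400 * (b + 1) ^ 6 + 4))
    fun m hm => ?_).mono (by omega) fun _ h => h
  obtain ⟨hm, h81⟩ := hm
  refine (Runs.forLoop (Nv := L.length) (τ := 1400 * (b + 1) ^ 6)
    -- The flag in cell `81` records that a nonminimal set was seen, and then the output is such a
    -- set. Without it, all sets so far are minimal and the output is unlinked as soon as one of
    -- them is.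
    (fun j m₁ => I.Header v L m₁ ∧
      (m₁ 81 ≠ 0 → ∃ h : m₁ 0 < L.length, I.NonMinimal v L[m₁ 0]) ∧
      (m₁ 81 = 0 → ∀ y, ∀ h : y < L.length, y < j →
        ¬ I.NonMinimal v L[y] ∧
          (¬ I.LinkedToTarget L[y] → ∃ h : m₁ 0 < L.length, ¬ I.LinkedToTarget L[m₁ 0])))
    (by decide) (by decide) (by decide) ?_ ?_ ?_ ?_).mono le_rfl ?_
  · rintro j m₁ m₂ h ⟨h1, h2, h3⟩
    have e0 := h 0 (by decide) (by decide)
    have e81 := h 81 (by decide) (by decide)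
    refine ⟨h1.congr fun z hz hz' => h z (by omega) (by omega), ?_⟩
    simp only [e0, e81]
    exact ⟨h2, h3⟩
  · rintro j m₁ ⟨h1, h2, h3⟩
    exact h1.2.1
  · exact ⟨hm, fun h => absurd h81 h, fun _ y _ hy => absurd hy (by omega)⟩
  · rintro j m₁ hj ⟨h1, h2, h3⟩ h70
    refine (runs_processSet h1 hk hn hj h70 (hcard _ (List.getElem_mem _))).mono le_rfl ?_
    rintro m₂ ⟨h4, h5, h6⟩
    refine ⟨(h6 70 (by decide) (by decide)).trans h70,
      h1.congr fun z hz hz' => h6 z hz (by omega), fun h => ?_, fun h y hyL hy => ?_⟩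
    · by_cases hN : I.NonMinimal v L[j]
      · simp only [(h4 hN).1]
        exact ⟨hj, hN⟩
      · obtain ⟨h7, h8, -⟩ := h5 hN
        rw [h7] at h
        simp only [h8 (Or.inl h)]
        exact h2 h
    · have hN : ¬ I.NonMinimal v L[j] := fun hN => (h4 hN).2 h
      obtain ⟨h7, h8, h9⟩ := h5 hN
      rw [h7] at h
      have key : ¬ I.LinkedToTarget L[j] →
          ∃ h : m₂ 0 < L.length, ¬ I.LinkedToTarget L[m₂ 0] := fun hl => by
        simp only [h9 h hl]
        exact ⟨hj, hl⟩
      by_cases hyj : y = j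
      · subst hyj
        exact ⟨hN, key⟩
      · obtain ⟨h10, h11⟩ := h3 h y hyL (by omega)
        refine ⟨h10, fun hl => ?_⟩
        by_cases hlj : I.LinkedToTarget L[j]
        · simp only [h8 (Or.inr hlj)]
          exact h11 hl
        · exact key hlj
  · rintro m₁ ⟨h1, h2, h3⟩
    by_cases h : m₁ 81 = 0
    · have hmin : ∀ p ∈ L, ¬ I.NonMinimal v p := fun p hp => by
        obtain ⟨y, hy, rfl⟩ := List.getElem_of_mem hp
        exact (h3 h y hy hy).1
      obtain ⟨j, hj, hR⟩ := hex
      obtain ⟨h4, h5⟩ := (h3 h j hj hj).2 (hR.resolve_left (hmin _ (List.getElem_mem _))).2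
      exact ⟨h4, Or.inr ⟨hmin, h5⟩⟩
    · obtain ⟨h4, h5⟩ := h2 h
      exact ⟨h4, Or.inl h5⟩

/-- A nonminimal set has nothing to be represented for, and the other sets represent themselves; an
unlinked set is replaced by any other one. -/
lemma Redundant.kRepresents (hI : I.Irreducible) {l : ℕ} (hnd : L.Nodup)
    (hcard : ∀ p ∈ L, p.card = l) (hdis : ∀ p ∈ L, ∀ p' ∈ L, p ≠ p' → Disjoint p p')
    (hL : 1 < L.length) {j : ℕ} (hj : j < L.length) (h : I.Redundant v L j) :
    I.KRepresents (L.toFinset.erase L[j]) L.toFinset v := by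
  obtain ⟨_, h | ⟨h1, h2⟩⟩ := h
  · intro q hq Q hQ
    refine ⟨q, Finset.mem_erase.2 ⟨?_, hq⟩, hQ.1.2.1, le_rfl, hQ.1.1⟩
    rintro rfl
    exact h.not_minimallyCompletes Q hQ
  · exact I.kRepresents_erase hI (l := l) (by simpa using hcard) (by simpa using hdis)
      (by rwa [List.toFinset_card_of_nodup hnd]) (by simpa using h1) (by simp) h2

end ColoredPathStar

/-! ### The bound and the conclusion -/

/-- For `k ≥ 2`, `20 * (k + 1) ^ 2 ≤ 45 * k ^ 2`, while `100 * log k ≥ 100 * log 2 > 69`. -/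
lemma two_pow_sq_le (k : ℕ) (hk : 2 ≤ k) :
    (((2 : ℕ) ^ (20 * (k + 1) ^ 2) : ℕ) : ℝ) ≤
      (2 : ℝ) ^ ((100 : ℝ) * ((k : ℝ) ^ 2 * Real.log (k : ℝ))) := by
  have hk' : (2 : ℝ) ≤ k := by exact_mod_cast hk
  have hlog : 0.69 ≤ Real.log k :=
    (by have := Real.log_two_gt_d9; linarith : (0.69 : ℝ) ≤ Real.log 2).trans
      (Real.log_le_log (by norm_num) hk')
  push_cast
  rw [← Real.rpow_natCast]
  refine Real.rpow_le_rpow_of_exponent_le (by norm_num) ?_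
  push_cast
  have h1 : (k : ℝ) ^ 2 * 0.69 ≤ (k : ℝ) ^ 2 * Real.log k := by gcongr
  nlinarith

theorem mainTheorem4 :
    ∃ f : ℕ → ℕ,
      (∃ c : ℝ, ∀ k : ℕ, 2 ≤ k →
        (f k : ℝ) ≤ (2 : ℝ) ^ (c * ((k : ℝ) ^ 2 * Real.log (k : ℝ)))) ∧
      ∃ (A : RamProgram) (q : Polynomial ℕ),
        ∀ (n : ℕ) (I : ColoredPathStar n) (v : Fin n) (l : ℕ) (L : List (Finset ℕ)),
          I.Irreducible →
          l ≤ I.k →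
          L.Nodup →
          (∀ p ∈ L, p.card = l) →
          (∀ p ∈ L, I.SReachable p) →
          (∀ p ∈ L, ∀ p' ∈ L, p ≠ p' → Disjoint p p') →
          f I.k < L.length →
          ∃ (T : ℕ) (m : ℕ → ℕ),
            RamExec (encodeInput I v L) A (fun _ => 0) T m ∧
            T ≤ q.eval (L.length + n) ∧
            ∃ h : m 0 < L.length,
              I.KRepresents (L.toFinset.erase L[m 0]) L.toFinset v := by
  classical
  refine ⟨fun k => 2 ^ (20 * (k + 1) ^ 2), ⟨100, two_pow_sq_le⟩, RamProgram.findRedundantSet,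
    1500 * (Polynomial.X + 1) ^ 7, ?_⟩
  intro n I v l L hI hl hnd hcard _ hdis hL
  simp only at hL
  have hex : ∃ j, I.Redundant v L j := by
    by_cases hmin : ∀ p ∈ L, ¬ I.NonMinimal v p
    · obtain ⟨p, hp, h⟩ := I.exists_not_linkedToTarget (v := v) (L := L.toFinset) hI hl
        (by simpa using hcard) (by simpa using hdis) (by simpa using hmin)
        (by rwa [List.toFinset_card_of_nodup hnd])
      obtain ⟨j, hj, rfl⟩ := List.getElem_of_mem (List.mem_toFinset.1 hp)
      exact ⟨j, hj, Or.inr ⟨hmin, h⟩⟩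
    · push Not at hmin
      obtain ⟨p, hp, h⟩ := hmin
      obtain ⟨j, hj, rfl⟩ := List.getElem_of_mem hp
      exact ⟨j, hj, Or.inl h⟩
  -- Since `k` is below the size of the family, `L.length + n` bounds all parameters of the running
  -- time.
  have hk : I.k < 2 ^ (20 * (I.k + 1) ^ 2) :=
    Nat.lt_two_pow_self.trans_le (Nat.pow_le_pow_right (by norm_num) (by nlinarith))
  obtain ⟨T, m, hT, hle, hred⟩ := ColoredPathStar.runs_findRedundantSet (I := I) (v := v) (L := L)
    (b := L.length + n) (by omega) (by omega) (by omega) (fun p hp => (hcard p hp).trans_le hl) hex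
  refine ⟨T, m, hT, by simpa using hle, hred.1, ?_⟩
  exact hred.kRepresents hI hnd hcard hdis (by omega) hred.1
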